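/- **Setting.** Let $B$ be a unital complex Banach algebra. A *Banach $B$-$B$-non-commutative probability space* is a triple $(\mathcal A,E,\varepsilon)$ where $\mathcal A$ is a unital complex Banach algebra, $\varepsilon:B\otimes B^{\mathrm{op}}\to\mathcal A$ is a unital homomorphism, and $E:\mathcal A\to B$ is a bounded linear map with $E(1)=1$ such that, writing $L_b=\varepsilon(b\otimes 1)$ and $R_b=\varepsilon(1\otimes b)$, the maps $b\mapsto L_b$ and $b\mapsto R_b$ are injective and bounded, and $E(L_{b_1}R_{b_2}Z)=b_1E(Z)b_2$, $E(ZL_b)=E(ZR_b)$ for all $b,b_1,b_2\in B$, $Z\in\mathcal A$. Put $\mathcal A_\ell=\{Z: ZR_b=R_bZ\ \forall b\in B\}$ and $\mathcal A_r=\{Z: ZL_b=L_bZ\ \forall b\in B\}$. **Cumulants.** For $\chi:\{1,\dots,n\}\to\{\ell,r\}$ let $\prec_\chi$ be the total order on $\{1,\dots,n\}$ that lists $\chi^{-1}(\ell)$ increasingly and then $\chi^{-1}(r)$ decreasingly, and let $BNC(\chi)$ be the set of partitions of $\{1,\dots,n\}$ that are non-crossing with respect to $\prec_\chi$, ordered by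 refinement, with largest element $1_\chi$ and Möbius function $\mu_{BNC}$. For $\pi\in BNC(\chi)$ and $Z_k\in\mathcal A_{\chi(k)}$ let $E^B_\pi(Z_1,\dots,Z_n)\in B$ be the bi-free moment function, i.e. the bi-multiplicative function with $E^B_{1_\chi}(Z_1,\dots,Z_n)=E(Z_1\cdots Z_n)$. Explicitly, with value $1$ for the empty partition, it is given by the following recursion: if $V$ is the block containing the $\prec_\chi$-smallest index, replace, for each $k\in V$ that is not the $\prec_\chi$-largest element of $V$, the operator $Z_k$ by $Z_kL_a$ if $\chi(k)=\ell$ and by $R_aZ_k$ if $\chi(k)=r$, where $a$ is the value of $E^B$ on the restriction of $\pi$ to the indices strictly between $k$ and the $\prec_\chi$-next element of $V$; then $E^B_\pi(Z_1,\dots,Z_n)$ is $E$ of the product, in the usual order of the indices, of the so modified $Z_k$, $k\in V$, multiplied on the right by the value of $E^B$ on the restriction of $\pi$ to the indices $\prec_\chi$-after all of $V$. Put $$\kappa^B_\chi(Z_1,\dots,Z_n)=\sum_{\sigma\in BNC(\chi)}\mu_{BNC}(\sigma,1_\chi)\,E^B_\sigma(Z_1,\dots,Z_n).$$ Let $\chi_{n,m}:\{1,\dots,n+m\}\to\{\ell,r\}$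 be $\ell$ on the first $n$ indices and $r$ on the last $m$. **Series.** For $X\in\mathcal A_\ell$, $Y\in\mathcal A_r$ and $b,c,d\in B$ let $$M^\ell_X(b)=1+\sum_{n\ge1}E((L_bX)^n),\qquad M^r_Y(d)=1+\sum_{n\ge1}E((R_dY)^n),\qquad M_{X,Y}(b,c,d)=\sum_{n,m\ge0}E((L_bX)^n(R_dY)^mR_c),$$ $$C_{X,Y}(b,c,d)=c+\sum_{n\ge1}\kappa^B_{\chi_{n,0}}(\underbrace{L_bX,\dots,L_bX}_{n-1},L_bXL_c)+\sum_{m\ge1,\,n\ge0}\kappa^B_{\chi_{n,m}}(\underbrace{L_bX,\dots,L_bX}_{n},\underbrace{R_dY,\dots,R_dY}_{m-1},R_dYR_c).$$ **Theorem.** Let $(\mathcal A,E,\varepsilon)$ be a Banach $B$-$B$-non-commutative probability space, $X\in\mathcal A_\ell$ and $Y\in\mathcal A_r$. There is $\delta>0$ such that for all $b,c,d\in B$ with $\|b\|<\delta$ and $\|d\|<\delta$ the series $M^\ell_X(b)$, $M^r_Y(d)$, $M_{X,Y}(b,c,d)$, $C_{X,Y}(b,c,d)$ and $C_{X,Y}\big(M^\ell_X(b)b,\,M_{X,Y}(b,c,d),\,dM^r_Y(d)\big)$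 converge absolutely, and $$M^\ell_X(b)M_{X,Y}(b,c,d)+M_{X,Y}(b,c,d)M^r_Y(d)=M^\ell_X(b)\,c\,M^r_Y(d)+C_{X,Y}\big(M^\ell_X(b)b,\;M_{X,Y}(b,c,d),\;dM^r_Y(d)\big).$$ -/

import Mathlib

open scoped TensorProduct

noncomputable section

namespace BiFree

/-! ### Bi-non-crossing partitions -/

/-- The labels `ℓ` and `r`. -/
inductive Side where
  | left
  | right

/-- A key realising the order `≺_χ`: the left indices in increasing order come first, followed by
the right indices in decreasing order. -/
def chiKey {n : ℕ} (χ : Fin n → Side) (k : Fin n) : ℕ :=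
  match χ k with
  | Side.left => (k : ℕ)
  | Side.right => 2 * n - (k : ℕ)

/-- The strict order `i ≺_χ j`. -/
def Prec {n : ℕ} (χ : Fin n → Side) (i j : Fin n) : Prop :=
  chiKey χ i < chiKey χ j

/-- `π` (a partition of the indices, given as an equivalence relation) is bi-non-crossing with
respect to `χ`. -/
def IsBiNonCrossing {n : ℕ} (χ : Fin n → Side) (π : Setoid (Fin n)) : Prop :=
  ∀ u₁ v₁ u₂ v₂ : Fin n, Prec χ u₁ v₁ → Prec χ v₁ u₂ → Prec χ u₂ v₂ →
    π u₁ u₂ → π v₁ v₂ → π u₁ v₁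

/-- `BNC(χ)`, ordered by refinement (`π ≤ σ` when every block of `π` lies in a block of `σ`). -/
abbrev BNC {n : ℕ} (χ : Fin n → Side) : Type :=
  {π : Setoid (Fin n) // IsBiNonCrossing χ π}

/-- The maximal element `1_χ`, with a single block. -/
def BNC.one {n : ℕ} (χ : Fin n → Side) : BNC χ :=
  ⟨⊤, fun _ _ _ _ _ _ _ _ _ => trivial⟩

instance BNC.instFinite {n : ℕ} (χ : Fin n → Side) : Finite (BNC χ) :=
  Finite.of_injective (fun (π : BNC χ) (i j : Fin n) => π.1 i j) (fun _ _ h =>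
    Subtype.ext (Setoid.ext (fun i j => iff_of_eq (congrFun (congrFun h i) j))))

instance BNC.instFintype {n : ℕ} (χ : Fin n → Side) : Fintype (BNC χ) :=
  Fintype.ofFinite _

open Classical in
instance BNC.instLocallyFiniteOrder {n : ℕ} (χ : Fin n → Side) : LocallyFiniteOrder (BNC χ) :=
  Fintype.toLocallyFiniteOrder

open Classical in
/-- The bi-non-crossing Möbius function: the Möbius function of the poset `BNC(χ)`. -/
def muBNC {n : ℕ} {χ : Fin n → Side} (σ π : BNC χ) : ℂ :=
  IncidenceAlgebra.mu ℂ σ π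

/-- The map `χ_{n,m}`: `n` left indices followed by `m` right indices. -/
def chi (n m : ℕ) : Fin (n + m) → Side :=
  fun k => if (k : ℕ) < n then Side.left else Side.right

/-! ### `B`-`B`-non-commutative probability spaces -/

/-- A `B`-`B`-non-commutative probability space `(A, E, ε)`. -/
structure BBSpace (B A : Type*) [Ring B] [Algebra ℂ B] [Ring A] [Algebra ℂ A] where
  ε : B ⊗[ℂ] Bᵐᵒᵖ →ₐ[ℂ] A
  E : A →ₗ[ℂ] B
  injective_left : Function.Injective (fun b : B => ε (b ⊗ₜ[ℂ] (1 : Bᵐᵒᵖ)))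
  injective_right : Function.Injective (fun b : B => ε ((1 : B) ⊗ₜ[ℂ] MulOpposite.op b))
  E_one : E 1 = 1
  E_bimodule : ∀ (b₁ b₂ : B) (Z : A),
    E (ε (b₁ ⊗ₜ[ℂ] MulOpposite.op b₂) * Z) = b₁ * E Z * b₂
  E_left_eq_right : ∀ (b : B) (Z : A),
    E (Z * ε (b ⊗ₜ[ℂ] (1 : Bᵐᵒᵖ))) = E (Z * ε ((1 : B) ⊗ₜ[ℂ] MulOpposite.op b))

namespace BBSpace

section Algebraic

variable {B A : Type*} [Ring B] [Algebra ℂ B] [Ring A] [Algebra ℂ A]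

/-- `L_b = ε(b ⊗ 1)`. -/
def L (S : BBSpace B A) (b : B) : A := S.ε (b ⊗ₜ[ℂ] (1 : Bᵐᵒᵖ))

/-- `R_b = ε(1 ⊗ b)`. -/
def R (S : BBSpace B A) (b : B) : A := S.ε ((1 : B) ⊗ₜ[ℂ] MulOpposite.op b)

/-- The left algebra `A_ℓ`. -/
def leftAlgebra (S : BBSpace B A) : Subalgebra ℂ A :=
  Subalgebra.centralizer ℂ (Set.range S.R)

/-- The right algebra `A_r`. -/
def rightAlgebra (S : BBSpace B A) : Subalgebra ℂ A :=
  Subalgebra.centralizer ℂ (Set.range S.L)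

end Algebraic

end BBSpace

/-! ### The moment and cumulant functions -/

section Blocks

open Classical in
/-- The part in `T` of the block of `π` that contains the `≺_χ`-smallest element of `T`. -/
def firstBlock {n : ℕ} (χ : Fin n → Side) (π : Setoid (Fin n)) (T : Finset (Fin n)) :
    Finset (Fin n) :=
  T.filter (fun k => ∃ p ∈ T, (∀ j ∈ T, ¬ Prec χ j p) ∧ π p k)

open Classical in
/-- The elements of `T` strictly between `k` and the `≺_χ`-next element of the first block `V` of
`T` (empty if `k` is the `≺_χ`-largest element of `V`). -/
def gap {n : ℕ} (χ : Fin n → Side) (π : Setoid (Fin n)) (T : Finset (Fin n)) (k : Fin n) :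
    Finset (Fin n) :=
  (T \ firstBlock χ π T).filter (fun j => Prec χ k j ∧ (∃ v ∈ firstBlock χ π T, Prec χ j v) ∧
    ∀ v ∈ firstBlock χ π T, Prec χ k v → Prec χ j v)

open Classical in
/-- The elements of `T` that come `≺_χ`-after all of the first block of `T`. -/
def rest {n : ℕ} (χ : Fin n → Side) (π : Setoid (Fin n)) (T : Finset (Fin n)) :
    Finset (Fin n) :=
  (T \ firstBlock χ π T).filter (fun j => ∀ v ∈ firstBlock χ π T, Prec χ v j)

theorem firstBlock_nonempty {n : ℕ} (χ : Fin n → Side) (π : Setoid (Fin n))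
    {T : Finset (Fin n)} (hT : T ≠ ∅) : (firstBlock χ π T).Nonempty := by
  obtain ⟨p, hp, hmin⟩ := T.exists_min_image (chiKey χ) (Finset.nonempty_iff_ne_empty.mpr hT)
  refine ⟨p, ?_⟩
  simp only [firstBlock, Finset.mem_filter]
  exact ⟨hp, p, hp, fun j hj => not_lt.mpr (hmin j hj), π.refl p⟩

theorem card_sdiff_firstBlock_lt {n : ℕ} (χ : Fin n → Side) (π : Setoid (Fin n))
    {T : Finset (Fin n)} (hT : T ≠ ∅) : (T \ firstBlock χ π T).card < T.card := by
  obtain ⟨p, hp⟩ := firstBlock_nonempty χ π hT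
  refine Finset.card_lt_card ⟨Finset.sdiff_subset, fun h => ?_⟩
  have hpT : p ∈ T := by
    simp only [firstBlock, Finset.mem_filter] at hp
    exact hp.1
  exact (Finset.mem_sdiff.mp (h hpT)).2 hp

open Classical in
theorem card_gap_lt {n : ℕ} (χ : Fin n → Side) (π : Setoid (Fin n))
    {T : Finset (Fin n)} (hT : T ≠ ∅) (k : Fin n) : (gap χ π T k).card < T.card :=
  lt_of_le_of_lt (Finset.card_filter_le _ _) (card_sdiff_firstBlock_lt χ π hT)

open Classical in
theorem card_rest_lt {n : ℕ} (χ : Fin n → Side) (π : Setoid (Fin n))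
    {T : Finset (Fin n)} (hT : T ≠ ∅) : (rest χ π T).card < T.card :=
  lt_of_le_of_lt (Finset.card_filter_le _ _) (card_sdiff_firstBlock_lt χ π hT)

end Blocks

namespace BBSpace

section Functions

variable {B A : Type*} [Ring B] [Algebra ℂ B] [Ring A] [Algebra ℂ A]

/-- Multiply `Z` by the element `b` of `B` that sits `≺_χ`-directly after it:
`Z L_b` for a left operator, `R_b Z` for a right operator. -/
def insertAfter (S : BBSpace B A) (s : Side) (Z : A) (b : B) : A :=
  match s with
  | Side.left => Z * S.L b
  | Side.right => S.R b * Z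

/-- The operator-valued bi-free moment function of the restriction of `π` to `T`, computed by the
reduction rules of a bi-multiplicative function whose value on a single block is `E` of the product
in the given order.  The first block `V` of `T` and whatever is nested in it form an initial
`≺_χ`-interval, which splits off as a left factor; each gap of `V` is replaced by its value in `B`,
which is attached to the element of `V` directly before the gap. -/
def momentOn (S : BBSpace B A) {n : ℕ} (χ : Fin n → Side) (π : Setoid (Fin n)) (Z : Fin n → A)
    (T : Finset (Fin n)) : B :=
  open Classical in
  if hT : T = ∅ then 1
  else
    S.E (((firstBlock χ π T).sort (· ≤ ·)).map
        (fun k => S.insertAfter (χ k) (Z k) (S.momentOn χ π Z (gap χ π T k)))).prod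
      * S.momentOn χ π Z (rest χ π T)
termination_by T.card
decreasing_by
  · exact card_gap_lt χ π hT k
  · exact card_rest_lt χ π hT

/-- The operator-valued bi-free moment function `E^B_π(Z₁, …, Zₙ)`. -/
def moment (S : BBSpace B A) {n : ℕ} {χ : Fin n → Side} (π : BNC χ) (Z : Fin n → A) : B :=
  S.momentOn χ π.1 Z Finset.univ

open Classical in
/-- The operator-valued bi-free cumulant function `κ^B_π(Z₁, …, Zₙ)`. -/
def cumulant (S : BBSpace B A) {n : ℕ} {χ : Fin n → Side} (π : BNC χ) (Z : Fin n → A) : B :=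
  ∑ σ : BNC χ with σ ≤ π, muBNC σ π • S.moment σ Z

/-- `κ^B_χ = κ^B_{1_χ}`. -/
def kappa (S : BBSpace B A) {n : ℕ} (χ : Fin n → Side) (Z : Fin n → A) : B :=
  S.cumulant (BNC.one χ) Z

/-! ### The terms of the series -/

/-- `κ_{χ_{n,0}}(L_b X, …, L_b X, L_b X L_c)`, with `n` entries. -/
def leftTerm (S : BBSpace B A) (X : A) (b c : B) (n : ℕ) : B :=
  S.kappa (chi n 0) (fun k => if (k : ℕ) + 1 = n then S.L b * X * S.L c else S.L b * X)

/-- `κ_{χ_{n,m}}(L_b X, …, L_b X, R_d Y, …, R_d Y, R_d Y R_c)`, with `n` left entries and `m` right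
entries (used for `m ≥ 1`). -/
def mixedTerm (S : BBSpace B A) (X Y : A) (b c d : B) (n m : ℕ) : B :=
  S.kappa (chi n m) (fun k =>
    if (k : ℕ) < n then S.L b * X
    else if (k : ℕ) + 1 = n + m then S.R d * Y * S.R c else S.R d * Y)

end Functions

section Banach

variable {B A : Type*} [NormedRing B] [NormedAlgebra ℂ B] [NormedRing A] [NormedAlgebra ℂ A]

/-- The boundedness requirements in a Banach `B`-`B`-non-commutative probability space. -/
structure IsBanach (S : BBSpace B A) : Prop where
  E_bounded : ∃ K : ℝ, ∀ Z : A, ‖S.E Z‖ ≤ K * ‖Z‖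
  L_bounded : ∃ K : ℝ, ∀ b : B, ‖S.L b‖ ≤ K * ‖b‖
  R_bounded : ∃ K : ℝ, ∀ b : B, ‖S.R b‖ ≤ K * ‖b‖

/-- `M^ℓ_X(b) = 1 + ∑_{n ≥ 1} E((L_b X)^n)`. -/
def Ml (S : BBSpace B A) (X : A) (b : B) : B :=
  1 + ∑' n : ℕ, S.E ((S.L b * X) ^ (n + 1))

/-- `M^r_Y(d) = 1 + ∑_{n ≥ 1} E((R_d Y)^n)`. -/
def Mr (S : BBSpace B A) (Y : A) (d : B) : B :=
  1 + ∑' n : ℕ, S.E ((S.R d * Y) ^ (n + 1))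

/-- `M_{X,Y}(b,c,d) = ∑_{n,m ≥ 0} E((L_b X)^n (R_d Y)^m R_c)`. -/
def M (S : BBSpace B A) (X Y : A) (b c d : B) : B :=
  ∑' p : ℕ × ℕ, S.E ((S.L b * X) ^ p.1 * (S.R d * Y) ^ p.2 * S.R c)

/-- The cumulant series `C_{X,Y}(b,c,d)`. -/
def C (S : BBSpace B A) (X Y : A) (b c d : B) : B :=
  c + ∑' n : ℕ, S.leftTerm X b c (n + 1)
    + ∑' p : ℕ × ℕ, S.mixedTerm X Y b c d p.1 (p.2 + 1)

/-- Absolute convergence of the series `M^ℓ_X(b)`. -/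
def MlConverges (S : BBSpace B A) (X : A) (b : B) : Prop :=
  Summable fun n : ℕ => ‖S.E ((S.L b * X) ^ (n + 1))‖

/-- Absolute convergence of the series `M^r_Y(d)`. -/
def MrConverges (S : BBSpace B A) (Y : A) (d : B) : Prop :=
  Summable fun n : ℕ => ‖S.E ((S.R d * Y) ^ (n + 1))‖

/-- Absolute convergence of the series `M_{X,Y}(b,c,d)`. -/
def MConverges (S : BBSpace B A) (X Y : A) (b c d : B) : Prop :=
  Summable fun p : ℕ × ℕ => ‖S.E ((S.L b * X) ^ p.1 * (S.R d * Y) ^ p.2 * S.R c)‖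

/-- Absolute convergence of the two series in `C_{X,Y}(b,c,d)`. -/
def CConverges (S : BBSpace B A) (X Y : A) (b c d : B) : Prop :=
  (Summable fun n : ℕ => ‖S.leftTerm X b c (n + 1)‖) ∧
    Summable fun p : ℕ × ℕ => ‖S.mixedTerm X Y b c d p.1 (p.2 + 1)‖

end Banach

end BBSpace

end BiFree

end

open scoped TensorProduct

namespace BiFree

/-! ### Möbius inversion with values in a module -/

section Moebius

variable {α 𝕜 E : Type*} [Fintype α] [PartialOrder α] [LocallyFiniteOrder α]
  [DecidableEq α] [DecidableLE α] [Ring 𝕜]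
  [AddCommGroup E] [Module 𝕜 E]

/-! List the letters of a word `w` in the order `≺_χ` and let `P_j(w)` (`partialCumulant`) be the
sum of the cumulants `κ_π(w)` over all bi-non-crossing `π` with the first `j` letters in one block.
Then `P_1(w)` is the moment of `w` and `P_{|w|}(w)` is its full cumulant. Sorting the partitions by
the number `s` of letters between the `j`-th letter and the next letter of its block gives `P_j(w) =
∑_s P_{j+1}(w_s) + P_j(w_∞)` (`Admissible.partialCumulant_eq`). Here `w_s` arises by turning the `s`
letters after the `j`-th one into their moment, attached to the `j`-th letter as a coefficient, and
`w_∞` does this with all remaining letters, so that `P_j(w_∞)` is a full cumulant. The gap may be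
collapsed because of `IsContraction.sum_cumulant_restrict`, which follows by Möbius inversion from
the corresponding collapse of a block in the moment function, `IsContraction.momentOn_expand`.

The recursion then replaces all further combinatorics. Solved for `P_{j+1}(w)`, it involves only a
smaller `j` or shorter words. By induction, linear relations between moments that survive
contraction pass to the `P_j` (`partialCumulant_relation`). This gives additivity in each letter and
the shifting of coefficients between neighbouring letters (`headCoef_mul_partialCumulant`). The same
induction yields an exponential bound (`IsBanach.exists_norm_partialCumulant_le`).

Now write `μ`, `ρ`, `ν` for the left, right and mixed moment series. Summing the recursion over all
words replaces gap moments by whole series: a gap between two left letters becomes `μ`, the gap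
after the last left letter of the block becomes `ν`, a gap after a right letter becomes `ρ`.
Iterating in `j` telescopes, and the bound kills the remainder (`IsBound.hasSum_mixed`,
`IsBound.hasSum_cumulant_replicate`). The words with at least one left letter sum to `ν - cρ = ∑ κ_n
+ ∑ Ψ_n`, where `κ_n` and `Ψ_n` collect the blocks without and with right letters; the right words
give `ρ - 1`. In the terms of `C(μb, ν, dρ)` the leading coefficient (`μ`, or `ν` if there is no
left letter) comes out in front, so `C = ν + μ ∑ κ_n + ν(ρ - 1) + μ ∑ Ψ_n = νρ + μ(ν - cρ)`, which
is the claim. -/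

theorem sum_le_sum_mu_smul (g : α → E) (x : α) :
    ∑ y with y ≤ x, ∑ z with z ≤ y, IncidenceAlgebra.mu 𝕜 z y • g z = g x := by
  have h : ∀ y : α, ∑ z with z ≤ y, IncidenceAlgebra.mu 𝕜 z y • g z
      = ∑ z : α, IncidenceAlgebra.mu 𝕜 z y • g z := fun y => by
    rw [Finset.sum_filter]
    refine Finset.sum_congr rfl fun z _ => ?_
    split_ifs with hzy
    · rfl
    · rw [IncidenceAlgebra.apply_eq_zero_of_not_le hzy, zero_smul]
  simp_rw [h]
  rw [Finset.sum_comm]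
  have h2 : ∀ z : α, ∑ y with y ≤ x, IncidenceAlgebra.mu 𝕜 z y • g z
      = if z = x then g z else 0 := fun z => by
    rw [← Finset.sum_smul]
    have : ∑ y with y ≤ x, IncidenceAlgebra.mu 𝕜 z y
        = ∑ y ∈ Finset.Icc z x, IncidenceAlgebra.mu 𝕜 z y := by
      symm
      refine Finset.sum_subset (fun y hy => ?_) fun y hy hy' => ?_
      · simpa using (Finset.mem_Icc.1 hy).2
      · refine IncidenceAlgebra.apply_eq_zero_of_not_le (fun hzy => hy' ?_) _
        exact Finset.mem_Icc.2 ⟨hzy, by simpa using hy⟩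
    rw [this, IncidenceAlgebra.sum_Icc_mu_right]
    split_ifs <;> simp
  simp_rw [h2]
  simp

/-- The Möbius function is a two-sided inverse of zeta. The previous lemma recovers moments from
cumulants; this one recognises a family as the cumulants once its lower sums are known to be the
moments. -/
theorem sum_mu_smul_of_eq_sum (f g : α → E) (h : ∀ x, g x = ∑ y with y ≤ x, f y) (x : α) :
    ∑ y with y ≤ x, IncidenceAlgebra.mu 𝕜 y x • g y = f x := by
  have h1 : ∀ y : α, IncidenceAlgebra.mu 𝕜 y x • g y
      = ∑ z : α, if z ≤ y then IncidenceAlgebra.mu 𝕜 y x • f z else 0 := fun y => by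
    rw [h y, Finset.smul_sum, Finset.sum_filter]
  simp_rw [h1]
  rw [Finset.sum_comm]
  have h2 : ∀ z : α, (∑ y with y ≤ x, if z ≤ y then IncidenceAlgebra.mu 𝕜 y x • f z else 0)
      = if z = x then f z else 0 := fun z => by
    rw [← Finset.sum_filter, ← Finset.sum_smul]
    have : ({y ∈ ({y | y ≤ x} : Finset α) | z ≤ y} : Finset α) = Finset.Icc z x := by
      ext y; simp [and_comm]
    rw [this, IncidenceAlgebra.sum_Icc_mu_left]
    split_ifs <;> simp
  simp_rw [h2]
  simp

end Moebius

/-! ### The order `≺_χ` -/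

section Order

variable {N N' : ℕ} {χ : Fin N → Side} {χ' : Fin N' → Side}

theorem Prec.trans {i j k : Fin N} (h : Prec χ i j) (h' : Prec χ j k) : Prec χ i k :=
  lt_trans h h'

theorem Prec.irrefl (i : Fin N) : ¬ Prec χ i i := lt_irrefl _

theorem Prec.asymm {i j : Fin N} (h : Prec χ i j) : ¬ Prec χ j i := lt_asymm h

theorem prec_left_left {i j : Fin N} (hi : χ i = Side.left) (hj : χ j = Side.left) :
    Prec χ i j ↔ i < j := by
  simp [Prec, chiKey, hi, hj]

theorem prec_left_right {i j : Fin N} (hi : χ i = Side.left) (hj : χ j = Side.right) :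
    Prec χ i j := by
  simp only [Prec, chiKey, hi, hj]; omega

theorem prec_right_right {i j : Fin N} (hi : χ i = Side.right) (hj : χ j = Side.right) :
    Prec χ i j ↔ j < i := by
  simp only [Prec, chiKey, hi, hj]; omega

theorem not_prec_right_left {i j : Fin N} (hi : χ i = Side.right) (hj : χ j = Side.left) :
    ¬ Prec χ i j := by
  simp only [Prec, chiKey, hi, hj]; omega

theorem prec_trichotomy (i j : Fin N) : Prec χ i j ∨ i = j ∨ Prec χ j i := by
  cases hi : χ i <;> cases hj : χ j
  · rw [prec_left_left hi hj, prec_left_left hj hi]; exact lt_trichotomy i j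
  · exact Or.inl (prec_left_right hi hj)
  · exact Or.inr (Or.inr (prec_left_right hj hi))
  · rw [prec_right_right hi hj, prec_right_right hj hi]
    have := lt_trichotomy i j
    tauto

theorem not_prec_iff {i j : Fin N} (h : i ≠ j) : ¬ Prec χ i j ↔ Prec χ j i := by
  have := prec_trichotomy (χ := χ) i j
  exact ⟨fun h' => by tauto, fun h' => h'.asymm⟩

theorem exists_prec_min (χ : Fin N → Side) {T : Finset (Fin N)} (hT : T ≠ ∅) :
    ∃ p ∈ T, ∀ j ∈ T, ¬ Prec χ j p := by
  obtain ⟨p, hp, hmin⟩ := T.exists_min_image (chiKey χ) (Finset.nonempty_iff_ne_empty.mpr hT)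
  exact ⟨p, hp, fun j hj => not_lt.mpr (hmin j hj)⟩

/-- By trichotomy the minimum is unique, so any minimal element may serve as the witness hidden in
`firstBlock`. -/
theorem mem_firstBlock {π : Setoid (Fin N)} {T : Finset (Fin N)} {p : Fin N} (hp : p ∈ T)
    (hmin : ∀ j ∈ T, ¬ Prec χ j p) (k : Fin N) : k ∈ firstBlock χ π T ↔ k ∈ T ∧ π p k := by
  simp only [firstBlock, Finset.mem_filter]
  refine and_congr_right fun _ => ⟨?_, fun h => ⟨p, hp, hmin, h⟩⟩
  rintro ⟨q, hq, hqmin, hqk⟩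
  have h1 := hmin q hq
  have h2 := hqmin p hp
  have h3 := prec_trichotomy (χ := χ) p q
  obtain rfl : p = q := by tauto
  exact hqk

theorem firstBlock_subset (π : Setoid (Fin N)) (T : Finset (Fin N)) :
    firstBlock χ π T ⊆ T := by
  intro k hk
  simp only [firstBlock, Finset.mem_filter] at hk
  exact hk.1

theorem mem_gap {π : Setoid (Fin N)} {T : Finset (Fin N)} {k j : Fin N} :
    j ∈ gap χ π T k ↔ (j ∈ T ∧ j ∉ firstBlock χ π T) ∧ Prec χ k j ∧
      (∃ v ∈ firstBlock χ π T, Prec χ j v) ∧ ∀ v ∈ firstBlock χ π T, Prec χ k v → Prec χ j v := by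
  simp only [gap, Finset.mem_filter, Finset.mem_sdiff]

theorem mem_rest {π : Setoid (Fin N)} {T : Finset (Fin N)} {j : Fin N} :
    j ∈ rest χ π T ↔ (j ∈ T ∧ j ∉ firstBlock χ π T) ∧ ∀ v ∈ firstBlock χ π T, Prec χ v j := by
  simp only [rest, Finset.mem_filter, Finset.mem_sdiff]

end Order

/-! ### Elementary properties of the operators `L_b` and `R_b` -/

namespace BBSpace

section Basic

variable {B A : Type*} [Ring B] [Algebra ℂ B] [Ring A] [Algebra ℂ A] (S : BBSpace B A)

theorem L_mul (a b : B) : S.L (a * b) = S.L a * S.L b := by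
  simp [L, ← map_mul]

theorem R_mul (a b : B) : S.R (a * b) = S.R b * S.R a := by
  simp [R, ← map_mul]

theorem L_one : S.L 1 = 1 := by
  rw [L, ← Algebra.TensorProduct.one_def, map_one]

theorem R_one : S.R 1 = 1 := by
  rw [R, MulOpposite.op_one, ← Algebra.TensorProduct.one_def, map_one]

theorem L_add (a b : B) : S.L (a + b) = S.L a + S.L b := by
  simp [L, TensorProduct.add_tmul]

theorem R_add (a b : B) : S.R (a + b) = S.R a + S.R b := by
  simp [R, TensorProduct.tmul_add]

theorem L_mul_R (a b : B) : S.L a * S.R b = S.R b * S.L a := by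
  simp [L, R, ← map_mul]

theorem E_L_mul (b : B) (Z : A) : S.E (S.L b * Z) = b * S.E Z := by
  have := S.E_bimodule b 1 Z
  simpa [L] using this

theorem E_R_mul (b : B) (Z : A) : S.E (S.R b * Z) = S.E Z * b := by
  have := S.E_bimodule 1 b Z
  simpa [R] using this

theorem E_mul_L (b : B) (Z : A) : S.E (Z * S.L b) = S.E (Z * S.R b) := S.E_left_eq_right b Z

/-- The algebra in which an operator with the given label lives. -/
def sideAlgebra : Side → Subalgebra ℂ A
  | Side.left => S.leftAlgebra
  | Side.right => S.rightAlgebra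

theorem R_comm {Z : A} (hZ : Z ∈ S.leftAlgebra) (b : B) : S.R b * Z = Z * S.R b :=
  (Subalgebra.mem_centralizer_iff ℂ).1 hZ _ ⟨b, rfl⟩

theorem L_comm {Z : A} (hZ : Z ∈ S.rightAlgebra) (b : B) : S.L b * Z = Z * S.L b :=
  (Subalgebra.mem_centralizer_iff ℂ).1 hZ _ ⟨b, rfl⟩

theorem L_mem (b : B) : S.L b ∈ S.leftAlgebra := by
  refine (Subalgebra.mem_centralizer_iff ℂ).2 ?_
  rintro _ ⟨c, rfl⟩
  exact (S.L_mul_R b c).symm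

theorem R_mem (b : B) : S.R b ∈ S.rightAlgebra := by
  refine (Subalgebra.mem_centralizer_iff ℂ).2 ?_
  rintro _ ⟨c, rfl⟩
  exact S.L_mul_R c b

theorem insertAfter_mem {s : Side} {Z : A} (hZ : Z ∈ S.sideAlgebra s) (b : B) :
    S.insertAfter s Z b ∈ S.sideAlgebra s := by
  cases s
  · exact mul_mem hZ (S.L_mem b)
  · exact mul_mem (S.R_mem b) hZ

theorem insertAfter_one (s : Side) (Z : A) : S.insertAfter s Z 1 = Z := by
  cases s
  · simp [insertAfter, L_one]
  · simp [insertAfter, R_one]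

theorem insertAfter_insertAfter (s : Side) (Z : A) (a b : B) :
    S.insertAfter s (S.insertAfter s Z a) b = S.insertAfter s Z (a * b) := by
  cases s
  · simp [insertAfter, L_mul, mul_assoc]
  · simp [insertAfter, R_mul, mul_assoc]

theorem momentOn_empty {N : ℕ} (χ : Fin N → Side) (π : Setoid (Fin N)) (Z : Fin N → A) :
    S.momentOn χ π Z ∅ = 1 := by
  rw [momentOn, dif_pos rfl]

theorem momentOn_of_ne_empty {N : ℕ} (χ : Fin N → Side) (π : Setoid (Fin N)) (Z : Fin N → A)
    {T : Finset (Fin N)} (hT : T ≠ ∅) :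
    S.momentOn χ π Z T = S.E (((firstBlock χ π T).sort (· ≤ ·)).map
        (fun k => S.insertAfter (χ k) (Z k) (S.momentOn χ π Z (gap χ π T k)))).prod
      * S.momentOn χ π Z (rest χ π T) := by
  rw [momentOn, dif_neg hT]

/-- The value of a single block. -/
def blockMoment {N : ℕ} (Z : Fin N → A) (V : Finset (Fin N)) : B :=
  S.E ((V.sort (· ≤ ·)).map Z).prod

theorem blockMoment_congr {N : ℕ} {Z Z' : Fin N → A} {V : Finset (Fin N)}
    (h : ∀ k ∈ V, Z k = Z' k) : S.blockMoment Z V = S.blockMoment Z' V := by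
  unfold blockMoment
  congr 2
  exact List.map_congr_left fun k hk => h k ((Finset.mem_sort _).1 hk)

/-- If the first block `G` of `G ∪ T` comes before `T` and has no gaps, its value splits off. -/
theorem momentOn_eq_blockMoment_mul {N : ℕ} {χ : Fin N → Side} {π : Setoid (Fin N)} (Z : Fin N → A)
    {U G T : Finset (Fin N)} (hU : ∀ k, k ∈ U ↔ k ∈ G ∨ k ∈ T) (hG : G ≠ ∅)
    (hGT : ∀ g ∈ G, ∀ t ∈ T, Prec χ g t) (hGπ : ∀ g ∈ G, ∀ k ∈ U, π g k ↔ k ∈ G) :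
    S.momentOn χ π Z U = S.blockMoment Z G * S.momentOn χ π Z T := by
  obtain ⟨p, hp, hmin⟩ := exists_prec_min χ hG
  have hpU : p ∈ U := (hU p).2 (Or.inl hp)
  have hminU : ∀ j ∈ U, ¬ Prec χ j p := by
    intro j hj
    rcases (hU j).1 hj with h | h
    · exact hmin j h
    · exact (hGT p hp j h).asymm
  have hfb : firstBlock χ π U = G := by
    ext k
    rw [mem_firstBlock hpU hminU]
    refine ⟨fun h => (hGπ p hp k h.1).1 h.2, fun h => ?_⟩
    have hk := (hU k).2 (Or.inl h)
    exact ⟨hk, (hGπ p hp k hk).2 h⟩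
  have hgap : ∀ k, gap χ π U k = ∅ := by
    intro k
    refine Finset.eq_empty_of_forall_notMem fun j hj => ?_
    rw [mem_gap, hfb] at hj
    obtain ⟨⟨hjU, hjG⟩, -, ⟨v, hv, hjv⟩, -⟩ := hj
    exact (hGT v hv j (((hU j).1 hjU).resolve_left hjG)).asymm hjv
  have hrest : rest χ π U = T := by
    ext j
    rw [mem_rest, hfb, hU]
    refine ⟨fun h => h.1.1.resolve_left h.1.2, fun h => ⟨⟨Or.inr h, fun hg => ?_⟩, ?_⟩⟩
    · exact Prec.irrefl _ (hGT j hg j h)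
    · exact fun v hv => hGT v hv j h
  rw [S.momentOn_of_ne_empty χ π Z (Finset.ne_empty_of_mem hpU), hrest, hfb]
  simp only [hgap, momentOn_empty, insertAfter_one]
  rfl

/-- A coefficient after the `≺_χ`-last entry of a block can be pulled out of its value. -/
theorem blockMoment_insertAfter_last {N : ℕ} {χ : Fin N → Side} {W W' : Fin N → A}
    {V : Finset (Fin N)} {k : Fin N} (hk : k ∈ V) (hlast : ∀ v ∈ V, ¬ Prec χ k v) (b : B)
    (hW : ∀ v ∈ V, W v ∈ S.sideAlgebra (χ v))
    (hne : ∀ v ∈ V, v ≠ k → W' v = W v) (heq : W' k = S.insertAfter (χ k) (W k) b) :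
    S.blockMoment W' V = S.blockMoment W V * b := by
  unfold blockMoment
  have hsorted : (V.sort (· ≤ ·)).SortedLT := Finset.sortedLT_sort V
  have hmem : ∀ v, v ∈ V.sort (· ≤ ·) ↔ v ∈ V := fun v => Finset.mem_sort _
  obtain ⟨l₁, l₂, hl⟩ := List.append_of_mem ((hmem k).2 hk)
  have hp := hsorted.pairwise
  rw [hl] at hmem hp
  rw [hl]
  have hp' := List.pairwise_append.1 hp
  have h1 : ∀ v ∈ l₁, v < k := fun v hv => hp'.2.2 v hv k (by simp)
  have h2 : ∀ v ∈ l₂, k < v := (List.pairwise_cons.1 hp'.2.1).1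
  have hV1 : ∀ v ∈ l₁, v ∈ V := fun v hv => (hmem v).1 (by simp [hv])
  have hV2 : ∀ v ∈ l₂, v ∈ V := fun v hv => (hmem v).1 (by simp [hv])
  have e1 : l₁.map W' = l₁.map W := List.map_congr_left fun v hv => hne v (hV1 v hv) (h1 v hv).ne
  have e2 : l₂.map W' = l₂.map W := List.map_congr_left fun v hv => hne v (hV2 v hv) (h2 v hv).ne'
  -- A right index smaller than `k` in the usual order would come `≺_χ`-after `k`, whichever label
  -- `k` has.
  have hleft : ∀ v ∈ l₁, χ v = Side.left := by
    intro v hv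
    cases hχ : χ v
    · rfl
    · exfalso
      have := hlast v (hV1 v hv)
      cases hχk : χ k
      · exact this (prec_left_right hχk hχ)
      · exact this ((prec_right_right hχk hχ).2 (h1 v hv))
  have hmem1 : (l₁.map W).prod ∈ S.leftAlgebra := by
    refine Subalgebra.list_prod_mem _ fun x hx => ?_
    obtain ⟨v, hv, rfl⟩ := List.mem_map.1 hx
    have := hW v (hV1 v hv)
    rwa [hleft v hv] at this
  have hWk := hW k hk
  simp only [List.map_append, List.map_cons, List.prod_append, List.prod_cons, e1, e2, heq]
  -- If `k` is left, it is also the last factor: `L_b` stands at the right end, becomes `R_b` under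
  -- `E` and commutes to the front past left operators. If `k` is right, only left operators stand
  -- before `R_b`, and it moves to the front directly.
  cases hχk : χ k
  · have hl2 : l₂ = [] := by
      refine List.eq_nil_iff_forall_not_mem.2 fun v hv => ?_
      have := hlast v (hV2 v hv)
      cases hχ : χ v
      · exact this ((prec_left_left hχk hχ).2 (h2 v hv))
      · exact this (prec_left_right hχk hχ)
    rw [hχk] at hWk
    subst hl2
    simp only [insertAfter, List.map_nil, List.prod_nil, mul_one]
    rw [← mul_assoc, E_mul_L, ← S.R_comm (mul_mem hmem1 hWk), E_R_mul]
  · simp only [insertAfter]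
    rw [mul_assoc, ← mul_assoc _ (S.R b), ← S.R_comm hmem1, mul_assoc, E_R_mul]

end Basic

end BBSpace

end BiFree

namespace BiFree

/-! ### Contracting an interval -/

/-- `f` embeds the indices of `χ'` into those of `χ`, and the indices that are left out form a
`≺_χ`-interval directly after `f j`. -/
structure IsContraction {N N' : ℕ} (χ : Fin N → Side) (χ' : Fin N' → Side) (f : Fin N' → Fin N)
    (j : Fin N') : Prop where
  strictMono : StrictMono f
  side : ∀ i, χ (f i) = χ' i
  prec_iff : ∀ g, g ∉ Set.range f → ∀ i, Prec χ (f i) g ↔ ¬ Prec χ' j i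

section Contraction

open Classical in
/-- The indices left out by `f`. -/
def leftOut {N N' : ℕ} (f : Fin N' → Fin N) : Finset (Fin N) :=
  Finset.univ.filter fun g => g ∉ Set.range f

open Classical in
/-- The image of `T` under `f`, together with the left out indices if `j ∈ T`. -/
def expand {N N' : ℕ} (f : Fin N' → Fin N) (j : Fin N') (T : Finset (Fin N')) : Finset (Fin N) :=
  Finset.univ.filter fun x => (∃ i ∈ T, f i = x) ∨ (j ∈ T ∧ x ∉ Set.range f)

variable {N N' : ℕ} {χ : Fin N → Side} {χ' : Fin N' → Side} {f : Fin N' → Fin N} {j : Fin N'}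

theorem mem_leftOut {g : Fin N} : g ∈ leftOut f ↔ g ∉ Set.range f := by
  simp [leftOut]

theorem mem_expand {T : Finset (Fin N')} {x : Fin N} :
    x ∈ expand f j T ↔ (∃ i ∈ T, f i = x) ∨ (j ∈ T ∧ x ∉ Set.range f) := by
  simp [expand]

namespace IsContraction

theorem prec_map (h : IsContraction χ χ' f j) (i k : Fin N') :
    Prec χ (f i) (f k) ↔ Prec χ' i k := by
  have hi := h.side i
  have hk := h.side k
  cases hi' : χ' i <;> cases hk' : χ' k <;> rw [hi'] at hi <;> rw [hk'] at hk
  · rw [prec_left_left hi hk, prec_left_left hi' hk', h.strictMono.lt_iff_lt]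
  · exact iff_of_true (prec_left_right hi hk) (prec_left_right hi' hk')
  · exact iff_of_false (not_prec_right_left hi hk) (not_prec_right_left hi' hk')
  · rw [prec_right_right hi hk, prec_right_right hi' hk', h.strictMono.lt_iff_lt]

theorem prec_iff' (h : IsContraction χ χ' f j) {g : Fin N} (hg : g ∉ Set.range f) (i : Fin N') :
    Prec χ g (f i) ↔ Prec χ' j i := by
  have hne : f i ≠ g := fun e => hg ⟨i, e⟩
  rw [← not_prec_iff hne, h.prec_iff g hg i, not_not]

theorem mem_expand_map (h : IsContraction χ χ' f j) {T : Finset (Fin N')} {i : Fin N'} :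
    f i ∈ expand f j T ↔ i ∈ T := by
  rw [mem_expand]
  constructor
  · rintro (⟨k, hk, hki⟩ | ⟨-, hi⟩)
    · rwa [h.strictMono.injective hki] at hk
    · exact absurd ⟨i, rfl⟩ hi
  · exact fun hi => Or.inl ⟨i, hi, rfl⟩

theorem mem_expand_of_notMem {T : Finset (Fin N')} {g : Fin N} (hg : g ∉ Set.range f) :
    g ∈ expand f j T ↔ j ∈ T := by
  rw [mem_expand]
  constructor
  · rintro (⟨k, hk, hki⟩ | ⟨hj, -⟩)
    · exact absurd ⟨k, hki⟩ hg
    · exact hj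
  · exact fun hi => Or.inr ⟨hi, hg⟩

section Blocks

/-- The indices left out by `f` form a block of `π`. -/
def IsLeftOutBlock (f : Fin N' → Fin N) (π : Setoid (Fin N)) : Prop :=
  ∀ g, g ∉ Set.range f → ∀ x, π g x ↔ x ∉ Set.range f

/-- A left out index enters `expand f j T` only together with `f j`, which precedes it. Hence the
`≺_χ`-minimum is never a left out index, and minima correspond under `f`. -/
theorem firstBlock_map (h : IsContraction χ χ' f j) {π : Setoid (Fin N)}
    (T : Finset (Fin N')) (i : Fin N') :
    f i ∈ firstBlock χ π (expand f j T) ↔ i ∈ firstBlock χ' (π.comap f) T := by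
  by_cases hT : T = ∅
  · subst hT
    refine iff_of_false (fun hi => ?_) fun hi => ?_
    · have := h.mem_expand_map.1 (firstBlock_subset _ _ hi)
      simp at this
    · have := firstBlock_subset _ _ hi
      simp at this
  obtain ⟨p, hp, hmin⟩ := exists_prec_min χ' hT
  have hmin' : ∀ x ∈ expand f j T, ¬ Prec χ x (f p) := by
    intro x hx
    rcases mem_expand.1 hx with ⟨k, hk, rfl⟩ | ⟨hj, hx⟩
    · rw [h.prec_map]; exact hmin k hk
    · rw [h.prec_iff' hx]; exact hmin j hj
  rw [mem_firstBlock hp hmin, mem_firstBlock (h.mem_expand_map.2 hp) hmin', h.mem_expand_map]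
  rfl

theorem notMem_firstBlock (h : IsContraction χ χ' f j) {π : Setoid (Fin N)}
    (hπ : IsLeftOutBlock f π) (T : Finset (Fin N')) {g : Fin N} (hg : g ∉ Set.range f) :
    g ∉ firstBlock χ π (expand f j T) := by
  intro hmem
  simp only [firstBlock, Finset.mem_filter] at hmem
  obtain ⟨hgT, p, hp, hpmin, hpg⟩ := hmem
  have hj : j ∈ T := (mem_expand_of_notMem hg).1 hgT
  have hpr : p ∉ Set.range f := (hπ g hg p).1 (π.symm hpg)
  refine hpmin (f j) (h.mem_expand_map.2 hj) ?_
  rw [h.prec_iff p hpr]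
  exact Prec.irrefl j

theorem exists_firstBlock (h : IsContraction χ χ' f j) {π : Setoid (Fin N)}
    (hπ : IsLeftOutBlock f π) (T : Finset (Fin N')) (P : Fin N → Prop) :
    (∃ v ∈ firstBlock χ π (expand f j T), P v) ↔
      ∃ v ∈ firstBlock χ' (π.comap f) T, P (f v) := by
  constructor
  · rintro ⟨v, hv, hP⟩
    by_cases hr : v ∈ Set.range f
    · obtain ⟨i, rfl⟩ := hr
      exact ⟨i, (h.firstBlock_map T i).1 hv, hP⟩
    · exact absurd hv (h.notMem_firstBlock hπ T hr)
  · rintro ⟨v, hv, hP⟩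
    exact ⟨f v, (h.firstBlock_map T v).2 hv, hP⟩

theorem forall_firstBlock (h : IsContraction χ χ' f j) {π : Setoid (Fin N)}
    (hπ : IsLeftOutBlock f π) (T : Finset (Fin N')) (P : Fin N → Prop) :
    (∀ v ∈ firstBlock χ π (expand f j T), P v) ↔
      ∀ v ∈ firstBlock χ' (π.comap f) T, P (f v) := by
  have := h.exists_firstBlock hπ T (fun v => ¬ P v)
  rw [← not_iff_not]
  push Not
  exact this

theorem firstBlock_eq (h : IsContraction χ χ' f j) {π : Setoid (Fin N)}
    (hπ : IsLeftOutBlock f π) (T : Finset (Fin N')) : firstBlock χ π (expand f j T) =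
    (firstBlock χ' (π.comap f) T).map ⟨f, h.strictMono.injective⟩ := by
  ext x
  simp only [Finset.mem_map, Function.Embedding.coeFn_mk]
  constructor
  · intro hx
    have := (h.exists_firstBlock hπ T (fun v => v = x)).1 ⟨x, hx, rfl⟩
    simpa using this
  · rintro ⟨i, hi, rfl⟩
    exact (h.firstBlock_map T i).2 hi

theorem map_mem_gap (h : IsContraction χ χ' f j) {π : Setoid (Fin N)}
    (hπ : IsLeftOutBlock f π) (T : Finset (Fin N')) (i k : Fin N') :
    f k ∈ gap χ π (expand f j T) (f i) ↔ k ∈ gap χ' (π.comap f) T i := by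
  rw [mem_gap, mem_gap, h.mem_expand_map, h.firstBlock_map, h.exists_firstBlock hπ,
    h.forall_firstBlock hπ]
  simp only [h.prec_map]

theorem notMem_range_mem_gap (h : IsContraction χ χ' f j) {π : Setoid (Fin N)}
    (hπ : IsLeftOutBlock f π) (T : Finset (Fin N')) {g : Fin N} (hg : g ∉ Set.range f) (i : Fin N') :
    g ∈ gap χ π (expand f j T) (f i) ↔ j ∈ T ∧ ¬ Prec χ' j i ∧
      (∃ v ∈ firstBlock χ' (π.comap f) T, Prec χ' j v) ∧
      ∀ v ∈ firstBlock χ' (π.comap f) T, Prec χ' i v → Prec χ' j v := by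
  rw [mem_gap, mem_expand_of_notMem hg, h.exists_firstBlock hπ, h.forall_firstBlock hπ,
    h.prec_iff g hg]
  simp only [h.prec_map, h.prec_iff' hg]
  have := h.notMem_firstBlock hπ T hg
  tauto

/-- The left out interval sticks to `f j`: it lies in a gap that starts elsewhere exactly if `j`
does. -/
theorem gap_eq_of_ne (h : IsContraction χ χ' f j) {π : Setoid (Fin N)}
    (hπ : IsLeftOutBlock f π) (T : Finset (Fin N')) {i : Fin N'} (hi : i ≠ j) :
    gap χ π (expand f j T) (f i) = expand f j (gap χ' (π.comap f) T i) := by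
  ext x
  by_cases hr : x ∈ Set.range f
  · obtain ⟨k, rfl⟩ := hr
    rw [h.map_mem_gap hπ, h.mem_expand_map]
  · rw [h.notMem_range_mem_gap hπ T hr, mem_expand_of_notMem hr, mem_gap, not_prec_iff hi.symm]
    constructor
    · rintro ⟨h1, h2, h3, h4⟩
      exact ⟨⟨h1, fun hj => Prec.irrefl j (h4 j hj h2)⟩, h2, h3, h4⟩
    · rintro ⟨⟨h1, -⟩, h2, h3, h4⟩
      exact ⟨h1, h2, h3, h4⟩

theorem mem_gap_self (h : IsContraction χ χ' f j) {π : Setoid (Fin N)}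
    (hπ : IsLeftOutBlock f π) (T : Finset (Fin N')) (hj : j ∈ T) (hlast : ∃ v ∈ firstBlock χ' (π.comap f) T, Prec χ' j v)
    (x : Fin N) : x ∈ gap χ π (expand f j T) (f j) ↔
      x ∈ leftOut f ∨ x ∈ expand f j (gap χ' (π.comap f) T j) := by
  by_cases hr : x ∈ Set.range f
  · obtain ⟨k, rfl⟩ := hr
    rw [h.map_mem_gap hπ, h.mem_expand_map, mem_leftOut]
    simp
  · rw [h.notMem_range_mem_gap hπ T hr, mem_leftOut]
    exact iff_of_true ⟨hj, Prec.irrefl j, hlast, fun _ _ h => h⟩ (Or.inl hr)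

theorem gap_last (h : IsContraction χ χ' f j) {π : Setoid (Fin N)}
    (hπ : IsLeftOutBlock f π) (T : Finset (Fin N')) (hlast : ∀ v ∈ firstBlock χ' (π.comap f) T, ¬ Prec χ' j v) :
    gap χ π (expand f j T) (f j) = ∅ := by
  refine Finset.eq_empty_of_forall_notMem fun x hx => ?_
  by_cases hr : x ∈ Set.range f
  · obtain ⟨k, rfl⟩ := hr
    rw [h.map_mem_gap hπ, mem_gap] at hx
    obtain ⟨-, h1, ⟨v, hv, hkv⟩, -⟩ := hx
    exact hlast v hv (h1.trans hkv)
  · rw [h.notMem_range_mem_gap hπ T hr] at hx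
    obtain ⟨-, -, ⟨v, hv, hkv⟩, -⟩ := hx
    exact hlast v hv hkv

theorem map_mem_rest (h : IsContraction χ χ' f j) {π : Setoid (Fin N)}
    (hπ : IsLeftOutBlock f π) (T : Finset (Fin N')) (k : Fin N') :
    f k ∈ rest χ π (expand f j T) ↔ k ∈ rest χ' (π.comap f) T := by
  rw [mem_rest, mem_rest, h.mem_expand_map, h.firstBlock_map, h.forall_firstBlock hπ]
  simp only [h.prec_map]

theorem notMem_range_mem_rest (h : IsContraction χ χ' f j) {π : Setoid (Fin N)}
    (hπ : IsLeftOutBlock f π) (T : Finset (Fin N')) {g : Fin N} (hg : g ∉ Set.range f) :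
    g ∈ rest χ π (expand f j T) ↔ j ∈ T ∧
      ∀ v ∈ firstBlock χ' (π.comap f) T, ¬ Prec χ' j v := by
  rw [mem_rest, mem_expand_of_notMem hg, h.forall_firstBlock hπ]
  simp only [h.prec_iff g hg]
  have := h.notMem_firstBlock hπ T hg
  tauto

/-- The only exception, excluded by the last hypothesis, is that `j` ends the first block; then the
left out indices start the rest without `j` lying in it (`mem_rest_of_last`). -/
theorem rest_eq (h : IsContraction χ χ' f j) {π : Setoid (Fin N)}
    (hπ : IsLeftOutBlock f π) (T : Finset (Fin N')) (hj : j ∈ firstBlock χ' (π.comap f) T →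
      ∃ v ∈ firstBlock χ' (π.comap f) T, Prec χ' j v) :
    rest χ π (expand f j T) = expand f j (rest χ' (π.comap f) T) := by
  ext x
  by_cases hr : x ∈ Set.range f
  · obtain ⟨k, rfl⟩ := hr
    rw [h.map_mem_rest hπ, h.mem_expand_map]
  · rw [h.notMem_range_mem_rest hπ T hr, mem_expand_of_notMem hr, mem_rest]
    constructor
    · rintro ⟨h1, h2⟩
      have hj' : j ∉ firstBlock χ' (π.comap f) T := fun hmem => by
        obtain ⟨v, hv, hjv⟩ := hj hmem
        exact h2 v hv hjv
      refine ⟨⟨h1, hj'⟩, fun v hv => (not_prec_iff ?_).1 (h2 v hv)⟩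
      rintro rfl
      exact hj' hv
    · rintro ⟨⟨h1, -⟩, h2⟩
      exact ⟨h1, fun v hv => (h2 v hv).asymm⟩

theorem mem_rest_of_last (h : IsContraction χ χ' f j) {π : Setoid (Fin N)}
    (hπ : IsLeftOutBlock f π) (T : Finset (Fin N')) (hj : j ∈ T)
    (hlast : ∀ v ∈ firstBlock χ' (π.comap f) T, ¬ Prec χ' j v) (x : Fin N) :
    x ∈ rest χ π (expand f j T) ↔
      x ∈ leftOut f ∨ x ∈ expand f j (rest χ' (π.comap f) T) := by
  by_cases hr : x ∈ Set.range f
  · obtain ⟨k, rfl⟩ := hr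
    rw [h.map_mem_rest hπ, h.mem_expand_map, mem_leftOut]
    simp
  · rw [h.notMem_range_mem_rest hπ T hr, mem_leftOut]
    exact iff_of_true ⟨hj, hlast⟩ (Or.inl hr)

variable {B A : Type*} [Ring B] [Algebra ℂ B] [Ring A] [Algebra ℂ A] (S : BBSpace B A)

theorem momentOn_leftOut_union (h : IsContraction χ χ' f j) {π : Setoid (Fin N)}
    (hπ : IsLeftOutBlock f π) (Z : Fin N → A) {U : Finset (Fin N)} {T' : Finset (Fin N')}
    (hU : ∀ x, x ∈ U ↔ x ∈ leftOut f ∨ x ∈ expand f j T') (hT' : ∀ t ∈ T', Prec χ' j t) :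
    S.momentOn χ π Z U =
      S.blockMoment Z (leftOut f) * S.momentOn χ π Z (expand f j T') := by
  -- Nothing is left out: the empty product has value `E 1 = 1`. Contractions of length zero are
  -- covered this way.
  by_cases hG : leftOut f = ∅
  · have : U = expand f j T' := by
      ext x; simp [hU, hG]
    rw [this, hG]
    simp [BBSpace.blockMoment, S.E_one]
  · have hj : j ∉ T' := fun hj => Prec.irrefl j (hT' j hj)
    refine S.momentOn_eq_blockMoment_mul Z hU hG (fun g hg t ht => ?_) fun g hg k _ => ?_
    · rcases mem_expand.1 ht with ⟨i, hi, rfl⟩ | ⟨hj', -⟩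
      · exact (h.prec_iff' (mem_leftOut.1 hg) i).2 (hT' i hi)
      · exact absurd hj' hj
    · rw [hπ g (mem_leftOut.1 hg), mem_leftOut]

/-- If the left out indices form a block of `π`, they can be replaced by their value, attached to
the entry before them. -/
theorem momentOn_expand (h : IsContraction χ χ' f j) {π : Setoid (Fin N)}
    (hπ : IsLeftOutBlock f π) (T : Finset (Fin N')) (Z : Fin N → A) (hZ : ∀ k, Z k ∈ S.sideAlgebra (χ k)) (Z' : Fin N' → A)
    (hne : ∀ i, i ≠ j → Z' i = Z (f i))
    (heq : Z' j = S.insertAfter (χ' j) (Z (f j)) (S.blockMoment Z (leftOut f))) :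
    S.momentOn χ π Z (expand f j T) = S.momentOn χ' (π.comap f) Z' T := by
  induction hc : T.card using Nat.strong_induction_on generalizing T with
  | _ c ih =>
  subst hc
  by_cases hT : T = ∅
  · subst hT
    have : expand f j (∅ : Finset (Fin N')) = ∅ := by
      ext x; simp [mem_expand]
    rw [this, S.momentOn_empty, S.momentOn_empty]
  have hT' : expand f j T ≠ ∅ := by
    obtain ⟨i, hi⟩ := Finset.nonempty_iff_ne_empty.mpr hT
    exact Finset.ne_empty_of_mem (h.mem_expand_map.2 hi)
  have ihgap := fun i => ih _ (card_gap_lt χ' (π.comap f) hT i) _ rfl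
  have ihrest := ih _ (card_rest_lt χ' (π.comap f) hT) _ rfl
  rw [S.momentOn_of_ne_empty χ π Z hT', S.momentOn_of_ne_empty χ' (π.comap f) Z' hT]
  set V := firstBlock χ' (π.comap f) T with hV
  have hsort : ∀ W : Fin N → A,
      S.E (((firstBlock χ π (expand f j T)).sort (· ≤ ·)).map W).prod
        = S.blockMoment (fun i => W (f i)) V := by
    intro W
    rw [h.firstBlock_eq hπ T, ← Finset.map_sort (r := (· ≤ ·)), List.map_map]
    · rfl
    · intro a _ b _
      exact h.strictMono.le_iff_le.symm
  rw [hsort]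
  change _ = S.blockMoment _ V * _
  have hlet : ∀ i, i ≠ j → S.insertAfter (χ (f i)) (Z (f i))
      (S.momentOn χ π Z (gap χ π (expand f j T) (f i))) =
      S.insertAfter (χ' i) (Z' i) (S.momentOn χ' (π.comap f) Z' (gap χ' (π.comap f) T i)) := by
    intro i hi
    rw [h.gap_eq_of_ne hπ T hi, ihgap, hne i hi, h.side]
  -- If `j` lies in `V` but is not last, the left out block heads the gap after `f j` and the two
  -- coefficients multiply. If `j` is last in `V`, it heads the rest, and its value is carried back
  -- into `E` by `blockMoment_insertAfter_last`. If `j` is not in `V`, it lies inside a smaller set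
  -- and induction suffices.
  by_cases hjV : j ∈ V
  · have hjT : j ∈ T := firstBlock_subset _ _ hjV
    by_cases hlast : ∃ v ∈ V, Prec χ' j v
    · rw [h.rest_eq hπ T (fun _ => hlast), ihrest]
      congr 1
      refine S.blockMoment_congr fun i _ => ?_
      by_cases hi : i = j
      · subst hi
        rw [h.momentOn_leftOut_union S hπ Z (h.mem_gap_self hπ T hjT hlast)
          (fun t ht => (mem_gap.1 ht).2.1), ihgap, heq, S.insertAfter_insertAfter, h.side]
      · exact hlet i hi
    · push Not at hlast
      rw [h.momentOn_leftOut_union S hπ Z (h.mem_rest_of_last hπ T hjT hlast)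
          (fun t ht => (mem_rest.1 ht).2 j hjV), ihrest, ← mul_assoc]
      congr 1
      symm
      refine S.blockMoment_insertAfter_last (χ := χ') hjV hlast _ (fun v _ => ?_)
        (fun v _ hv => (hlet v hv).symm) ?_
      · rw [← h.side v]
        exact S.insertAfter_mem (hZ _) _
      · have hg : gap χ' (π.comap f) T j = ∅ := by
          refine Finset.eq_empty_of_forall_notMem fun x hx => ?_
          obtain ⟨-, h1, ⟨v, hv, hxv⟩, -⟩ := mem_gap.1 hx
          exact hlast v hv (h1.trans hxv)
        rw [hg, h.gap_last hπ T hlast, S.momentOn_empty, S.momentOn_empty, S.insertAfter_one,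
          S.insertAfter_one, heq]
  · rw [h.rest_eq hπ T (fun hj => absurd hj hjV), ihrest]
    congr 1
    refine S.blockMoment_congr fun i hi => hlet i ?_
    rintro rfl
    exact hjV hi

end Blocks

/-- The left out indices are a union of blocks. -/
def Saturated (f : Fin N' → Fin N) (π : Setoid (Fin N)) : Prop :=
  ∀ g, g ∉ Set.range f → ∀ x, π g x → x ∉ Set.range f

/-- The restriction of a partition to the indices that are kept. -/
def restrict (h : IsContraction χ χ' f j) (π : BNC χ) : BNC χ' :=
  ⟨π.1.comap f, fun u₁ v₁ u₂ v₂ h1 h2 h3 h4 h5 =>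
    π.2 (f u₁) (f v₁) (f u₂) (f v₂) ((h.prec_map _ _).2 h1) ((h.prec_map _ _).2 h2)
      ((h.prec_map _ _).2 h3) h4 h5⟩

/-- The partition with the left out indices as an additional block. -/
def extend (h : IsContraction χ χ' f j) (τ : BNC χ') : BNC χ :=
  ⟨{ r := fun x y => (x ∉ Set.range f ∧ y ∉ Set.range f) ∨ ∃ a b, f a = x ∧ f b = y ∧ τ.1 a b
     iseqv :=
      { refl := fun x => by
          by_cases hx : x ∈ Set.range f
          · obtain ⟨a, rfl⟩ := hx
            exact Or.inr ⟨a, a, rfl, rfl, τ.1.refl a⟩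
          · exact Or.inl ⟨hx, hx⟩
        symm := by
          rintro x y (⟨h1, h2⟩ | ⟨a, b, ha, hb, hab⟩)
          · exact Or.inl ⟨h2, h1⟩
          · exact Or.inr ⟨b, a, hb, ha, τ.1.symm hab⟩
        trans := by
          rintro x y z (⟨h1, h2⟩ | ⟨a, b, rfl, rfl, hab⟩) (⟨h3, h4⟩ | ⟨c, d, hc, rfl, hcd⟩)
          · exact Or.inl ⟨h1, h4⟩
          · exact absurd ⟨c, hc⟩ h2
          · exact absurd ⟨b, rfl⟩ h3
          · obtain rfl := h.strictMono.injective hc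
            exact Or.inr ⟨a, d, rfl, rfl, τ.1.trans hab hcd⟩ } },
    by
      -- The left out indices form a `≺_χ`-interval, so the new block crosses no other block.
      have key : ∀ u v w : Fin N, u ∉ Set.range f → w ∉ Set.range f → Prec χ u v → Prec χ v w →
          v ∉ Set.range f := by
        rintro u v w hu hw h1 h2 ⟨i, rfl⟩
        exact (h.prec_iff w hw i).1 h2 ((h.prec_iff' hu i).1 h1)
      rintro u₁ v₁ u₂ v₂ h1 h2 h3 (⟨hu1, hu2⟩ | ⟨a, b, rfl, rfl, hab⟩)
        (⟨hv1, hv2⟩ | ⟨c, d, rfl, rfl, hcd⟩)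
      · exact Or.inl ⟨hu1, hv1⟩
      · exact absurd ⟨c, rfl⟩ (key _ _ _ hu1 hu2 h1 h2)
      · exact absurd ⟨b, rfl⟩ (key _ _ _ hv1 hv2 h2 h3)
      · exact Or.inr ⟨a, c, rfl, rfl, τ.2 a c b d ((h.prec_map _ _).1 h1) ((h.prec_map _ _).1 h2)
          ((h.prec_map _ _).1 h3) hab hcd⟩⟩

theorem extend_rel_map (h : IsContraction χ χ' f j) (τ : BNC χ') (a b : Fin N') :
    (h.extend τ).1 (f a) (f b) ↔ τ.1 a b := by
  constructor
  · rintro (⟨h1, -⟩ | ⟨c, d, hc, hd, hcd⟩)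
    · exact absurd ⟨a, rfl⟩ h1
    · rwa [h.strictMono.injective hc, h.strictMono.injective hd] at hcd
  · exact fun hab => Or.inr ⟨a, b, rfl, rfl, hab⟩

theorem extend_rel_leftOut (h : IsContraction χ χ' f j) (τ : BNC χ') {g : Fin N}
    (hg : g ∉ Set.range f) (x : Fin N) : (h.extend τ).1 g x ↔ x ∉ Set.range f := by
  constructor
  · rintro (⟨-, h1⟩ | ⟨c, d, hc, -, -⟩)
    · exact h1
    · exact absurd ⟨c, hc⟩ hg
  · exact fun hx => Or.inl ⟨hg, hx⟩

/-- On saturated partitions, `restrict` and `extend` form a Galois connection. It makes the interval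
below `h.extend τ` fibre over the interval below `τ`. -/
theorem le_extend_iff (h : IsContraction χ χ' f j) (π : BNC χ) (τ : BNC χ') :
    π ≤ h.extend τ ↔ Saturated f π.1 ∧ h.restrict π ≤ τ := by
  constructor
  · intro hle
    refine ⟨fun g hg x hx => ?_, fun a b hab => ?_⟩
    · exact (h.extend_rel_leftOut τ hg x).1 (hle hx)
    · exact (h.extend_rel_map τ a b).1 (hle hab)
  · rintro ⟨hsat, hle⟩ x y hxy
    by_cases hx : x ∈ Set.range f
    · by_cases hy : y ∈ Set.range f
      · obtain ⟨a, rfl⟩ := hx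
        obtain ⟨b, rfl⟩ := hy
        exact (h.extend_rel_map τ a b).2 (hle hxy)
      · exact absurd hx (hsat y hy x (π.1.symm hxy))
    · exact (h.extend_rel_leftOut τ hx y).2 (hsat x hx y hxy)

theorem comap_extend (h : IsContraction χ χ' f j) (τ : BNC χ') :
    (h.extend τ).1.comap f = τ.1 :=
  Setoid.ext fun a b => h.extend_rel_map τ a b

section Sums

variable {B A : Type*} [Ring B] [Algebra ℂ B] [Ring A] [Algebra ℂ A] (S : BBSpace B A)

theorem moment_extend (h : IsContraction χ χ' f j) (τ : BNC χ') (Z : Fin N → A)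
    (hZ : ∀ k, Z k ∈ S.sideAlgebra (χ k)) (Z' : Fin N' → A)
    (hne : ∀ i, i ≠ j → Z' i = Z (f i))
    (heq : Z' j = S.insertAfter (χ' j) (Z (f j)) (S.blockMoment Z (leftOut f))) :
    S.moment (h.extend τ) Z = S.moment τ Z' := by
  have := h.momentOn_expand S (fun g hg x => h.extend_rel_leftOut τ hg x) Finset.univ Z hZ Z' hne
    heq
  rw [h.comap_extend] at this
  rw [BBSpace.moment, BBSpace.moment, ← this]
  congr 1
  ext x
  simp only [mem_expand, Finset.mem_univ, true_and, true_iff]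
  exact Classical.em _

-- The moment–cumulant formula, which inverts the definition of the cumulants.
open Classical in
theorem _root_.BiFree.BBSpace.sum_cumulant_le (π : BNC χ) (Z : Fin N → A) :
    ∑ σ : BNC χ with σ ≤ π, S.cumulant σ Z = S.moment π Z := by
  unfold BBSpace.cumulant muBNC
  exact sum_le_sum_mu_smul (𝕜 := ℂ) (fun σ => S.moment σ Z) π

open Classical in
/-- The cumulants of the contracted word are the sums of the cumulants of the given word over the
partitions for which the left out indices are a union of blocks. -/
theorem sum_cumulant_restrict (h : IsContraction χ χ' f j) (Z : Fin N → A)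
    (hZ : ∀ k, Z k ∈ S.sideAlgebra (χ k)) (Z' : Fin N' → A)
    (hne : ∀ i, i ≠ j → Z' i = Z (f i))
    (heq : Z' j = S.insertAfter (χ' j) (Z (f j)) (S.blockMoment Z (leftOut f)))
    (P : BNC χ' → Prop) :
    ∑ π : BNC χ with Saturated f π.1 ∧ P (h.restrict π), S.cumulant π Z
      = ∑ τ : BNC χ' with P τ, S.cumulant τ Z' := by
  -- As functions of `τ`, the fibre sums on the right have lower sums equal to the moment of
  -- `h.extend τ`, which is the moment of `τ` for the contracted word. Möbius inversion in `BNC χ'`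
  -- identifies them with the cumulants of that word.
  have key : ∀ τ : BNC χ', S.cumulant τ Z' =
      ∑ π : BNC χ with Saturated f π.1 ∧ h.restrict π = τ, S.cumulant π Z := by
    intro τ
    unfold BBSpace.cumulant muBNC
    refine sum_mu_smul_of_eq_sum (𝕜 := ℂ)
      (fun τ => ∑ π : BNC χ with Saturated f π.1 ∧ h.restrict π = τ,
        ∑ σ : BNC χ with σ ≤ π, IncidenceAlgebra.mu ℂ σ π • S.moment σ Z)
      (fun τ => S.moment τ Z') (fun τ => ?_) τ
    rw [← h.moment_extend S τ Z hZ Z' hne heq, ← S.sum_cumulant_le]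
    unfold BBSpace.cumulant muBNC
    simp only [le_extend_iff]
    rw [← Finset.sum_fiberwise_of_maps_to (s := {π : BNC χ | Saturated f π.1 ∧ h.restrict π ≤ τ})
      (t := {ρ : BNC χ' | ρ ≤ τ}) (g := h.restrict) (by simp)]
    refine Finset.sum_congr rfl fun ρ hρ => Finset.sum_congr ?_ fun _ _ => rfl
    ext π
    simp only [Finset.mem_filter, Finset.mem_univ, true_and] at hρ ⊢
    constructor
    · rintro ⟨⟨h1, -⟩, h3⟩; exact ⟨h1, h3⟩
    · rintro ⟨h1, rfl⟩; exact ⟨⟨h1, hρ⟩, rfl⟩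
  simp only [key]
  rw [← Finset.sum_fiberwise_of_maps_to (s := {π : BNC χ | Saturated f π.1 ∧ P (h.restrict π)})
    (t := {ρ : BNC χ' | P ρ}) (g := h.restrict) (by simp)]
  refine Finset.sum_congr rfl fun ρ hρ => Finset.sum_congr ?_ fun _ _ => rfl
  ext π
  simp only [Finset.mem_filter, Finset.mem_univ, true_and] at hρ ⊢
  constructor
  · rintro ⟨⟨h1, -⟩, h3⟩; exact ⟨h1, h3⟩
  · rintro ⟨h1, rfl⟩; exact ⟨⟨h1, hρ⟩, rfl⟩

end Sums

end IsContraction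

end Contraction

end BiFree

namespace BiFree

/-! ### Positions -/

/-- The position of an index with respect to `≺_χ` if the first `n` indices are left and the other
ones are right. -/
def position {N : ℕ} (n : ℕ) (k : Fin N) : Fin N :=
  ⟨if (k : ℕ) < n then k else N + n - 1 - k, by split_ifs <;> omega⟩

theorem position_val {N : ℕ} (n : ℕ) (k : Fin N) :
    (position n k : ℕ) = if (k : ℕ) < n then (k : ℕ) else N + n - 1 - k := rfl

/-- Right indices are reflected by `k ↦ N + n - 1 - k`, left ones are fixed; one involution thus
converts indices to positions and back. -/
theorem position_position {N : ℕ} (n : ℕ) (k : Fin N) : position n (position n k) = k := by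
  ext
  simp only [position_val]
  split_ifs <;> omega

theorem position_injective {N : ℕ} (n : ℕ) {k l : Fin N} (h : (position n k : ℕ) = position n l) :
    k = l := by
  have := congrArg (position n) (Fin.ext h)
  rwa [position_position, position_position] at this

theorem position_lt_iff {N : ℕ} (n : ℕ) (k : Fin N) : (position n k : ℕ) < n ↔ (k : ℕ) < n := by
  rw [position_val]
  split_ifs <;> omega

theorem prec_iff_position {N n : ℕ} {χ : Fin N → Side} (hχ : ∀ k, χ k = Side.left ↔ (k : ℕ) < n)
    (i k : Fin N) : Prec χ i k ↔ position n i < position n k := by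
  have hi := hχ i
  have hk := hχ k
  rw [Fin.lt_def, position_val, position_val]
  cases hi' : χ i <;> cases hk' : χ k <;> simp only [hi', hk', true_iff, reduceCtorEq, false_iff] at hi hk
  · rw [prec_left_left hi' hk', if_pos hi, if_pos hk, Fin.lt_def]
  · refine iff_of_true (prec_left_right hi' hk') ?_
    rw [if_pos hi, if_neg hk]; omega
  · refine iff_of_false (not_prec_right_left hi' hk') ?_
    rw [if_neg hi, if_pos hk]; omega
  · rw [prec_right_right hi' hk', if_neg hi, if_neg hk, Fin.lt_def]; omega

/-- The map that leaves out the `t` positions after `a`. -/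
def skip (a t i : ℕ) : ℕ := if i ≤ a then i else i + t

theorem skip_lt {N N' a t : ℕ} (hN : N = N' + t) (i : Fin N') : skip a t i < N := by
  unfold skip
  split_ifs <;> omega

/-- The map of indices that leaves out the `t` positions after `a`. -/
def skipIndex {N N' : ℕ} (n n' a t : ℕ) (hN : N = N' + t) (k : Fin N') : Fin N :=
  position n ⟨skip a t (position n' k), skip_lt hN _⟩

section SkipIndex

variable {N N' n n' a t : ℕ} (hN : N = N' + t)

theorem position_skipIndex (k : Fin N') :
    (position n (skipIndex n n' a t hN k) : ℕ) = skip a t (position n' k) := by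
  rw [skipIndex, position_position]

theorem notMem_range_skipIndex (ha : a < N') (g : Fin N) :
    g ∉ Set.range (skipIndex n n' a t hN) ↔
      a < (position n g : ℕ) ∧ (position n g : ℕ) ≤ a + t := by
  constructor
  · intro hg
    by_contra hcon
    refine hg ?_
    have hpos := (position n g).2
    by_cases h1 : (position n g : ℕ) ≤ a
    · refine ⟨position n' ⟨position n g, by omega⟩, ?_⟩
      refine position_injective n ?_
      rw [position_skipIndex, position_position]
      simp [skip, h1]
    · refine ⟨position n' ⟨position n g - t, by omega⟩, ?_⟩
      refine position_injective n ?_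
      rw [position_skipIndex, position_position]
      simp only [skip]
      rw [if_neg (by omega)]
      omega
  · rintro ⟨h1, h2⟩ ⟨k, rfl⟩
    rw [position_skipIndex] at h1 h2
    unfold skip at h1 h2
    split_ifs at h1 h2 <;> omega

/-- `hskip` says that surviving positions keep their label. On right letters the reflections in
source and target cancel, so monotonicity of `skip` on positions gives monotonicity on indices as
well. -/
theorem isContraction_skipIndex {χ : Fin N → Side} {χ' : Fin N' → Side} (ha : a < N')
    (hχ : ∀ k, χ k = Side.left ↔ (k : ℕ) < n) (hχ' : ∀ k, χ' k = Side.left ↔ (k : ℕ) < n')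
    (hskip : ∀ i < N', (skip a t i < n ↔ i < n')) :
    IsContraction χ χ' (skipIndex n n' a t hN) (position n' ⟨a, ha⟩) where
  strictMono := by
    intro k l hkl
    rw [Fin.lt_def] at hkl ⊢
    have hk := hskip _ (position n' k).2
    have hl := hskip _ (position n' l).2
    simp only [skipIndex, position_val (n := n)]
    have e1 := position_val n' k
    have e2 := position_val n' l
    generalize (position n' k : ℕ) = pk at *
    generalize (position n' l : ℕ) = pl at *
    unfold skip at *
    split_ifs at * <;> omega
  side := by
    intro i
    have h1 : χ (skipIndex n n' a t hN i) = Side.left ↔ skip a t (position n' i) < n := by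
      rw [hχ, ← position_lt_iff, position_skipIndex]
    have h2 := hskip _ (position n' i).2
    rw [position_lt_iff] at h2
    have h3 := hχ' i
    have : χ (skipIndex n n' a t hN i) = Side.left ↔ χ' i = Side.left := by
      rw [h1, h3, ← h2]
    cases h4 : χ (skipIndex n n' a t hN i) <;> cases h5 : χ' i <;> simp_all
  prec_iff := by
    intro g hg i
    rw [notMem_range_skipIndex hN ha] at hg
    rw [prec_iff_position hχ, prec_iff_position hχ', Fin.lt_def, position_skipIndex,
      position_position, Fin.lt_def]
    simp only [skip]
    split_ifs <;> omega

end SkipIndex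

/-! ### Classifying partitions by the block of the first index -/

section Classification

variable {N N' n n' a t : ℕ}

/-- The first `j` positions lie in one block. -/
def InitialBlock (n j : ℕ) (π : Setoid (Fin N)) : Prop :=
  ∀ k l : Fin N, (position n k : ℕ) < j → (position n l : ℕ) < j → π k l

/-- The first `a + 1` positions lie in one block, which contains none of the next `t` positions. -/
def InitialBlockWithGap (n a t : ℕ) (π : Setoid (Fin N)) : Prop :=
  InitialBlock n (a + 1) π ∧ ∀ k l : Fin N, (position n k : ℕ) ≤ a → a < (position n l : ℕ) →
    (position n l : ℕ) ≤ a + t → ¬ π k l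

theorem initialBlockWithGap_zero (π : Setoid (Fin N)) :
    InitialBlockWithGap n a 0 π ↔ InitialBlock n (a + 1) π :=
  ⟨fun h => h.1, fun h => ⟨h, fun k l _ h1 h2 => by omega⟩⟩

theorem exists_position (n : ℕ) {i : ℕ} (hi : i < N) : ∃ k : Fin N, (position n k : ℕ) = i :=
  ⟨position n ⟨i, hi⟩, by rw [position_position]⟩

/-- Both sides say that the block of the first `a + 1` positions omits exactly the next `t` and then
contains position `a + t + 1`. Given this, non-crossing forces the gap to be a union of blocks. -/
theorem saturated_and_initialBlock_iff (hN : N = N' + t) (ha : a + 1 < N') {χ : Fin N → Side}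
    (hχ : ∀ k, χ k = Side.left ↔ (k : ℕ) < n) (π : BNC χ) :
    IsContraction.Saturated (skipIndex n n' a t hN) π.1 ∧
        InitialBlock n' (a + 2) (π.1.comap (skipIndex n n' a t hN)) ↔
      InitialBlockWithGap n a t π.1 ∧ ¬ InitialBlockWithGap n a (t + 1) π.1 := by
  -- `o` is the first letter and `y` the first letter after the gap.
  obtain ⟨o, ho⟩ := exists_position n (i := 0) (N := N) (by omega)
  obtain ⟨y, hy⟩ := exists_position n (i := a + t + 1) (N := N) (by omega)
  have hlift : ∀ k : Fin N, ((position n k : ℕ) ≤ a ∨ (position n k : ℕ) = a + t + 1) →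
      ∃ i : Fin N', skipIndex n n' a t hN i = k ∧ (position n' i : ℕ) < a + 2 := by
    intro k hk
    have : ¬ k ∉ Set.range (skipIndex n n' a t hN) := by
      rw [notMem_range_skipIndex hN (by omega)]; omega
    obtain ⟨i, rfl⟩ := not_not.1 this
    refine ⟨i, rfl, ?_⟩
    rw [position_skipIndex] at hk
    unfold skip at hk
    split_ifs at hk <;> omega
  constructor
  · rintro ⟨hsat, hinit⟩
    have hrel : ∀ k l : Fin N, ((position n k : ℕ) ≤ a ∨ (position n k : ℕ) = a + t + 1) →
        ((position n l : ℕ) ≤ a ∨ (position n l : ℕ) = a + t + 1) → π.1 k l := by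
      intro k l hk hl
      obtain ⟨i, rfl, hi⟩ := hlift k hk
      obtain ⟨i', rfl, hi'⟩ := hlift l hl
      exact hinit i i' hi hi'
    refine ⟨⟨fun k l hk hl => hrel k l (by omega) (by omega), fun k l hk h1 h2 hkl => ?_⟩, ?_⟩
    · have hl : l ∉ Set.range (skipIndex n n' a t hN) := by
        rw [notMem_range_skipIndex hN (by omega)]; omega
      have := hsat l hl k (π.1.symm hkl)
      rw [notMem_range_skipIndex hN (by omega)] at this
      omega
    · intro hgap
      exact hgap.2 o y (by omega) (by omega) (by omega) (hrel o y (by omega) (by omega))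
  · rintro ⟨⟨hinit, hgap⟩, hnot⟩
    have hoy : π.1 o y := by
      by_contra hcon
      refine hnot ⟨hinit, fun k l hk h1 h2 hkl => ?_⟩
      by_cases hl : (position n l : ℕ) ≤ a + t
      · exact hgap k l hk h1 hl hkl
      · obtain rfl : l = y := position_injective n (by omega)
        exact hcon (π.1.trans (hinit o k (by omega) (by omega)) hkl)
    refine ⟨fun g hg x hgx => ?_, fun i i' hi hi' => ?_⟩
    · rw [notMem_range_skipIndex hN (by omega)] at hg ⊢
      by_contra hx
      by_cases hxa : (position n x : ℕ) ≤ a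
      · exact hgap x g hxa hg.1 hg.2 (π.1.symm hgx)
      · rcases eq_or_ne x y with rfl | hxy
        · exact hgap o g (by omega) hg.1 hg.2 (π.1.trans hoy (π.1.symm hgx))
        -- Here `o ≺ g ≺ y ≺ x` with `o`, `y` in one block and `g`, `x` in one block: non-crossing
        -- would put the gap letter `g` into the block of `o`.
        · have hne : (position n x : ℕ) ≠ position n y := fun e => hxy (position_injective n e)
          refine hgap o g (by omega) hg.1 hg.2 (π.2 o g y x ?_ ?_ ?_ hoy hgx) <;>
            rw [prec_iff_position hχ, Fin.lt_def] <;> omega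
    · have key : ∀ i : Fin N', (position n' i : ℕ) < a + 2 → π.1 o (skipIndex n n' a t hN i) := by
        intro i hi
        have hp := position_skipIndex (n := n) (n' := n') (a := a) (t := t) hN i
        unfold skip at hp
        split_ifs at hp with hle
        · exact hinit _ _ (by omega) (by omega)
        · have : skipIndex n n' a t hN i = y := position_injective n (by omega)
          rw [this]; exact hoy
      exact π.1.trans (π.1.symm (key i hi)) (key i' hi')

/-- Now the gap reaches the end of the word, so no later letter can cross it and non-crossing is not
needed. -/
theorem saturated_and_initialBlock_iff_last (hN : N = N' + t) (ha : a + 1 = N')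
    (π : Setoid (Fin N)) :
    IsContraction.Saturated (skipIndex n n' a t hN) π ∧
        InitialBlock n' (a + 1) (π.comap (skipIndex n n' a t hN)) ↔
      InitialBlockWithGap n a t π := by
  constructor
  · rintro ⟨hsat, hinit⟩
    refine ⟨fun k l hk hl => ?_, fun k l hk h1 h2 hkl => ?_⟩
    · have hlift : ∀ k : Fin N, (position n k : ℕ) < a + 1 →
          ∃ i : Fin N', skipIndex n n' a t hN i = k := by
        intro k hk
        have : ¬ k ∉ Set.range (skipIndex n n' a t hN) := by
          rw [notMem_range_skipIndex hN (by omega)]; omega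
        exact not_not.1 this
      obtain ⟨i, rfl⟩ := hlift k hk
      obtain ⟨i', rfl⟩ := hlift l hl
      exact hinit i i' (by omega) (by omega)
    · have hl : l ∉ Set.range (skipIndex n n' a t hN) := by
        rw [notMem_range_skipIndex hN (by omega)]; omega
      have := hsat l hl k (π.symm hkl)
      rw [notMem_range_skipIndex hN (by omega)] at this
      omega
  · rintro ⟨hinit, hgap⟩
    refine ⟨fun g hg x hgx => ?_, fun i i' hi hi' => hinit _ _ ?_ ?_⟩
    · rw [notMem_range_skipIndex hN (by omega)] at hg ⊢
      by_contra hx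
      exact hgap x g (by omega) hg.1 hg.2 (π.symm hgx)
    · rw [position_skipIndex]; unfold skip; split_ifs <;> omega
    · rw [position_skipIndex]; unfold skip; split_ifs <;> omega

end Classification

end BiFree

namespace BiFree

/-! ### Words -/

/-- A word of labelled operators, listed in the order `≺_χ`. -/
abbrev Word (A : Type*) := List (Side × A)

/-- Whether a label is `ℓ`. -/
def Side.isLeft : Side → Bool
  | Side.left => true
  | Side.right => false

theorem Side.isLeft_iff {s : Side} : s.isLeft = true ↔ s = Side.left := by
  cases s <;> simp [Side.isLeft]

theorem Side.ne_left_iff {s : Side} : s ≠ Side.left ↔ s = Side.right := by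
  cases s <;> simp

section Words

variable {A : Type*}

/-- In the word all left operators precede all right operators. -/
def LeftFirst (w : Word A) : Prop := w.Pairwise fun y z => z.1 = Side.left → y.1 = Side.left

/-- The number of left operators. -/
def leftCount (w : Word A) : ℕ := w.countP fun z => z.1.isLeft

theorem LeftFirst.side_eq_left_iff {w : Word A} (hw : LeftFirst w) (i : ℕ) (hi : i < w.length) :
    w[i].1 = Side.left ↔ i < leftCount w := by
  induction w generalizing i with
  | nil => simp at hi
  | cons z w ih =>
    obtain ⟨h1, h2⟩ := List.pairwise_cons.1 hw
    cases hz : z.1 with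
    | left =>
      have hc : leftCount (z :: w) = leftCount w + 1 := by
        simp [leftCount, Side.isLeft_iff, hz]
      rw [hc]
      cases i with
      | zero => simp [hz]
      | succ i => simpa using ih h2 i (by simpa using hi)
    | right =>
      have hall : ∀ y ∈ w, y.1 = Side.right := fun y hy => by
        rw [← Side.ne_left_iff]
        intro hl
        rw [h1 y hy hl] at hz
        cases hz
      have hc : leftCount (z :: w) = 0 := by
        rw [leftCount, List.countP_eq_zero]
        intro y hy
        rw [Side.isLeft_iff, ← ne_eq, Side.ne_left_iff]
        rcases List.mem_cons.1 hy with rfl | hy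
        · exact hz
        · exact hall y hy
      rw [hc]
      simp only [not_lt_zero, iff_false, Side.ne_left_iff]
      rcases List.mem_cons.1 (List.getElem_mem hi) with e | hy
      · rw [e, hz]
      · exact hall _ hy

/-- The labels of a word as a function of the index. -/
def wordSide (w : Word A) (k : Fin w.length) : Side := (w[position (leftCount w) k]).1

/-- The operators of a word as a function of the index. -/
def wordOp (w : Word A) (k : Fin w.length) : A := (w[position (leftCount w) k]).2

theorem LeftFirst.wordSide_eq_left_iff {w : Word A} (hw : LeftFirst w) (k : Fin w.length) :
    wordSide w k = Side.left ↔ (k : ℕ) < leftCount w := by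
  rw [← position_lt_iff (leftCount w) k]
  exact hw.side_eq_left_iff _ _

/-- The product of a word: in the order of the list for the left operators, in the reverse order
for the right operators. -/
def wordProd [Monoid A] : Word A → A
  | [] => 1
  | (Side.left, Z) :: w => Z * wordProd w
  | (Side.right, Z) :: w => wordProd w * Z

theorem sort_insert_max {α : Type*} [LinearOrder α] {s : Finset α} {a : α} (h : ∀ b ∈ s, b < a) :
    (insert a s).sort (· ≤ ·) = s.sort (· ≤ ·) ++ [a] := by
  have ha : a ∉ s := fun ha => lt_irrefl _ (h a ha)
  refine List.Perm.eq_of_pairwise' (Finset.pairwise_sort _ _) ?_ ?_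
  · refine List.pairwise_append.2 ⟨Finset.pairwise_sort _ _, by simp, fun b hb c hc => ?_⟩
    rw [List.mem_singleton.1 hc]
    exact (h b ((Finset.mem_sort _).1 hb)).le
  · refine (List.perm_ext_iff_of_nodup (Finset.sort_nodup _ _) ?_).2 fun b => ?_
    · refine List.nodup_append.2 ⟨Finset.sort_nodup _ _, by simp, fun b hb c hc => ?_⟩
      rw [List.mem_singleton.1 hc]
      exact (h b ((Finset.mem_sort _).1 hb)).ne
    · simp [or_comm]

/-- The product, in the order of the indices, over an interval of positions. -/
theorem LeftFirst.prod_interval [Monoid A] {w : Word A} (hw : LeftFirst w) (t a : ℕ)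
    (h : a + t ≤ w.length) (V : Finset (Fin w.length))
    (hV : ∀ k, k ∈ V ↔ a ≤ (position (leftCount w) k : ℕ) ∧
      (position (leftCount w) k : ℕ) < a + t) :
    ((V.sort (· ≤ ·)).map (wordOp w)).prod = wordProd ((w.drop a).take t) := by
  induction t generalizing a V with
  | zero =>
    obtain rfl : V = ∅ := Finset.eq_empty_of_forall_notMem fun k hk => by
      have := (hV k).1 hk; omega
    simp [wordProd]
  | succ t ih =>
    have ha : a < w.length := by omega
    rw [List.drop_eq_getElem_cons ha, List.take_succ_cons]
    obtain ⟨k₀, hk₀⟩ : ∃ k₀ : Fin w.length, position (leftCount w) k₀ = ⟨a, ha⟩ :=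
      ⟨_, position_position _ _⟩
    have hk₀' : (position (leftCount w) k₀ : ℕ) = a := by rw [hk₀]
    have hop : wordOp w k₀ = w[a].2 := by simp [wordOp, hk₀]
    set V' : Finset (Fin w.length) := V.erase k₀ with hV'def
    have hV' : ∀ k, k ∈ V' ↔ a + 1 ≤ (position (leftCount w) k : ℕ) ∧
        (position (leftCount w) k : ℕ) < a + 1 + t := by
      intro k
      rw [Finset.mem_erase, hV]
      constructor
      · rintro ⟨h1, h2, h3⟩
        have : (position (leftCount w) k : ℕ) ≠ a := fun e =>
          h1 (position_injective _ (e.trans hk₀'.symm))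
        omega
      · rintro ⟨h1, h2⟩
        refine ⟨?_, by omega, by omega⟩
        rintro rfl
        omega
    have hins : insert k₀ V' = V := Finset.insert_erase ((hV k₀).2 (by omega))
    have hnot : k₀ ∉ V' := Finset.notMem_erase _ _
    have hside := hw.side_eq_left_iff a ha
    rw [← hins]
    rcases hz : w[a] with ⟨s, Z⟩
    rw [hz] at hop hside
    -- The `≺_χ`-first letter of the interval has the smallest index if it is left and the largest
    -- if it is right; hence it goes to the front or to the end of the product.
    cases s with
    | left =>
      have hlt : a < leftCount w := by simpa using hside
      rw [Finset.sort_insert]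
      · rw [List.map_cons, List.prod_cons, ih (a + 1) (by omega) V' hV', hop, wordProd]
      · intro b hb
        have h1 := ((hV' b).1 hb).1
        rw [Fin.le_def]
        rw [position_val] at h1 hk₀'
        split_ifs at h1 hk₀' <;> omega
      · exact hnot
    | right =>
      have hlt : ¬ a < leftCount w := by simpa using hside
      rw [sort_insert_max]
      · rw [List.map_append, List.prod_append, ih (a + 1) (by omega) V' hV', wordProd]
        simp [hop]
      · intro b hb
        have h1 := ((hV' b).1 hb).1
        rw [Fin.lt_def]
        rw [position_val] at h1 hk₀'
        split_ifs at h1 hk₀' <;> omega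

end Words

/-! ### Partial cumulants of words and their recursion -/

namespace BBSpace

variable {B A : Type*} [Ring B] [Algebra ℂ B] [Ring A] [Algebra ℂ A] (S : BBSpace B A)

/-- A word of operators from the appropriate algebras in which the left operators come first. -/
structure Admissible (w : Word A) : Prop where
  mem : ∀ z ∈ w, z.2 ∈ S.sideAlgebra z.1
  leftFirst : LeftFirst w

/-- The moment of a word. -/
def wordMoment (w : Word A) : B := S.E (wordProd w)

/-- Insert a coefficient after a letter. -/
def insAfter (z : Side × A) (b : B) : Side × A := (z.1, S.insertAfter z.1 z.2 b)

open Classical in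
/-- The sum of the cumulants of a word over all partitions for which the first `j` letters lie in
one block. -/
noncomputable def partialCumulant (w : Word A) (j : ℕ) : B :=
  ∑ π : BNC (wordSide w) with InitialBlock (leftCount w) j π.1, S.cumulant π (wordOp w)

variable {S}

theorem Admissible.wordOp_mem {w : Word A} (hw : S.Admissible w) (k : Fin w.length) :
    wordOp w k ∈ S.sideAlgebra (wordSide w k) :=
  hw.mem _ (List.getElem_mem _)

theorem blockMoment_interval {w : Word A} (hw : LeftFirst w) (t a : ℕ)
    (h : a + t ≤ w.length) (V : Finset (Fin w.length))
    (hV : ∀ k, k ∈ V ↔ a ≤ (position (leftCount w) k : ℕ) ∧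
      (position (leftCount w) k : ℕ) < a + t) :
    S.blockMoment (wordOp w) V = S.wordMoment ((w.drop a).take t) := by
  rw [blockMoment, hw.prod_interval t a h V hV, wordMoment]

theorem moment_one {N : ℕ} {χ : Fin N → Side} (hN : 0 < N) (Z : Fin N → A) :
    S.moment (BNC.one χ) Z = S.blockMoment Z Finset.univ := by
  rw [moment, S.momentOn_eq_blockMoment_mul (G := Finset.univ) (T := ∅), S.momentOn_empty, mul_one]
  · simp
  · exact Finset.ne_empty_of_mem (Finset.mem_univ ⟨0, hN⟩)
  · simp
  · intro g _ k _
    simp only [Finset.mem_univ, iff_true]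
    trivial

/-- For `j = 1` the block condition is void and the moment–cumulant formula applies. At the other
end, `j = w.length` leaves only the one-block partition. -/
theorem partialCumulant_one {w : Word A} (hw : LeftFirst w) (hne : w ≠ []) :
    S.partialCumulant w 1 = S.wordMoment w := by
  classical
  have hN : 0 < w.length := List.length_pos_of_ne_nil hne
  have h := S.sum_cumulant_le (BNC.one (wordSide w)) (wordOp w)
  rw [moment_one hN, blockMoment_interval hw w.length 0 (by simp) _ (by simp)] at h
  rw [List.drop_zero, List.take_length] at h
  rw [← h, partialCumulant]
  refine Finset.sum_congr ?_ fun _ _ => rfl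
  ext π
  simp only [Finset.mem_filter, Finset.mem_univ, true_and]
  refine iff_of_true (fun k l hk hl => ?_) fun x y _ => trivial
  obtain rfl : k = l := position_injective (leftCount w) (by omega)
  exact π.1.refl _

theorem partialCumulant_length (w : Word A) :
    S.partialCumulant w w.length = S.kappa (wordSide w) (wordOp w) := by
  classical
  rw [partialCumulant, kappa]
  have : ({π | InitialBlock (leftCount w) w.length π.1} : Finset (BNC (wordSide w)))
      = {BNC.one (wordSide w)} := by
    ext π
    simp only [Finset.mem_filter, Finset.mem_univ, true_and, Finset.mem_singleton]
    constructor
    · intro h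
      refine Subtype.ext (Setoid.ext fun k l => ?_)
      exact iff_of_true (h k l (Fin.isLt _) (Fin.isLt _)) trivial
    · rintro rfl k l _ _
      trivial
  rw [this, Finset.sum_singleton]

/-- The word in which the `s` letters after the letter `z` are replaced by their moment. -/
def contract (S : BBSpace B A) (p : Word A) (z : Side × A) (v : Word A) (s : ℕ) : Word A :=
  p ++ S.insAfter z (S.wordMoment (v.take s)) :: v.drop s

theorem length_contract (p : Word A) (z : Side × A) (v : Word A) {s : ℕ} (hs : s ≤ v.length) :
    (p ++ z :: v).length = (S.contract p z v s).length + s := by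
  simp [contract]; omega

theorem Admissible.contract {p : Word A} {z : Side × A} {v : Word A}
    (hw : S.Admissible (p ++ z :: v)) (s : ℕ) : S.Admissible (S.contract p z v s) := by
  constructor
  · intro y hy
    rw [BBSpace.contract, List.mem_append, List.mem_cons] at hy
    rcases hy with hy | rfl | hy
    · exact hw.mem y (by simp [hy])
    · exact S.insertAfter_mem (hw.mem z (by simp)) _
    · exact hw.mem y (by simp [List.mem_of_mem_drop hy])
  · have h := List.pairwise_append.1 hw.leftFirst
    have h' := List.pairwise_cons.1 h.2.1
    refine List.pairwise_append.2 ⟨h.1, List.pairwise_cons.2 ⟨?_, ?_⟩, ?_⟩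
    · exact fun y hy => h'.1 y (List.mem_of_mem_drop hy)
    · exact h'.2.sublist (List.drop_sublist _ _)
    · intro y hy x hx
      rcases List.mem_cons.1 hx with rfl | hx
      · exact h.2.2 y hy z (by simp)
      · exact h.2.2 y hy x (by simp [List.mem_of_mem_drop hx])

theorem getElem_contract_of_ne {p : Word A} {z : Side × A} {v : Word A} {s : ℕ}
    {i : ℕ} (hi : i < (S.contract p z v s).length)
    (hi' : skip p.length s i < (p ++ z :: v).length) (hne : i ≠ p.length) :
    (S.contract p z v s)[i] = (p ++ z :: v)[skip p.length s i] := by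
  rcases lt_or_gt_of_ne hne with h | h
  · simp only [skip, if_pos h.le, contract]
    rw [List.getElem_append_left h, List.getElem_append_left h]
  · obtain ⟨m, rfl⟩ : ∃ m, i = p.length + (m + 1) := ⟨i - p.length - 1, by omega⟩
    have : skip p.length s (p.length + (m + 1)) = p.length + (s + m + 1) := by
      rw [skip, if_neg (by omega)]; omega
    simp only [this, contract]
    rw [List.getElem_append_right (by omega), List.getElem_append_right (by omega)]
    simp

theorem getElem_contract_self {p : Word A} {z : Side × A} {v : Word A} {s : ℕ}
    (hi : p.length < (S.contract p z v s).length) :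
    (S.contract p z v s)[p.length] = S.insAfter z (S.wordMoment (v.take s)) := by
  simp [contract]

theorem side_getElem_contract {p : Word A} {z : Side × A} {v : Word A} {s : ℕ}
    {i : ℕ} (hi : i < (S.contract p z v s).length)
    (hi' : skip p.length s i < (p ++ z :: v).length) :
    (S.contract p z v s)[i].1 = (p ++ z :: v)[skip p.length s i].1 := by
  by_cases hne : i = p.length
  · subst hne
    rw [getElem_contract_self]
    simp [skip, insAfter]
  · rw [getElem_contract_of_ne hi hi' hne]

section Contract

variable {p : Word A} {z : Side × A} {v : Word A} {s : ℕ}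

theorem lt_length_contract : p.length < (S.contract p z v s).length := by
  simp [contract]

theorem Admissible.isContraction (hw : S.Admissible (p ++ z :: v)) (hs : s ≤ v.length) :
    IsContraction (wordSide (p ++ z :: v)) (wordSide (S.contract p z v s))
      (skipIndex (leftCount (p ++ z :: v)) (leftCount (S.contract p z v s)) p.length s
        (length_contract (S := S) p z v hs))
      (position (leftCount (S.contract p z v s)) ⟨p.length, lt_length_contract⟩) := by
  refine isContraction_skipIndex _ lt_length_contract
    hw.leftFirst.wordSide_eq_left_iff (hw.contract s).leftFirst.wordSide_eq_left_iff ?_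
  intro i hi
  have hi' : skip p.length s i < (p ++ z :: v).length :=
    skip_lt (length_contract (S := S) p z v hs) ⟨i, hi⟩
  rw [← hw.leftFirst.side_eq_left_iff _ hi', ← (hw.contract s).leftFirst.side_eq_left_iff _ hi,
    side_getElem_contract hi hi']

open Classical in
theorem Admissible.sum_cumulant_contract (hw : S.Admissible (p ++ z :: v)) (hs : s ≤ v.length)
    (P : Setoid (Fin (S.contract p z v s).length) → Prop) :
    ∑ π : BNC (wordSide (p ++ z :: v)) with
        IsContraction.Saturated (skipIndex (leftCount (p ++ z :: v))
          (leftCount (S.contract p z v s)) p.length s (length_contract (S := S) p z v hs)) π.1 ∧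
        P (π.1.comap (skipIndex (leftCount (p ++ z :: v))
          (leftCount (S.contract p z v s)) p.length s (length_contract (S := S) p z v hs))),
        S.cumulant π (wordOp (p ++ z :: v))
      = ∑ τ : BNC (wordSide (S.contract p z v s)) with P τ.1,
        S.cumulant τ (wordOp (S.contract p z v s)) := by
  refine (hw.isContraction hs).sum_cumulant_restrict S _ hw.wordOp_mem _ ?_ ?_ (fun τ => P τ.1)
  · intro i hi
    have hne : (position (leftCount (S.contract p z v s)) i : ℕ) ≠ p.length := fun e => by
      refine hi (position_injective (leftCount (S.contract p z v s)) ?_)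
      rw [position_position, e]
    simp only [wordOp, Fin.getElem_fin, position_skipIndex]
    rw [getElem_contract_of_ne _ _ hne]
  · have h1 : S.blockMoment (wordOp (p ++ z :: v)) (leftOut (skipIndex (leftCount (p ++ z :: v))
          (leftCount (S.contract p z v s)) p.length s (length_contract (S := S) p z v hs)))
        = S.wordMoment (v.take s) := by
      rw [blockMoment_interval hw.leftFirst s (p.length + 1)]
      · congr 2
        simp
      · simp; omega
      · intro k
        rw [mem_leftOut, notMem_range_skipIndex _ lt_length_contract]
        omega
    rw [h1]
    simp only [wordOp, wordSide, Fin.getElem_fin, position_skipIndex, position_position]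
    simp [getElem_contract_self, insAfter, skip]

/-- A gap of at least `s` letters either has at least `s + 1` letters or is followed at once by a
letter of the block. The latter partitions live on the contracted word, where one more initial
letter belongs to the block. -/
theorem Admissible.partialCumulant_contract (hw : S.Admissible (p ++ z :: v))
    (hs : s < v.length) :
    S.partialCumulant (S.contract p z v s) (p.length + 2)
      + (open Classical in ∑ π : BNC (wordSide (p ++ z :: v)) with
          InitialBlockWithGap (leftCount (p ++ z :: v)) p.length (s + 1) π.1,
          S.cumulant π (wordOp (p ++ z :: v)))
      = open Classical in ∑ π : BNC (wordSide (p ++ z :: v)) with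
          InitialBlockWithGap (leftCount (p ++ z :: v)) p.length s π.1,
          S.cumulant π (wordOp (p ++ z :: v)) := by
  classical
  rw [partialCumulant, ← hw.sum_cumulant_contract hs.le
    (InitialBlock (leftCount (S.contract p z v s)) (p.length + 2))]
  have hlen : p.length + 1 < (S.contract p z v s).length := by
    simp [BBSpace.contract]; omega
  simp only [saturated_and_initialBlock_iff (length_contract p z v hs.le) hlen
    hw.leftFirst.wordSide_eq_left_iff]
  rw [← Finset.sum_filter_not_add_sum_filter
    (s := {π : BNC (wordSide (p ++ z :: v)) | InitialBlockWithGap _ p.length s π.1})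
    (p := fun π => InitialBlockWithGap (leftCount (p ++ z :: v)) p.length (s + 1) π.1),
    Finset.filter_filter, Finset.filter_filter]
  congr 1
  refine Finset.sum_congr ?_ fun _ _ => rfl
  ext π
  simp only [Finset.mem_filter, Finset.mem_univ, true_and]
  refine ⟨fun h => ⟨⟨h.1, fun k l hk h1 h2 => h.2 k l hk h1 (by omega)⟩, h⟩, fun h => h.2⟩

/-- The partial cumulants are expanded according to the letters between the `j`-th letter and the
next letter of the block of the first letter. -/
theorem Admissible.partialCumulant_eq (hw : S.Admissible (p ++ z :: v)) :
    S.partialCumulant (p ++ z :: v) (p.length + 1) =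
      ∑ s ∈ Finset.range v.length, S.partialCumulant (S.contract p z v s) (p.length + 2)
        + S.partialCumulant (p ++ [S.insAfter z (S.wordMoment v)]) (p.length + 1) := by
  classical
  -- `R s` collects the partitions whose gap after `z` has at least `s` letters. `R 0` is the left
  -- side, consecutive differences are the summands, and `R v.length` belongs to blocks that end at
  -- `z`.
  set R : ℕ → B := fun s => ∑ π : BNC (wordSide (p ++ z :: v)) with
    InitialBlockWithGap (leftCount (p ++ z :: v)) p.length s π.1,
    S.cumulant π (wordOp (p ++ z :: v)) with hR
  have h0 : S.partialCumulant (p ++ z :: v) (p.length + 1) = R 0 := by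
    simp only [hR, partialCumulant, initialBlockWithGap_zero]
  have hlast : S.partialCumulant (p ++ [S.insAfter z (S.wordMoment v)]) (p.length + 1)
      = R v.length := by
    have e : p ++ [S.insAfter z (S.wordMoment v)] = S.contract p z v v.length := by
      simp [BBSpace.contract]
    rw [e, partialCumulant, ← hw.sum_cumulant_contract le_rfl
      (InitialBlock (leftCount (S.contract p z v v.length)) (p.length + 1))]
    have hlen : p.length + 1 = (S.contract p z v v.length).length := by
      simp [BBSpace.contract]
    simp only [saturated_and_initialBlock_iff_last (length_contract p z v le_rfl) hlen, hR]
  have hstep : ∀ s ∈ Finset.range v.length,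
      S.partialCumulant (S.contract p z v s) (p.length + 2) = R s - R (s + 1) := by
    intro s hs
    rw [eq_sub_iff_add_eq]
    exact hw.partialCumulant_contract (Finset.mem_range.1 hs)
  rw [Finset.sum_congr rfl hstep, Finset.sum_range_sub', h0, hlast]
  abel

end Contract

end BBSpace

end BiFree

/-! ### Transfer of relations from moments to partial cumulants -/

namespace BiFree

namespace BBSpace

section Lists

variable {A B : Type*}

theorem exists_eq_append_cons {α : Type*} {w : List α} {a : ℕ} (ha : a < w.length) :
    ∃ p z v, w = p ++ z :: v ∧ p.length = a :=
  ⟨w.take a, w[a], w.drop (a + 1), by simp, by simp; omega⟩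

theorem wordProd_add [Ring A] (p q : Word A) (s : Side) (x y : A) :
    wordProd (p ++ (s, x + y) :: q) = wordProd (p ++ (s, x) :: q)
      + wordProd (p ++ (s, y) :: q) := by
  induction p with
  | nil => cases s <;> simp [wordProd, add_mul, mul_add]
  | cons z p ih =>
    obtain ⟨s', Z⟩ := z
    cases s' <;> simp [wordProd, ih, add_mul, mul_add]

theorem leftFirst_iff_map (w : Word A) :
    LeftFirst w ↔ (w.map Prod.fst).Pairwise fun s t => t = Side.left → s = Side.left := by
  rw [List.pairwise_map]; rfl

/-- A word with a coefficient for each letter. -/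
abbrev CoefWord (B A : Type*) := List ((Side × A) × B)

/-- The first coefficient, or `h` for the empty word. -/
def headCoef (T : CoefWord B A) (h : B) : B :=
  match T with
  | [] => h
  | y :: _ => y.2

theorem headCoef_append (T T' : CoefWord B A) (h : B) :
    headCoef (T ++ T') h = headCoef T (headCoef T' h) := by
  cases T <;> rfl

theorem headCoef_cons (y : (Side × A) × B) (T : CoefWord B A) (h : B) :
    headCoef (y :: T) h = y.2 := rfl

end Lists

section Induction

variable {B A : Type*} [Ring B] [Algebra ℂ B] [Ring A] [Algebra ℂ A] {S : BBSpace B A}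

theorem wordMoment_nil : S.wordMoment [] = 1 := S.E_one

theorem insAfter_one (z : Side × A) : S.insAfter z 1 = z := by
  simp [insAfter, insertAfter_one]

theorem insAfter_insAfter (z : Side × A) (a b : B) :
    S.insAfter (S.insAfter z a) b = S.insAfter z (a * b) := by
  simp [insAfter, insertAfter_insertAfter]

/-- The word in which the `t` letters after position `a` are replaced by their moment. -/
def contractAt (S : BBSpace B A) (w : Word A) (a t : ℕ) : Word A :=
  match w.drop a with
  | [] => w
  | z :: v => S.contract (w.take a) z v t

theorem contractAt_append (p : Word A) (z : Side × A) (v : Word A) (t : ℕ) :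
    S.contractAt (p ++ z :: v) p.length t = S.contract p z v t := by
  simp [contractAt]

theorem length_contractAt {w : Word A} {a t : ℕ} (h : a + 1 + t ≤ w.length) :
    (S.contractAt w a t).length + t = w.length := by
  obtain ⟨p, z, v, rfl, rfl⟩ := exists_eq_append_cons (w := w) (a := a) (by omega)
  rw [contractAt_append]
  refine (length_contract p z v ?_).symm
  simp at h; omega

theorem Admissible.contractAt {w : Word A} (hw : S.Admissible w) (a t : ℕ) :
    S.Admissible (S.contractAt w a t) := by
  by_cases ha : a < w.length
  · obtain ⟨p, z, v, rfl, rfl⟩ := exists_eq_append_cons ha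
    rw [contractAt_append]
    exact hw.contract t
  · rw [BBSpace.contractAt, List.drop_eq_nil_of_le (by omega)]
    exact hw

/-- The summand `s = 0` of `Admissible.partialCumulant_eq` has an empty gap with moment `1`, so it
concerns `w` itself. Solving for it leaves a smaller `j` or shorter words, which permits induction.
-/
theorem Admissible.partialCumulant_succ {w : Word A} (hw : S.Admissible w) {a x : ℕ}
    (ha : w.length = a + 2 + x) :
    S.partialCumulant w (a + 2) = S.partialCumulant w (a + 1)
      - ∑ s ∈ Finset.range x, S.partialCumulant (S.contractAt w a (s + 1)) (a + 2)
      - S.partialCumulant (S.contractAt w a (x + 1)) (a + 1) := by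
  obtain ⟨p, z, v, rfl, rfl⟩ := exists_eq_append_cons (w := w) (a := a) (by omega)
  have hv : v.length = x + 1 := by simp at ha; omega
  have h := hw.partialCumulant_eq
  rw [hv, Finset.sum_range_succ'] at h
  have h0 : S.contract p z v 0 = p ++ z :: v := by
    simp [BBSpace.contract, wordMoment_nil, insAfter_one]
  have h1 : S.contract p z v (x + 1) = p ++ [S.insAfter z (S.wordMoment v)] := by
    rw [← hv]; simp [BBSpace.contract]
  simp only [contractAt_append]
  rw [h0] at h
  rw [h, h1]
  abel

/-- A linear relation between moments that is stable under contractions holds for all partial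
cumulants. -/
theorem partialCumulant_relation (φ₀ φ₁ φ₂ : B →+ B) (r : Word A → Word A → Word A → Prop)
    (hadm : ∀ w₀ w₁ w₂, r w₀ w₁ w₂ → S.Admissible w₀ ∧ S.Admissible w₁ ∧ S.Admissible w₂)
    (hlen : ∀ w₀ w₁ w₂, r w₀ w₁ w₂ → w₁.length = w₀.length ∧ w₂.length = w₀.length)
    (hmom : ∀ w₀ w₁ w₂, r w₀ w₁ w₂ →
      φ₀ (S.wordMoment w₀) = φ₁ (S.wordMoment w₁) + φ₂ (S.wordMoment w₂))
    (hcon : ∀ w₀ w₁ w₂, r w₀ w₁ w₂ → ∀ a t, a + 1 + t ≤ w₀.length →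
      r (S.contractAt w₀ a t) (S.contractAt w₁ a t) (S.contractAt w₂ a t))
    {w₀ w₁ w₂ : Word A} (hr : r w₀ w₁ w₂) {j : ℕ} (hj : 1 ≤ j) (hjw : j ≤ w₀.length) :
    φ₀ (S.partialCumulant w₀ j) = φ₁ (S.partialCumulant w₁ j) + φ₂ (S.partialCumulant w₂ j) := by
  -- Outer induction on the length, inner induction on `j`; the base `j = 1` is the relation between
  -- moments.
  induction hN : w₀.length using Nat.strong_induction_on generalizing w₀ w₁ w₂ j with
  | _ N ih =>
  subst hN
  obtain ⟨h0, h1, h2⟩ := hadm _ _ _ hr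
  obtain ⟨l1, l2⟩ := hlen _ _ _ hr
  induction j, hj using Nat.le_induction with
  | base =>
    rw [partialCumulant_one h0.leftFirst (by rintro rfl; simp at hjw),
      partialCumulant_one h1.leftFirst (by rintro rfl; rw [← l1] at hjw; simp at hjw),
      partialCumulant_one h2.leftFirst (by rintro rfl; rw [← l2] at hjw; simp at hjw)]
    exact hmom _ _ _ hr
  | succ j hj ihj =>
    obtain ⟨a, rfl⟩ : ∃ a, j = a + 1 := ⟨j - 1, by omega⟩
    obtain ⟨x, hx⟩ : ∃ x, w₀.length = a + 2 + x := ⟨w₀.length - (a + 2), by omega⟩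
    have ihj' := ihj (by omega)
    have hc : ∀ s, s < x → φ₀ (S.partialCumulant (S.contractAt w₀ a (s + 1)) (a + 2))
        = φ₁ (S.partialCumulant (S.contractAt w₁ a (s + 1)) (a + 2))
          + φ₂ (S.partialCumulant (S.contractAt w₂ a (s + 1)) (a + 2)) := by
      intro s hs
      have hl := length_contractAt (S := S) (w := w₀) (a := a) (t := s + 1) (by omega)
      exact ih _ (by omega) (hcon _ _ _ hr a (s + 1) (by omega)) (by omega) (by omega) rfl
    have hl := length_contractAt (S := S) (w := w₀) (a := a) (t := x + 1) (by omega)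
    have hlast := ih _ (by omega) (hcon _ _ _ hr a (x + 1) (by omega)) (j := a + 1)
      (by omega) (by omega) rfl
    have hsum := Finset.sum_congr rfl fun s (hs : s ∈ Finset.range x) =>
      hc s (Finset.mem_range.1 hs)
    rw [Finset.sum_add_distrib] at hsum
    rw [h0.partialCumulant_succ hx, h1.partialCumulant_succ (l1.trans hx),
      h2.partialCumulant_succ (l2.trans hx)]
    simp only [map_sub, map_sum]
    rw [hsum, hlast, ihj']
    abel

/-! ### Additivity -/

theorem wordMoment_add (p q : Word A) (s : Side) (x y : A) :
    S.wordMoment (p ++ (s, x + y) :: q)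
      = S.wordMoment (p ++ (s, x) :: q) + S.wordMoment (p ++ (s, y) :: q) := by
  simp [wordMoment, wordProd_add]

theorem insertAfter_add_left (s : Side) (x y : A) (b : B) :
    S.insertAfter s (x + y) b = S.insertAfter s x b + S.insertAfter s y b := by
  cases s <;> simp [insertAfter, add_mul, mul_add]

theorem insertAfter_add_right (s : Side) (x : A) (b c : B) :
    S.insertAfter s x (b + c) = S.insertAfter s x b + S.insertAfter s x c := by
  cases s <;> simp [insertAfter, L_add, R_add, add_mul, mul_add]

theorem Admissible.add {p q : Word A} {s : Side} {x y : A}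
    (hx : S.Admissible (p ++ (s, x) :: q)) (hy : S.Admissible (p ++ (s, y) :: q)) :
    S.Admissible (p ++ (s, x + y) :: q) := by
  constructor
  · intro z hz
    rw [List.mem_append, List.mem_cons] at hz
    rcases hz with hz | rfl | hz
    · exact hx.mem z (by simp [hz])
    · exact add_mem (hx.mem (s, x) (by simp)) (hy.mem (s, y) (by simp))
    · exact hx.mem z (by simp [hz])
  · have h := hx.leftFirst
    simp only [LeftFirst, List.pairwise_append, List.pairwise_cons, List.mem_cons,
      forall_eq_or_imp] at h ⊢
    exact h

/-- Moments are additive in one letter, and a contraction again gives words that differ in one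
letter. This additivity later allows coefficients to be summed as series. -/
theorem partialCumulant_add {p q : Word A} {s : Side} {x y : A}
    (hx : S.Admissible (p ++ (s, x) :: q)) (hy : S.Admissible (p ++ (s, y) :: q)) {j : ℕ}
    (hj : 1 ≤ j) (hjw : j ≤ p.length + 1 + q.length) :
    S.partialCumulant (p ++ (s, x + y) :: q) j
      = S.partialCumulant (p ++ (s, x) :: q) j + S.partialCumulant (p ++ (s, y) :: q) j := by
  refine partialCumulant_relation (AddMonoidHom.id B) (AddMonoidHom.id B) (AddMonoidHom.id B)
    (fun w₀ w₁ w₂ => S.Admissible w₁ ∧ S.Admissible w₂ ∧ ∃ p q s x y, w₀ = p ++ (s, x + y) :: q ∧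
      w₁ = p ++ (s, x) :: q ∧ w₂ = p ++ (s, y) :: q) ?_ ?_ ?_ ?_
    ⟨hx, hy, p, q, s, x, y, rfl, rfl, rfl⟩ hj (by simp; omega)
  · rintro _ _ _ ⟨h1, h2, p, q, s, x, y, rfl, rfl, rfl⟩
    exact ⟨h1.add h2, h1, h2⟩
  · rintro _ _ _ ⟨h1, h2, p, q, s, x, y, rfl, rfl, rfl⟩
    simp
  · rintro _ _ _ ⟨h1, h2, p, q, s, x, y, rfl, rfl, rfl⟩
    exact wordMoment_add p q s x y
  · rintro _ _ _ ⟨h1, h2, p, q, s, x, y, rfl, rfl, rfl⟩ a t hat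
    refine ⟨h1.contractAt a t, h2.contractAt a t, ?_⟩
    rcases lt_trichotomy a p.length with ha | rfl | ha
    · obtain ⟨p, z, p', rfl, rfl⟩ := exists_eq_append_cons ha
      simp only [List.append_assoc, List.cons_append, contractAt_append, contract]
      rcases le_or_gt t p'.length with ht | ht
      · refine ⟨p ++ S.insAfter z (S.wordMoment (p'.take t)) :: p'.drop t, q, s, x, y, ?_⟩
        simp [List.take_append_of_le_length ht, List.drop_append_of_le_length ht]
      -- The split letter is swallowed by the contraction. The moment splits instead, so `z` with
      -- its coefficient becomes the new split letter.
      · obtain ⟨m, rfl⟩ : ∃ m, t = p'.length + (m + 1) := ⟨t - p'.length - 1, by omega⟩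
        refine ⟨p, q.drop m, z.1,
          S.insertAfter z.1 z.2 (S.wordMoment (p' ++ (s, x) :: q.take m)),
          S.insertAfter z.1 z.2 (S.wordMoment (p' ++ (s, y) :: q.take m)), ?_⟩
        simp [List.take_length_add_append, List.drop_length_add_append, insAfter,
          wordMoment_add, insertAfter_add_right]
    · simp only [contractAt_append, contract]
      refine ⟨p, q.drop t, s, S.insertAfter s x (S.wordMoment (q.take t)),
        S.insertAfter s y (S.wordMoment (q.take t)), ?_⟩
      simp [insAfter, insertAfter_add_left]
    · have ha' : a - (p.length + 1) < q.length := by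
        simp at hat; omega
      obtain ⟨q', z, v, rfl, hq'⟩ := exists_eq_append_cons ha'
      refine ⟨p, q' ++ S.insAfter z (S.wordMoment (v.take t)) :: v.drop t, s, x, y, ?_⟩
      have key : ∀ u : A, S.contractAt (p ++ (s, u) :: (q' ++ z :: v)) a t
          = p ++ (s, u) :: (q' ++ S.insAfter z (S.wordMoment (v.take t)) :: v.drop t) := by
        intro u
        have e : p ++ (s, u) :: (q' ++ z :: v) = (p ++ (s, u) :: q') ++ z :: v := by simp
        have ea : a = (p ++ (s, u) :: q').length := by simp; omega
        rw [e, ea, contractAt_append, contract]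
        simp
      exact ⟨key _, key _, key _⟩

/-! ### Moving coefficients -/

/-- Insert a coefficient before a letter. -/
def insBefore (S : BBSpace B A) (z : Side × A) (b : B) : Side × A :=
  (z.1, match z.1 with
    | Side.left => S.L b * z.2
    | Side.right => z.2 * S.R b)

/-- Each coefficient is put before its letter. -/
def coefBefore (S : BBSpace B A) (T : CoefWord B A) : Word A :=
  T.map fun y => S.insBefore y.1 y.2

/-- Each coefficient is put after the preceding letter; the first one is omitted, and `h` is put
after the last letter. -/
def coefAfter (S : BBSpace B A) : CoefWord B A → B → Word A
  | [], _ => []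
  | y :: T, h => S.insAfter y.1 (headCoef T h) :: coefAfter S T h

theorem coefAfter_append (T T' : CoefWord B A) (h : B) :
    S.coefAfter (T ++ T') h = S.coefAfter T (headCoef T' h) ++ S.coefAfter T' h := by
  induction T with
  | nil => rfl
  | cons y T ih => simp [coefAfter, ih, headCoef_append]

theorem length_coefAfter (T : CoefWord B A) (h : B) : (S.coefAfter T h).length = T.length := by
  induction T with
  | nil => rfl
  | cons y T ih => simp [coefAfter, ih]

theorem map_fst_coefAfter (T : CoefWord B A) (h : B) :
    (S.coefAfter T h).map Prod.fst = T.map fun y => y.1.1 := by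
  induction T with
  | nil => rfl
  | cons y T ih => simp [coefAfter, ih, insAfter]

theorem insBefore_mem {z : Side × A} (hz : z.2 ∈ S.sideAlgebra z.1) (b : B) :
    (S.insBefore z b).2 ∈ S.sideAlgebra z.1 := by
  obtain ⟨s, Z⟩ := z
  cases s
  · exact mul_mem (S.L_mem b) hz
  · exact mul_mem hz (S.R_mem b)

theorem insBefore_insAfter (z : Side × A) (a b : B) :
    S.insBefore (S.insAfter z a) b = S.insAfter (S.insBefore z b) a := by
  obtain ⟨s, Z⟩ := z
  cases s <;> simp [insBefore, insAfter, insertAfter, mul_assoc]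

/-- Admissibility of the underlying word. -/
def CoefAdmissible (S : BBSpace B A) (T : CoefWord B A) : Prop := S.Admissible (T.map Prod.fst)

theorem CoefAdmissible.coefAfter {T : CoefWord B A} (hT : S.CoefAdmissible T) (h : B) :
    S.Admissible (S.coefAfter T h) := by
  constructor
  · have hmem := hT.mem
    clear hT
    induction T with
    | nil => simp [BBSpace.coefAfter]
    | cons y T ih =>
      intro z hz
      rcases List.mem_cons.1 hz with rfl | hz
      · exact S.insertAfter_mem (hmem y.1 (by simp)) _
      · exact ih (fun x hx => hmem x (List.mem_cons_of_mem _ hx)) z hz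
  · rw [leftFirst_iff_map, map_fst_coefAfter]
    have := hT.leftFirst
    rw [leftFirst_iff_map, List.map_map] at this
    exact this

theorem CoefAdmissible.coefBefore {T : CoefWord B A} (hT : S.CoefAdmissible T) :
    S.Admissible (S.coefBefore T) := by
  constructor
  · intro z hz
    obtain ⟨y, hy, rfl⟩ := List.mem_map.1 hz
    exact insBefore_mem (hT.mem y.1 (List.mem_map_of_mem hy)) _
  · rw [leftFirst_iff_map, BBSpace.coefBefore, List.map_map]
    have := hT.leftFirst
    rw [leftFirst_iff_map, List.map_map] at this
    exact this

theorem CoefAdmissible.tail {y : (Side × A) × B} {T : CoefWord B A}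
    (hT : S.CoefAdmissible (y :: T)) : S.CoefAdmissible T :=
  ⟨fun z hz => hT.mem z (List.mem_cons_of_mem _ hz), (List.pairwise_cons.1 hT.leftFirst).2⟩

theorem CoefAdmissible.right_of_cons {y : (Side × A) × B} {T : CoefWord B A}
    (hT : S.CoefAdmissible (y :: T)) (hy : y.1.1 = Side.right) : ∀ x ∈ T, x.1.1 = Side.right := by
  intro x hx
  rw [← Side.ne_left_iff]
  intro hl
  have := (List.pairwise_cons.1 hT.leftFirst).1 x.1 (List.mem_map_of_mem hx) hl
  rw [hy] at this
  cases this

/-- Pure reassociation: right letters are multiplied in reverse order, so "after a letter" and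
"before the next letter" name the same place in the product. -/
theorem wordProd_coefAfter_right {T : CoefWord B A} (hT : ∀ x ∈ T, x.1.1 = Side.right) (h : B) :
    wordProd (S.coefAfter T h) * S.R (headCoef T h) = S.R h * wordProd (S.coefBefore T) := by
  induction T with
  | nil => simp [coefAfter, coefBefore, wordProd, headCoef]
  | cons y T ih =>
    obtain ⟨⟨s, Z⟩, b⟩ := y
    obtain rfl : s = Side.right := hT ((s, Z), b) (by simp)
    have := ih fun x hx => hT x (List.mem_cons_of_mem _ hx)
    simp only [coefAfter, coefBefore, insAfter, insertAfter, List.map_cons, insBefore, wordProd,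
      headCoef_cons] at this ⊢
    rw [← mul_assoc, ← mul_assoc, this]
    simp [mul_assoc]

theorem wordProd_mem_right {w : Word A} (hw : ∀ z ∈ w, z.1 = Side.right ∧ z.2 ∈ S.rightAlgebra) :
    wordProd w ∈ S.rightAlgebra := by
  induction w with
  | nil => exact one_mem _
  | cons z w ih =>
    obtain ⟨s, Z⟩ := z
    obtain ⟨hs, hZ⟩ := hw (s, Z) (by simp)
    simp only at hs
    subst hs
    exact mul_mem (ih fun y hy => hw y (List.mem_cons_of_mem _ hy)) hZ

/-- `Y` accumulates the left letters already read, where shifting is reassociation. The only real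
step is the passage from left to right letters: there `L_b` commutes past the right product and
becomes `R_b` under `E`, while `R_h` commutes past `Y` and leaves `E` on the right. -/
theorem E_mul_wordProd_coefAfter {T : CoefWord B A} (hT : S.CoefAdmissible T) (h : B) {Y : A}
    (hY : Y ∈ S.leftAlgebra) :
    S.E (Y * S.L (headCoef T h) * wordProd (S.coefAfter T h))
      = S.E (Y * wordProd (S.coefBefore T)) * h := by
  induction T generalizing Y with
  | nil =>
    simp only [headCoef, coefAfter, coefBefore, wordProd, mul_one, List.map_nil]
    rw [E_mul_L, ← S.R_comm hY, E_R_mul]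
  | cons y T ih =>
    obtain ⟨⟨s, Z⟩, b⟩ := y
    have hZ : Z ∈ S.sideAlgebra s := hT.mem (s, Z) (by simp)
    cases s with
    | left =>
      have hY' : Y * S.L b * Z ∈ S.leftAlgebra := mul_mem (mul_mem hY (S.L_mem b)) hZ
      have := ih hT.tail hY'
      simp only [coefAfter, coefBefore, insAfter, insertAfter, List.map_cons, insBefore, wordProd,
        headCoef_cons] at this ⊢
      simp only [mul_assoc] at this ⊢
      exact this
    | right =>
      have hright := hT.right_of_cons rfl
      have h1 := wordProd_coefAfter_right (S := S) hright h
      have hmem : wordProd (S.coefBefore T) * Z ∈ S.rightAlgebra := by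
        refine mul_mem (wordProd_mem_right fun z hz => ?_) hZ
        obtain ⟨x, hx, rfl⟩ := List.mem_map.1 hz
        have h2 := insBefore_mem (S := S) (hT.tail.mem x.1 (List.mem_map_of_mem hx)) x.2
        rw [hright x hx] at h2
        exact ⟨hright x hx, h2⟩
      simp only [coefAfter, insAfter, insertAfter, headCoef_cons]
      rw [wordProd, ← mul_assoc (wordProd _), h1]
      have hcb : S.coefBefore (((Side.right, Z), b) :: T)
          = (Side.right, Z * S.R b) :: S.coefBefore T := rfl
      rw [hcb, wordProd]
      have e1 : Y * S.L b * (S.R h * wordProd (S.coefBefore T) * Z)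
          = S.R h * (Y * (wordProd (S.coefBefore T) * Z)) * S.L b := by
        rw [mul_assoc (S.R h), ← mul_assoc (Y * S.L b), mul_assoc Y, L_mul_R, ← mul_assoc Y,
          ← S.R_comm hY]
        simp only [mul_assoc]
        rw [← mul_assoc (wordProd _) Z, ← S.L_comm hmem]
      rw [e1, E_mul_L, mul_assoc, E_R_mul]
      simp only [mul_assoc]

theorem headCoef_mul_wordMoment {T : CoefWord B A} (hT : S.CoefAdmissible T) (h : B) :
    headCoef T h * S.wordMoment (S.coefAfter T h) = S.wordMoment (S.coefBefore T) * h := by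
  have := E_mul_wordProd_coefAfter hT h (one_mem S.leftAlgebra)
  rwa [one_mul, one_mul, E_L_mul] at this

/-- In a partial cumulant, coefficients before the letters can be moved behind the preceding
letters. -/
theorem headCoef_mul_partialCumulant {T : CoefWord B A} (hT : S.CoefAdmissible T) (h : B) {j : ℕ}
    (hj : 1 ≤ j) (hjT : j ≤ T.length) :
    headCoef T h * S.partialCumulant (S.coefAfter T h) j
      = S.partialCumulant (S.coefBefore T) j * h := by
  -- The third map is `0`, which turns the three-term relation into a two-term one.
  have key := partialCumulant_relation (S := S) (AddMonoidHom.mulLeft (headCoef T h))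
    (AddMonoidHom.mulRight h) 0
    (fun w₀ w₁ w₂ => ∃ T', S.CoefAdmissible T' ∧ headCoef T' h = headCoef T h ∧
      w₀ = S.coefAfter T' h ∧ w₁ = S.coefBefore T' ∧ w₂ = S.coefBefore T') ?_ ?_ ?_ ?_
    ⟨T, hT, rfl, rfl, rfl, rfl⟩ hj (by rwa [length_coefAfter])
  · simpa using key
  · rintro _ _ _ ⟨T', hT', -, rfl, rfl, rfl⟩
    exact ⟨hT'.coefAfter h, hT'.coefBefore, hT'.coefBefore⟩
  · rintro _ _ _ ⟨T', hT', -, rfl, rfl, rfl⟩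
    simp [length_coefAfter, coefBefore]
  · rintro _ _ _ ⟨T', hT', e, rfl, rfl, rfl⟩
    simpa [← e] using headCoef_mul_wordMoment hT' h
  · rintro _ _ _ ⟨T', hT', e, rfl, rfl, rfl⟩ a t hat
    rw [length_coefAfter] at hat
    obtain ⟨p, ⟨z, b⟩, v, rfl, rfl⟩ := exists_eq_append_cons (w := T') (a := a) (by omega)
    obtain ⟨g, q, rfl, rfl⟩ : ∃ g q, v = g ++ q ∧ g.length = t :=
      ⟨v.take t, v.drop t, by simp, by simp at hat ⊢; omega⟩
    have hg : S.CoefAdmissible g := by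
      refine ⟨fun x hx => hT'.mem x (by simp at hx ⊢; tauto), ?_⟩
      refine List.Pairwise.sublist (List.Sublist.map _ ?_) hT'.leftFirst
      exact ((List.sublist_append_left g q).cons _).trans (List.sublist_append_right p _)
    -- Contracting `g` gives on both sides the same shorter word with coefficients, in which `z`
    -- absorbs the moment of `g` with coefficients before. For the shifted word this uses
    -- `headCoef_mul_wordMoment` on `g`, with the coefficient that follows `g` as its closing one.
    have hb : S.contractAt (S.coefBefore (p ++ (z, b) :: (g ++ q))) p.length g.length
        = S.coefBefore (p ++ (S.insAfter z (S.wordMoment (S.coefBefore g)), b) :: q) := by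
      have e1 : S.coefBefore (p ++ (z, b) :: (g ++ q))
          = S.coefBefore p ++ S.insBefore z b :: (S.coefBefore g ++ S.coefBefore q) := by
        simp [coefBefore]
      have e2 : p.length = (S.coefBefore p).length := by simp [coefBefore]
      have e3 : g.length = (S.coefBefore g).length := by simp [coefBefore]
      rw [e1, e2, e3, contractAt_append, contract, List.take_left, List.drop_left,
        ← insBefore_insAfter]
      simp [coefBefore]
    have ha : S.contractAt (S.coefAfter (p ++ (z, b) :: (g ++ q)) h) p.length g.length
        = S.coefAfter (p ++ (S.insAfter z (S.wordMoment (S.coefBefore g)), b) :: q) h := by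
      have e1 : S.coefAfter (p ++ (z, b) :: (g ++ q)) h
          = S.coefAfter p b ++ S.insAfter z (headCoef g (headCoef q h)) ::
            (S.coefAfter g (headCoef q h) ++ S.coefAfter q h) := by
        simp [coefAfter_append, coefAfter, headCoef_append, headCoef_cons]
      have e2 : p.length = (S.coefAfter p b).length := by simp [length_coefAfter]
      have e3 : g.length = (S.coefAfter g (headCoef q h)).length := by simp [length_coefAfter]
      rw [e1, e2, e3, contractAt_append, contract, List.take_left, List.drop_left,
        insAfter_insAfter, headCoef_mul_wordMoment hg]
      simp [coefAfter_append, coefAfter, headCoef_cons, insAfter_insAfter]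
    refine ⟨p ++ (S.insAfter z (S.wordMoment (S.coefBefore g)), b) :: q, ?_, ?_, ha, hb, hb⟩
    · constructor
      · intro x hx
        simp only [List.map_append, List.map_cons, List.mem_append, List.mem_cons] at hx
        rcases hx with hx | rfl | hx
        · exact hT'.mem x (by simp only [List.map_append, List.mem_append]; exact Or.inl hx)
        · exact S.insertAfter_mem (hT'.mem z (by simp)) _
        · refine hT'.mem x ?_
          simp only [List.map_append, List.map_cons, List.mem_append, List.mem_cons]
          tauto
      · have h1 := hT'.leftFirst
        rw [leftFirst_iff_map, List.map_map] at h1 ⊢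
        simp only [List.map_append, List.map_cons] at h1 ⊢
        refine h1.sublist (List.Sublist.append_left ?_ _)
        exact List.Sublist.cons_cons _ (List.sublist_append_right _ _)
    · rw [← e, headCoef_append, headCoef_append]
      rfl

end Induction

end BBSpace

end BiFree

/-! ### Exponential bounds for partial cumulants -/

namespace BiFree

namespace BBSpace

section Weight

variable {A : Type*} [NormedRing A]

/-- The product of the norms of the letters, each multiplied by `Γ`. -/
def weight (Γ : ℝ) (w : Word A) : ℝ := (w.map fun z => Γ * ‖z.2‖).prod

theorem weight_nil (Γ : ℝ) : weight Γ ([] : Word A) = 1 := rfl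

theorem weight_cons (Γ : ℝ) (z : Side × A) (w : Word A) :
    weight Γ (z :: w) = Γ * ‖z.2‖ * weight Γ w := by
  simp [weight]

theorem weight_append (Γ : ℝ) (w w' : Word A) :
    weight Γ (w ++ w') = weight Γ w * weight Γ w' := by
  simp [weight]

theorem weight_replicate (Γ : ℝ) (n : ℕ) (z : Side × A) :
    weight Γ (List.replicate n z) = (Γ * ‖z.2‖) ^ n := by
  simp [weight]

theorem weight_nonneg {Γ : ℝ} (hΓ : 0 ≤ Γ) (w : Word A) : 0 ≤ weight Γ w := by
  induction w with
  | nil => simp [weight_nil]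
  | cons z w ih => rw [weight_cons]; positivity

theorem weight_eq_pow_mul (Γ : ℝ) (w : Word A) : weight Γ w = Γ ^ w.length * weight 1 w := by
  induction w with
  | nil => simp [weight_nil]
  | cons z w ih => rw [weight_cons, weight_cons, ih, List.length_cons]; ring

/-- The extra factor is needed only for the empty word, since `‖1‖ = 1` is not assumed. -/
theorem norm_wordProd_le (w : Word A) : ‖(wordProd w : A)‖ ≤ (1 + ‖(1 : A)‖) * weight 1 w := by
  have key : ∀ w : Word A, w ≠ [] → ‖(wordProd w : A)‖ ≤ weight 1 w := by
    intro w hw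
    induction w with
    | nil => exact absurd rfl hw
    | cons z w ih =>
      obtain ⟨s, Z⟩ := z
      rw [weight_cons, one_mul]
      rcases eq_or_ne w [] with rfl | hne
      · cases s <;> simp [wordProd, weight_nil]
      · cases s
        · exact (norm_mul_le _ _).trans (mul_le_mul_of_nonneg_left (ih hne) (norm_nonneg _))
        · rw [mul_comm]
          exact (norm_mul_le _ _).trans (mul_le_mul_of_nonneg_right (ih hne) (norm_nonneg _))
  rcases eq_or_ne w [] with rfl | hne
  · simp [wordProd, weight_nil]
  · have h0 := weight_nonneg zero_le_one w
    have := key w hne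
    nlinarith [norm_nonneg (1 : A)]

end Weight

section Bound

variable {B A : Type*} [NormedRing B] [NormedAlgebra ℂ B] [NormedRing A] [NormedAlgebra ℂ A]
  {S : BBSpace B A}

theorem IsBanach.exists_bound (hS : S.IsBanach) : ∃ K : ℝ, 1 ≤ K ∧ (∀ Z, ‖S.E Z‖ ≤ K * ‖Z‖) ∧
    (∀ b, ‖S.L b‖ ≤ K * ‖b‖) ∧ ∀ b, ‖S.R b‖ ≤ K * ‖b‖ := by
  obtain ⟨K₁, h₁⟩ := hS.E_bounded
  obtain ⟨K₂, h₂⟩ := hS.L_bounded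
  obtain ⟨K₃, h₃⟩ := hS.R_bounded
  refine ⟨max (max 1 K₁) (max K₂ K₃), by simp, fun Z => (h₁ Z).trans ?_, fun b => (h₂ b).trans ?_,
    fun b => (h₃ b).trans ?_⟩ <;> refine mul_le_mul_of_nonneg_right ?_ (norm_nonneg _) <;> simp

theorem norm_insertAfter_le {K : ℝ} (hL : ∀ b, ‖S.L b‖ ≤ K * ‖b‖) (hR : ∀ b, ‖S.R b‖ ≤ K * ‖b‖)
    (s : Side) (Z : A) (b : B) : ‖S.insertAfter s Z b‖ ≤ K * ‖b‖ * ‖Z‖ := by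
  cases s
  · rw [mul_comm]
    exact (norm_mul_le _ _).trans (mul_le_mul_of_nonneg_left (hL b) (norm_nonneg _))
  · exact (norm_mul_le _ _).trans (mul_le_mul_of_nonneg_right (hR b) (norm_nonneg _))

/-- Induction along the backward recursion; each contraction costs a factor `D` in the weight. With
`α = 6D + 2` and `β = 2D + 1`, the geometric sum over gap lengths satisfies `D ∑ β^s = (β^x - 1)/2`,
which uses up half of `α β^x`; the two remaining terms fit into the other half because `β + D =
α/2`. -/
theorem norm_partialCumulant_le_pow {D : ℝ} (hD : 1 ≤ D)
    (hmom : ∀ w, ‖S.wordMoment w‖ ≤ D * weight 1 w)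
    (hins : ∀ z g, ‖(S.insAfter z (S.wordMoment g)).2‖ ≤ D * ‖z.2‖ * weight 1 g)
    {w : Word A} (hw : S.Admissible w) {j : ℕ} (hj : 1 ≤ j) (hjw : j ≤ w.length) :
    ‖S.partialCumulant w j‖ ≤ (6 * D + 2) ^ j * (2 * D + 1) ^ (w.length - j) * weight 1 w := by
  induction hN : w.length using Nat.strong_induction_on generalizing w j with
  | _ N ih =>
  subst hN
  have hcon : ∀ a t, a + 1 + t ≤ w.length →
      weight 1 (S.contractAt w a t) ≤ D * weight 1 w := by
    intro a t hat
    obtain ⟨p, z, v, rfl, rfl⟩ := exists_eq_append_cons (w := w) (a := a) (by omega)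
    rw [contractAt_append, contract]
    have hp := weight_nonneg zero_le_one p
    have hd := weight_nonneg zero_le_one (v.drop t)
    have hv : weight 1 v = weight 1 (v.take t) * weight 1 (v.drop t) := by
      rw [← weight_append, List.take_append_drop]
    rw [weight_append, weight_append, weight_cons, weight_cons, hv, one_mul, one_mul]
    calc weight 1 p * (‖(S.insAfter z (S.wordMoment (v.take t))).2‖ * weight 1 (v.drop t))
        ≤ weight 1 p * ((D * ‖z.2‖ * weight 1 (v.take t)) * weight 1 (v.drop t)) := by
          gcongr
          exact hins z _
      _ = _ := by ring
  have hW := weight_nonneg zero_le_one w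
  induction j, hj using Nat.le_induction with
  | base =>
    rw [partialCumulant_one hw.leftFirst (by rintro rfl; simp at hjw)]
    refine (hmom w).trans (mul_le_mul_of_nonneg_right ?_ hW)
    have h1 : (1 : ℝ) ≤ (2 * D + 1) ^ (w.length - 1) := one_le_pow₀ (by linarith)
    nlinarith
  | succ j hj ihj =>
    obtain ⟨a, rfl⟩ : ∃ a, j = a + 1 := ⟨j - 1, by omega⟩
    obtain ⟨x, hx⟩ : ∃ x, w.length = a + 2 + x := ⟨w.length - (a + 2), by omega⟩
    have ihj' := ihj (by omega)
    rw [hw.partialCumulant_succ hx]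
    set α := 6 * D + 2 with hα
    set β := 2 * D + 1 with hβ
    have hα0 : 0 ≤ α := by linarith
    have hβ0 : 0 ≤ β := by linarith
    have e1 : w.length - (a + 1) = x + 1 := by omega
    have e2 : w.length - (a + 1 + 1) = x := by omega
    rw [e1] at ihj'
    rw [e2]
    have hterm : ∀ s ∈ Finset.range x,
        ‖S.partialCumulant (S.contractAt w a (s + 1)) (a + 2)‖
          ≤ α ^ (a + 2) * (D * weight 1 w) * β ^ (x - 1 - s) := by
      intro s hs
      have hs := Finset.mem_range.1 hs
      have hl := length_contractAt (S := S) (w := w) (a := a) (t := s + 1) (by omega)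
      have := ih _ (by omega) (hw.contractAt a (s + 1)) (j := a + 2) (by omega) (by omega) rfl
      have e3 : (S.contractAt w a (s + 1)).length - (a + 2) = x - 1 - s := by omega
      rw [e3] at this
      refine this.trans ?_
      rw [mul_right_comm]
      gcongr
      exact hcon a (s + 1) (by omega)
    have hsum : ‖∑ s ∈ Finset.range x, S.partialCumulant (S.contractAt w a (s + 1)) (a + 2)‖
        ≤ α ^ (a + 2) * (D * weight 1 w) * ∑ s ∈ Finset.range x, β ^ s := by
      refine (norm_sum_le_of_le _ hterm).trans (le_of_eq ?_)
      rw [← Finset.mul_sum, Finset.sum_range_reflect (fun s => β ^ s)]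
    have hgeom : 2 * D * ∑ s ∈ Finset.range x, β ^ s = β ^ x - 1 := by
      have := mul_geom_sum β x
      rw [← this, hβ]; ring
    have hlast : ‖S.partialCumulant (S.contractAt w a (x + 1)) (a + 1)‖
        ≤ α ^ (a + 1) * (D * weight 1 w) := by
      have hl := length_contractAt (S := S) (w := w) (a := a) (t := x + 1) (by omega)
      have := ih _ (by omega) (hw.contractAt a (x + 1)) (j := a + 1) (by omega) (by omega) rfl
      have e3 : (S.contractAt w a (x + 1)).length - (a + 1) = 0 := by omega
      rw [e3, pow_zero, mul_one] at this
      refine this.trans ?_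
      gcongr
      exact hcon a (x + 1) (by omega)
    have hβx : 1 ≤ β ^ x := one_le_pow₀ (by linarith)
    have hαa : 0 ≤ α ^ (a + 1) * weight 1 w := by positivity
    calc _ ≤ ‖S.partialCumulant w (a + 1)‖
          + ‖∑ s ∈ Finset.range x, S.partialCumulant (S.contractAt w a (s + 1)) (a + 2)‖
          + ‖S.partialCumulant (S.contractAt w a (x + 1)) (a + 1)‖ :=
          (norm_sub_le _ _).trans (add_le_add_left (norm_sub_le _ _) _)
      _ ≤ α ^ (a + 1) * β ^ (x + 1) * weight 1 w
          + α ^ (a + 2) * (D * weight 1 w) * ∑ s ∈ Finset.range x, β ^ s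
          + α ^ (a + 1) * (D * weight 1 w) := by gcongr
      _ = (α ^ (a + 1) * weight 1 w) * (β ^ x * β + α * (β ^ x - 1) / 2 + D) := by
          rw [← hgeom]; ring
      _ ≤ (α ^ (a + 1) * weight 1 w) * (α * β ^ x) := by
          refine mul_le_mul_of_nonneg_left ?_ hαa
          have h1 : D ≤ D * β ^ x := le_mul_of_one_le_right (by linarith) hβx
          have h2 : β ^ x * β + D * β ^ x = α * β ^ x / 2 := by rw [hα, hβ]; ring
          linarith
      _ = _ := by ring

/-- Partial cumulants are exponentially bounded. -/
theorem IsBanach.exists_norm_partialCumulant_le (hS : S.IsBanach) : ∃ Γ : ℝ, 1 ≤ Γ ∧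
    ∀ w, S.Admissible w → ∀ j, 1 ≤ j → j ≤ w.length → ‖S.partialCumulant w j‖ ≤ weight Γ w := by
  obtain ⟨K, hK, hE, hL, hR⟩ := hS.exists_bound
  -- One factor `K` bounds `E`, the other bounds `L` or `R` when the moment is inserted as a
  -- coefficient.
  set D := K * (K * (1 + ‖(1 : A)‖)) with hDdef
  have h1 : 1 ≤ 1 + ‖(1 : A)‖ := by linarith [norm_nonneg (1 : A)]
  have h2 : 1 ≤ K * (1 + ‖(1 : A)‖) := one_le_mul_of_one_le_of_one_le hK h1
  have hD : 1 ≤ D := one_le_mul_of_one_le_of_one_le hK h2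
  have hmom' : ∀ w, ‖S.wordMoment w‖ ≤ K * (1 + ‖(1 : A)‖) * weight 1 w := by
    intro w
    refine (hE _).trans ?_
    rw [mul_assoc]
    exact mul_le_mul_of_nonneg_left (norm_wordProd_le w) (by linarith)
  have hmom : ∀ w, ‖S.wordMoment w‖ ≤ D * weight 1 w := by
    intro w
    refine (hmom' w).trans (mul_le_mul_of_nonneg_right ?_ (weight_nonneg zero_le_one w))
    exact le_mul_of_one_le_left (by linarith) hK
  have hins : ∀ z g, ‖(S.insAfter z (S.wordMoment g)).2‖ ≤ D * ‖z.2‖ * weight 1 g := by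
    intro z g
    refine (norm_insertAfter_le hL hR z.1 z.2 _).trans ?_
    calc K * ‖S.wordMoment g‖ * ‖z.2‖ ≤ K * (K * (1 + ‖(1 : A)‖) * weight 1 g) * ‖z.2‖ := by
          gcongr
          exact hmom' g
      _ = _ := by rw [hDdef]; ring
  refine ⟨6 * D + 2, by linarith, fun w hw j hj hjw => ?_⟩
  refine (norm_partialCumulant_le_pow hD hmom hins hw hj hjw).trans ?_
  rw [weight_eq_pow_mul (6 * D + 2)]
  refine mul_le_mul_of_nonneg_right ?_ (weight_nonneg zero_le_one w)
  calc (6 * D + 2) ^ j * (2 * D + 1) ^ (w.length - j)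
      ≤ (6 * D + 2) ^ j * (6 * D + 2) ^ (w.length - j) := by
        gcongr <;> norm_num
    _ = _ := by rw [← pow_add]; congr 1; omega

end Bound

end BBSpace

end BiFree

namespace BiFree

/-! ### Rearranging sums -/

section Sums

variable {E : Type*} [NormedAddCommGroup E]

/-- The data identify `P` with the disjoint union of the finite sets `I j`: `π` gives the class, `σ`
the place in it, and `ι` is the inverse. -/
theorem hasSum_fiberwise {P J : Type*} {f : P → E} {a : E} (h : HasSum f a) (π : P → J)
    (I : J → Finset ℕ) (ι : J → ℕ → P) (σ : P → ℕ) (h1 : ∀ j, ∀ s ∈ I j, π (ι j s) = j)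
    (h2 : ∀ j, ∀ s ∈ I j, σ (ι j s) = s) (h3 : ∀ p, σ p ∈ I (π p)) (h4 : ∀ p, ι (π p) (σ p) = p) :
    HasSum (fun j => ∑ s ∈ I j, f (ι j s)) a := by
  let e : (Σ j, I j) ≃ P :=
    { toFun := fun x => ι x.1 x.2
      invFun := fun p => ⟨π p, σ p, h3 p⟩
      left_inv := by
        rintro ⟨j, s, hs⟩
        have key : ∀ p, π p = j → σ p = s → (⟨π p, σ p, h3 p⟩ : Σ j, I j) = ⟨j, s, hs⟩ := by
          rintro p rfl rfl
          rfl
        exact key _ (h1 j s hs) (h2 j s hs)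
      right_inv := h4 }
  refine (e.hasSum_iff.2 h).sigma fun j => ?_
  have := hasSum_fintype fun s : I j => f (ι j s)
  rwa [Finset.sum_coe_sort (I j) (fun s => f (ι j s))] at this

/-- A pair consists of the gap length and the number of letters after the next block letter. That
letter itself accounts for the `+ 1` in the total. The two variants below regroup likewise for gaps
before a left and before a right letter. -/
theorem hasSum_sum_range {f : ℕ × ℕ → E} {a : E} (h : HasSum f a) :
    HasSum (fun m => ∑ s ∈ Finset.range m, f (s, m - 1 - s)) a :=
  hasSum_fiberwise h (fun p => p.1 + p.2 + 1) Finset.range (fun m s => (s, m - 1 - s)) Prod.fst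
    (fun m s hs => by have := Finset.mem_range.1 hs; simp only; omega) (fun _ _ _ => rfl)
    (fun p => Finset.mem_range.2 (by omega)) (fun p => by ext <;> simp)

theorem hasSum_sum_range_fst {f : ℕ × (ℕ × ℕ) → E} {a : E} (h : HasSum f a) :
    HasSum (fun q : ℕ × ℕ => ∑ s ∈ Finset.range q.1, f (s, (q.1 - 1 - s, q.2))) a :=
  hasSum_fiberwise h (fun p => (p.1 + p.2.1 + 1, p.2.2)) (fun q => Finset.range q.1)
    (fun q s => (s, (q.1 - 1 - s, q.2))) Prod.fst
    (fun m s hs => by have := Finset.mem_range.1 hs; ext <;> simp only; omega) (fun _ _ _ => rfl)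
    (fun p => Finset.mem_range.2 (by simp only; omega)) (fun p => by ext <;> simp)

theorem hasSum_sum_range_snd {f : (ℕ × ℕ) × ℕ → E} {a : E} (h : HasSum f a) :
    HasSum (fun q : ℕ × ℕ => ∑ s ∈ Finset.range q.2, f ((q.1, s), q.2 - 1 - s)) a :=
  hasSum_fiberwise h (fun p => (p.1.1, p.1.2 + p.2 + 1)) (fun q => Finset.range q.2)
    (fun q s => ((q.1, s), q.2 - 1 - s)) (fun p => p.1.2)
    (fun m s hs => by have := Finset.mem_range.1 hs; ext <;> simp only; omega) (fun _ _ _ => rfl)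
    (fun p => Finset.mem_range.2 (by simp only; omega)) (fun p => by ext <;> simp)

theorem hasSum_map_of_bound {E F ι : Type*} [NormedAddCommGroup E] [NormedAddCommGroup F]
    (φ : E →+ F) {C : ℝ} (hφ : ∀ b, ‖φ b‖ ≤ C * ‖b‖) {e : ι → E} {a : E} (he : HasSum e a) :
    HasSum (fun s => φ (e s)) (φ a) :=
  he.map φ (AddMonoidHomClass.continuous_of_bound φ C hφ)

/-- Absolute convergence of the double series permits summing over `ι` first. This replaces the gap
moments by their whole series. -/
theorem hasSum_prod_apply {ι κ : Type*} [CompleteSpace E] (φ : κ → E →+ E) {C : κ → ℝ}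
    (hC : Summable C) (hφ : ∀ k b, ‖φ k b‖ ≤ C k * ‖b‖) {e : ι → E} {a : E} (he : HasSum e a)
    (hne : Summable fun s => ‖e s‖) :
    HasSum (fun p : ι × κ => φ p.2 (e p.1)) (∑' k, φ k a) := by
  have hC0 : ∀ k, 0 ≤ |C k| := fun k => abs_nonneg _
  have hsum : Summable fun p : ι × κ => φ p.2 (e p.1) := by
    refine Summable.of_norm_bounded (g := fun p : ι × κ => ‖e p.1‖ * |C p.2|) ?_ fun p => ?_
    · exact hne.mul_of_nonneg hC.abs (fun _ => norm_nonneg _) hC0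
    · rw [mul_comm]
      exact (hφ _ _).trans (mul_le_mul_of_nonneg_right (le_abs_self _) (norm_nonneg _))
  have h2 := hsum.hasSum
  have h3 : HasSum (fun p : κ × ι => φ p.1 (e p.2)) (∑' p : ι × κ, φ p.2 (e p.1)) :=
    (Equiv.prodComm κ ι).hasSum_iff.2 h2
  have h4 := h3.prod_fiberwise fun k => hasSum_map_of_bound (φ k) (hφ k) he
  rw [h4.tsum_eq]
  exact h2

theorem hasSum_of_telescoping [CompleteSpace E] {Θ κ : ℕ → E} {C : ℝ}
    (h : ∀ q, Θ q = κ q + Θ (q + 1)) (hΘ : ∀ q, ‖Θ q‖ ≤ C * (1 / 2) ^ q) : HasSum κ (Θ 0) := by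
  have hgeom : Summable fun q : ℕ => C * (1 / 2 : ℝ) ^ q :=
    (summable_geometric_of_lt_one (by norm_num) (by norm_num)).mul_left C
  have hs : Summable Θ := Summable.of_norm_bounded hgeom hΘ
  have hκ : κ = fun q => Θ q - Θ (q + 1) := by
    funext q; rw [h q]; abel
  have h0 : Filter.Tendsto Θ Filter.atTop (nhds 0) := hs.tendsto_atTop_zero
  have hsκ : Summable κ := by
    rw [hκ]
    exact hs.sub ((summable_nat_add_iff 1).2 hs)
  rw [hsκ.hasSum_iff_tendsto_nat, hκ]
  simp only [Finset.sum_range_sub']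
  simpa using h0.const_sub (Θ 0)

end Sums

/-! ### Summing the recursion over words in a single letter -/

namespace BBSpace

section Series

variable {B A : Type*} [NormedRing B] [NormedAlgebra ℂ B] [NormedRing A] [NormedAlgebra ℂ A]
  {S : BBSpace B A}

/-- The partial cumulant as an additive function of a coefficient. -/
noncomputable def coefHom (S : BBSpace B A) (p : Word A) (z : Side × A) (q : Word A) (j : ℕ)
    (hadm : ∀ b, S.Admissible (p ++ S.insAfter z b :: q))
    (hj : 1 ≤ j) (hjw : j ≤ p.length + 1 + q.length) : B →+ B :=
  AddMonoidHom.mk' (fun b => S.partialCumulant (p ++ S.insAfter z b :: q) j) fun b c => by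
    have := partialCumulant_add (hadm b) (hadm c) hj hjw
    simpa only [insAfter, insertAfter_add_right] using this

/-- `Γ` bounds the partial cumulants and `K` the coefficient maps. -/
structure IsBound (S : BBSpace B A) (Γ K : ℝ) : Prop where
  one_le : 1 ≤ Γ
  partialCumulant_le : ∀ w, S.Admissible w → ∀ j, 1 ≤ j → j ≤ w.length →
    ‖S.partialCumulant w j‖ ≤ weight Γ w
  insAfter_le : ∀ z b, ‖(S.insAfter z b).2‖ ≤ K * ‖b‖ * ‖z.2‖

theorem IsBound.norm_coefHom_le {Γ K : ℝ} (hb : S.IsBound Γ K) {p : Word A} {z : Side × A}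
    {q : Word A} {j : ℕ} (hadm : ∀ b, S.Admissible (p ++ S.insAfter z b :: q))
    (hj : 1 ≤ j) (hjw : j ≤ p.length + 1 + q.length) (b : B) :
    ‖S.coefHom p z q j hadm hj hjw b‖
      ≤ weight Γ p * (Γ * (K * ‖z.2‖)) * weight Γ q * ‖b‖ := by
  have hΓ : 0 ≤ Γ := zero_le_one.trans hb.one_le
  refine (hb.partialCumulant_le _ (hadm b) j hj (by simp; omega)).trans ?_
  rw [weight_append, weight_cons]
  have hp := weight_nonneg hΓ p
  have hq := weight_nonneg hΓ q
  calc weight Γ p * (Γ * ‖(S.insAfter z b).2‖ * weight Γ q)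
      ≤ weight Γ p * (Γ * (K * ‖b‖ * ‖z.2‖) * weight Γ q) := by
        gcongr
        exact hb.insAfter_le z b
    _ = _ := by ring

theorem summable_geometric_bound {r : ℝ} (C : ℝ) (h0 : 0 ≤ r) (hr : r ≤ 1 / 2) :
    Summable fun m : ℕ => C * r ^ m :=
  (summable_geometric_of_lt_one h0 (by linarith)).mul_left C

theorem summable_geometric_bound_prod {r t : ℝ} (C : ℝ) (hr0 : 0 ≤ r) (hr : r ≤ 1 / 2)
    (ht0 : 0 ≤ t) (ht : t ≤ 1 / 2) : Summable fun q : ℕ × ℕ => C * (r ^ q.1 * t ^ q.2) := by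
  refine Summable.mul_left C ?_
  exact (summable_geometric_of_lt_one hr0 (by linarith)).mul_of_nonneg
    (summable_geometric_of_lt_one ht0 (by linarith)) (fun _ => by positivity)
    (fun _ => by positivity)

/-- The cumulants of the words `u`, followed by letters with the moment series as coefficient,
sum up to the partial cumulants of the words `u`, followed by plain letters. -/
theorem IsBound.hasSum_cumulant_replicate [CompleteSpace B] {Γ K : ℝ} (hb : S.IsBound Γ K)
    {u : Word A} {z : Side × A}
    (hadm : ∀ l : Word A, (∀ y ∈ l, y.1 = z.1 ∧ y.2 ∈ S.sideAlgebra z.1) → S.Admissible (u ++ l))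
    (hz : z.2 ∈ S.sideAlgebra z.1) {μ : B}
    (hμ : HasSum (fun s => S.wordMoment (List.replicate s z)) μ)
    (hμn : Summable fun s => ‖S.wordMoment (List.replicate s z)‖)
    (hΓz : Γ * ‖z.2‖ ≤ 1 / 2) (hΓμ : Γ * ‖(S.insAfter z μ).2‖ ≤ 1 / 2) :
    HasSum (fun q => S.partialCumulant (u ++ List.replicate (q + 1) (S.insAfter z μ))
        (u.length + q + 1))
      (∑' m, S.partialCumulant (u ++ z :: List.replicate m z) (u.length + 1)) := by
  have hΓ : 0 ≤ Γ := zero_le_one.trans hb.one_le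
  have hΓz0 : 0 ≤ Γ * ‖z.2‖ := by positivity
  set z' := S.insAfter z μ with hz'
  have hz'm : z'.2 ∈ S.sideAlgebra z.1 := S.insertAfter_mem hz μ
  have hins : ∀ b, (S.insAfter z b).2 ∈ S.sideAlgebra z.1 := fun b => S.insertAfter_mem hz b
  let W : ℕ → Word A := fun q => u ++ List.replicate q z'
  have hWl : ∀ q, (W q).length = u.length + q := fun q => by simp [W]
  have hWadm : ∀ q (l : Word A), (∀ y ∈ l, y.1 = z.1 ∧ y.2 ∈ S.sideAlgebra z.1) →
      S.Admissible (W q ++ l) := by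
    intro q l hl
    have := hadm (List.replicate q z' ++ l) (by
      intro y hy
      rcases List.mem_append.1 hy with hy | hy
      · rw [List.eq_of_mem_replicate hy]; exact ⟨rfl, hz'm⟩
      · exact hl y hy)
    simpa [W] using this
  -- `q` letters of the block already carry `μ`; the sum runs over the number of plain letters after
  -- the current one.
  let Θ : ℕ → B := fun q =>
    ∑' m, S.partialCumulant (W q ++ z :: List.replicate m z) (u.length + q + 1)
  have hbound : ∀ q m, ‖S.partialCumulant (W q ++ z :: List.replicate m z) (u.length + q + 1)‖
      ≤ weight Γ u * (1 / 2) ^ q * (1 / 2) * (1 / 2) ^ m := by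
    intro q m
    refine (hb.partialCumulant_le _ (hWadm q _ ?_) _ (by omega) (by simp [hWl])).trans ?_
    · intro y hy
      rw [← List.replicate_succ] at hy
      rw [List.eq_of_mem_replicate hy]
      exact ⟨rfl, hz⟩
    · rw [weight_append, weight_append, weight_cons, weight_replicate, weight_replicate,
        ← mul_assoc]
      have := weight_nonneg hΓ u
      gcongr
  have hsummable : ∀ q, Summable fun m =>
      S.partialCumulant (W q ++ z :: List.replicate m z) (u.length + q + 1) := fun q =>
    Summable.of_norm_bounded (summable_geometric_bound _ (by norm_num) le_rfl) (hbound q)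
  have hΘ : ∀ q, ‖Θ q‖ ≤ weight Γ u * (1 / 2) ^ q := by
    intro q
    refine (tsum_of_norm_bounded ((hasSum_geometric_of_lt_one (r := (1 / 2 : ℝ)) (by norm_num)
      (by norm_num)).mul_left (weight Γ u * (1 / 2) ^ q * (1 / 2))) (hbound q)).trans (le_of_eq ?_)
    ring
  -- Expand by the gap after the current letter and sum all gap lengths to `μ`. Either the block
  -- ends there, leaving a full cumulant, or it continues, leaving the next `Θ`.
  have hstep : ∀ q, Θ q = S.partialCumulant (W (q + 1)) (u.length + q + 1) + Θ (q + 1) := by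
    intro q
    have hadm1 : ∀ b, S.Admissible (W q ++ S.insAfter z b :: []) := fun b =>
      hWadm q _ (by
        intro y hy
        rw [List.mem_singleton.1 hy]
        exact ⟨rfl, hins b⟩)
    have hadm2 : ∀ k b, S.Admissible (W q ++ S.insAfter z b :: z :: List.replicate k z) :=
      fun k b => hWadm q _ (by
        intro y hy
        rcases List.mem_cons.1 hy with rfl | hy
        · exact ⟨rfl, hins b⟩
        · rw [← List.replicate_succ] at hy
          rw [List.eq_of_mem_replicate hy]
          exact ⟨rfl, hz⟩)
    have hW1 : W (q + 1) = W q ++ [z'] := by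
      simp [W, List.replicate_succ']
    have hlast := hasSum_map_of_bound
      (S.coefHom (W q) z [] (u.length + q + 1) hadm1 (by omega) (by simp [hWl]))
      (hb.norm_coefHom_le hadm1 _ _) hμ
    have hgap := hasSum_prod_apply
      (fun k => S.coefHom (W q) z (z :: List.replicate k z) (u.length + q + 2) (hadm2 k)
        (by omega) (by simp [hWl]; omega))
      (C := fun k => weight Γ (W q) * (Γ * (K * ‖z.2‖)) * (Γ * ‖z.2‖) * (Γ * ‖z.2‖) ^ k)
      (summable_geometric_bound _ hΓz0 hΓz)
      (fun k b => by
        have := hb.norm_coefHom_le (hadm2 k) (j := u.length + q + 2) (by omega)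
          (by simp [hWl]; omega) b
        rw [weight_cons, weight_replicate] at this
        refine this.trans (le_of_eq ?_)
        ring) hμ hμn
    have hgap' := hasSum_sum_range hgap
    have hsum := hgap'.add hlast
    have heq : (fun m => S.partialCumulant (W q ++ z :: List.replicate m z) (u.length + q + 1))
        = fun m => (∑ s ∈ Finset.range m, S.coefHom (W q) z
            (z :: List.replicate (m - 1 - s) z) (u.length + q + 2) (hadm2 (m - 1 - s))
            (by omega) (by simp [hWl]; omega) (S.wordMoment (List.replicate s z)))
          + S.coefHom (W q) z [] (u.length + q + 1) hadm1 (by omega) (by simp [hWl])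
            (S.wordMoment (List.replicate m z)) := by
      funext m
      have hA : S.Admissible (W q ++ z :: List.replicate m z) := hWadm q _ (by
        intro y hy
        rw [← List.replicate_succ] at hy
        rw [List.eq_of_mem_replicate hy]
        exact ⟨rfl, hz⟩)
      have := hA.partialCumulant_eq
      rw [hWl, List.length_replicate] at this
      rw [this]
      congr 1
      refine Finset.sum_congr rfl fun s hs => ?_
      have hs := Finset.mem_range.1 hs
      simp only [coefHom, AddMonoidHom.mk'_apply, contract]
      rw [List.take_replicate, List.drop_replicate, Nat.min_eq_left hs.le]
      have : m - s = m - 1 - s + 1 := by omega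
      rw [this, List.replicate_succ]
    simp only [Θ]
    rw [heq, hsum.tsum_eq, add_comm, hW1]
    congr 1
    refine tsum_congr fun k => ?_
    simp only [coefHom, AddMonoidHom.mk'_apply, ← hz']
    rw [List.append_assoc (W q) [z']]
    rfl
  have hΘ0 : Θ 0 = ∑' m, S.partialCumulant (u ++ z :: List.replicate m z) (u.length + 1) := by
    simp [Θ, W]
  rw [← hΘ0]
  exact hasSum_of_telescoping hstep hΘ

end Series

end BBSpace

end BiFree

/-! ### Summing the recursion over the left letters of mixed words -/

namespace BiFree

namespace BBSpace

section WordProd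

variable {A : Type*} [Ring A]

theorem wordProd_append_left (l : List A) (w : Word A) :
    wordProd (l.map (fun Z => (Side.left, Z)) ++ w) = l.prod * wordProd w := by
  induction l with
  | nil => simp
  | cons Z l ih => simp [wordProd, ih, mul_assoc]

theorem wordProd_replicate_left (n : ℕ) (X : A) (w : Word A) :
    wordProd (List.replicate n (Side.left, X) ++ w) = X ^ n * wordProd w := by
  have := wordProd_append_left (List.replicate n X) w
  simpa using this

theorem wordProd_replicate_right (n : ℕ) (Y : A) :
    wordProd (List.replicate n (Side.right, Y)) = Y ^ n := by
  induction n with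
  | zero => simp [wordProd]
  | succ n ih => rw [List.replicate_succ, wordProd, ih, pow_succ]

end WordProd

section Algebraic

variable {B A : Type*} [Ring B] [Algebra ℂ B] [Ring A] [Algebra ℂ A] {S : BBSpace B A}

theorem admissible_append {l l' : Word A} (hl : ∀ z ∈ l, z.1 = Side.left ∧ z.2 ∈ S.leftAlgebra)
    (hl' : ∀ z ∈ l', z.1 = Side.right ∧ z.2 ∈ S.rightAlgebra) : S.Admissible (l ++ l') := by
  constructor
  · intro z hz
    rcases List.mem_append.1 hz with h | h
    · rw [(hl z h).1]; exact (hl z h).2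
    · rw [(hl' z h).1]; exact (hl' z h).2
  · refine List.pairwise_append.2 ⟨?_, ?_, fun y hy z _ _ => (hl y hy).1⟩
    · exact List.pairwise_of_forall_mem_list fun y hy z _ _ => (hl y hy).1
    · refine List.pairwise_of_forall_mem_list fun y _ z hz hleft => ?_
      rw [(hl' z hz).1] at hleft
      cases hleft

theorem wordMoment_replicate_left (n : ℕ) (X : A) :
    S.wordMoment (List.replicate n (Side.left, X)) = S.E (X ^ n) := by
  have := wordProd_replicate_left n X []
  rw [List.append_nil, wordProd, mul_one] at this
  rw [wordMoment, this]

theorem wordMoment_replicate_right (n : ℕ) (Y : A) :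
    S.wordMoment (List.replicate n (Side.right, Y)) = S.E (Y ^ n) := by
  rw [wordMoment, wordProd_replicate_right]

/-- The word `X ⋯ X (X L_c) Y ⋯ Y`. -/
def mixedWord (S : BBSpace B A) (X Y : A) (c : B) (n m : ℕ) : Word A :=
  List.replicate n (Side.left, X)
    ++ S.insAfter (Side.left, X) c :: List.replicate m (Side.right, Y)

/-- `L_c` commutes past right operators and is exchanged for `R_c` under `E`. The `R_c` of the mixed
moments can thus be carried by the last left letter, as in `mixedWord`. -/
theorem E_mul_pow_mul_R (Z : A) {Y : A} (hY : Y ∈ S.rightAlgebra) (c : B) (m : ℕ) :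
    S.E (Z * S.L c * Y ^ m) = S.E (Z * Y ^ m * S.R c) := by
  rw [mul_assoc, S.L_comm (pow_mem hY m), ← mul_assoc, E_mul_L]

theorem wordMoment_mixedWord (X : A) {Y : A} (hY : Y ∈ S.rightAlgebra) (c : B) (n m : ℕ) :
    S.wordMoment (S.mixedWord X Y c n m) = S.E (X ^ (n + 1) * Y ^ m * S.R c) := by
  rw [← E_mul_pow_mul_R _ hY, mixedWord, wordMoment, wordProd_replicate_left]
  simp only [insAfter, insertAfter, wordProd, wordProd_replicate_right, pow_succ, mul_assoc]

theorem mul_E_pow {Y : A} (hY : Y ∈ S.rightAlgebra) (c : B) (m : ℕ) :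
    c * S.E (Y ^ m) = S.E (X ^ 0 * Y ^ m * S.R c) := by
  rw [← E_mul_pow_mul_R _ hY, pow_zero, one_mul, E_L_mul]

end Algebraic

section Mixed

variable {B A : Type*} [NormedRing B] [NormedAlgebra ℂ B] [NormedRing A] [NormedAlgebra ℂ A]
  {S : BBSpace B A}

/-- The cumulants of words whose left letters have the left moment series as coefficient and whose
last left letter has the mixed moment series as coefficient. -/
theorem IsBound.hasSum_mixed [CompleteSpace B] {Γ K : ℝ} (hb : S.IsBound Γ K) {X Y : A}
    (hX : X ∈ S.leftAlgebra) (hY : Y ∈ S.rightAlgebra) (c : B) {μ ν : B}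
    (hμ : HasSum (fun s => S.E (X ^ s)) μ) (hμn : Summable fun s => ‖S.E (X ^ s)‖)
    (hν : HasSum (fun q : ℕ × ℕ => S.E (X ^ q.1 * Y ^ q.2 * S.R c)) ν)
    (hνn : Summable fun q : ℕ × ℕ => ‖S.E (X ^ q.1 * Y ^ q.2 * S.R c)‖)
    (hΓX : Γ * ‖X‖ ≤ 1 / 2) (hΓY : Γ * ‖Y‖ ≤ 1 / 2)
    (hΓμ : Γ * ‖(S.insAfter (Side.left, X) μ).2‖ ≤ 1 / 2) :
    HasSum (fun j =>
        (∑' k, S.partialCumulant (List.replicate j (S.insAfter (Side.left, X) μ)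
          ++ S.insAfter (Side.left, X) ν :: (Side.right, Y) :: List.replicate k (Side.right, Y))
          (j + 2))
        + S.partialCumulant (List.replicate j (S.insAfter (Side.left, X) μ)
          ++ [S.insAfter (Side.left, X) ν]) (j + 1))
      (∑' q : ℕ × ℕ, S.E (X ^ (q.1 + 1) * Y ^ q.2 * S.R c)) := by
  have hΓ : 0 ≤ Γ := zero_le_one.trans hb.one_le
  have hΓX0 : 0 ≤ Γ * ‖X‖ := by positivity
  have hΓY0 : 0 ≤ Γ * ‖Y‖ := by positivity
  set x : Side × A := (Side.left, X) with hx
  set y : Side × A := (Side.right, Y) with hy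
  have hins : ∀ b, (S.insAfter x b).1 = Side.left ∧ (S.insAfter x b).2 ∈ S.leftAlgebra :=
    fun b => ⟨rfl, S.insertAfter_mem (s := Side.left) hX b⟩
  set x' := S.insAfter x μ with hx'
  let U : ℕ → Word A := fun j => List.replicate j x'
  have hUl : ∀ j, (U j).length = j := fun j => by simp [U]
  let w : ℕ → ℕ → Word A := S.mixedWord X Y c
  have hw : ∀ n m, w n m = List.replicate n x ++ S.insAfter x c :: List.replicate m y :=
    fun _ _ => rfl
  have hx2 : x.2 = X := rfl
  have hy2 : y.2 = Y := rfl
  have hwl : ∀ n m, (w n m).length = n + 1 + m := fun n m => by simp [w, mixedWord]; omega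
  have hUmem : ∀ j, ∀ z ∈ U j, z.1 = Side.left ∧ z.2 ∈ S.leftAlgebra := by
    intro j z hz
    rw [List.eq_of_mem_replicate hz]
    exact hins μ
  have hxmem : ∀ n, ∀ z ∈ List.replicate n x, z.1 = Side.left ∧ z.2 ∈ S.leftAlgebra := by
    intro n z hz
    rw [List.eq_of_mem_replicate hz]
    exact ⟨rfl, hX⟩
  have hymem : ∀ n, ∀ z ∈ List.replicate n y, z.1 = Side.right ∧ z.2 ∈ S.rightAlgebra := by
    intro n z hz
    rw [List.eq_of_mem_replicate hz]
    exact ⟨rfl, hY⟩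
  have hadmw : ∀ (l : Word A) n m, (∀ z ∈ l, z.1 = Side.left ∧ z.2 ∈ S.leftAlgebra) →
      S.Admissible (l ++ w n m) := by
    intro l n m hl
    have := admissible_append (S := S) (l := l ++ (List.replicate n x ++ [S.insAfter x c]))
      (l' := List.replicate m y) ?_ (hymem m)
    · rw [hw]
      simpa only [List.append_assoc, List.cons_append, List.nil_append] using this
    · intro z hz
      simp only [List.mem_append, List.mem_singleton] at hz
      rcases hz with hz | hz | rfl
      · exact hl z hz
      · exact hxmem n z hz
      · exact hins c
  have hww : ∀ n m, weight Γ (w n m) =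
      (Γ * ‖X‖) ^ n * (Γ * ‖(S.insAfter x c).2‖ * (Γ * ‖Y‖) ^ m) := by
    intro n m
    simp only [w, mixedWord]
    rw [weight_append, weight_cons, weight_replicate, weight_replicate]
  -- `j` left letters of the block already carry `μ`, and the block contains the next letter, the
  -- first of `w q.1 q.2`.
  let T : ℕ → ℕ × ℕ → B := fun j q => S.partialCumulant (U j ++ w q.1 q.2) (j + 1)
  let Θ : ℕ → B := fun j => ∑' q, T j q
  have hT : ∀ j q, ‖T j q‖ ≤ (1 / 2) ^ j * (Γ * ‖(S.insAfter x c).2‖)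
      * ((1 / 2) ^ q.1 * (1 / 2) ^ q.2) := by
    intro j q
    refine (hb.partialCumulant_le _ (hadmw (U j) q.1 q.2 (hUmem j)) _ (by omega)
      (by simp [hUl, hwl]; omega)).trans ?_
    rw [weight_append, hww, weight_replicate]
    calc (Γ * ‖x'.2‖) ^ j * ((Γ * ‖X‖) ^ q.1 * (Γ * ‖(S.insAfter x c).2‖ * (Γ * ‖Y‖) ^ q.2))
        ≤ (1 / 2) ^ j * ((1 / 2) ^ q.1 * (Γ * ‖(S.insAfter x c).2‖ * (1 / 2) ^ q.2)) := by
          gcongr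
      _ = _ := by ring
  have hhalf := summable_geometric_bound_prod (r := 1 / 2) (t := 1 / 2) 1 (by norm_num) le_rfl
    (by norm_num) le_rfl
  simp only [one_mul] at hhalf
  have hΘ : ∀ j, ‖Θ j‖ ≤ (Γ * ‖(S.insAfter x c).2‖) *
      (∑' q : ℕ × ℕ, (1 / 2 : ℝ) ^ q.1 * (1 / 2) ^ q.2) * (1 / 2) ^ j := by
    intro j
    refine (tsum_of_norm_bounded (hhalf.hasSum.mul_left _) (hT j)).trans (le_of_eq ?_)
    ring
  -- The next letter of the block is right, absent, or left. In the first two cases the gap contains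
  -- all remaining left letters, including the one with `c`, and sums to `ν`; in the third it
  -- consists of plain left letters and sums to `μ`.
  have hstep : ∀ j, Θ j =
      ((∑' k, S.partialCumulant (U j ++ S.insAfter x ν :: y :: List.replicate k y) (j + 2))
        + S.partialCumulant (U j ++ [S.insAfter x ν]) (j + 1)) + Θ (j + 1) := by
    intro j
    have hadm1 : ∀ b, S.Admissible (U j ++ S.insAfter x b :: []) := by
      intro b
      have := admissible_append (S := S) (l := U j ++ [S.insAfter x b]) (l' := []) ?_ (by simp)
      · simpa only [List.append_nil] using this
      · intro z hz
        simp only [List.mem_append, List.mem_singleton] at hz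
        rcases hz with hz | rfl
        · exact hUmem j z hz
        · exact hins b
    have hadm2 : ∀ k b, S.Admissible (U j ++ S.insAfter x b :: y :: List.replicate k y) := by
      intro k b
      have := admissible_append (S := S) (l := U j ++ [S.insAfter x b])
        (l' := List.replicate (k + 1) y) ?_ (hymem (k + 1))
      · simpa only [List.append_assoc, List.cons_append, List.nil_append, List.replicate_succ]
          using this
      · intro z hz
        simp only [List.mem_append, List.mem_singleton] at hz
        rcases hz with hz | rfl
        · exact hUmem j z hz
        · exact hins b
    have hadm3 : ∀ (q : ℕ × ℕ) b, S.Admissible (U j ++ S.insAfter x b :: w q.1 q.2) := by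
      intro q b
      have := hadmw (U j ++ [S.insAfter x b]) q.1 q.2 (by
        intro z hz
        simp only [List.mem_append, List.mem_singleton] at hz
        rcases hz with hz | rfl
        · exact hUmem j z hz
        · exact hins b)
      simpa only [List.append_assoc, List.cons_append, List.nil_append] using this
    have hlast := hasSum_map_of_bound
      (S.coefHom (U j) x [] (j + 1) hadm1 (by omega) (by simp [hUl]))
      (hb.norm_coefHom_le hadm1 _ _) hν
    have hright := hasSum_sum_range_snd (hasSum_prod_apply
      (fun k => S.coefHom (U j) x (y :: List.replicate k y) (j + 2) (hadm2 k)
        (by omega) (by simp [hUl]; omega))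
      (C := fun k => weight Γ (U j) * (Γ * (K * ‖X‖)) * (Γ * ‖Y‖) * (Γ * ‖Y‖) ^ k)
      (summable_geometric_bound _ hΓY0 hΓY)
      (fun k b => by
        have := hb.norm_coefHom_le (hadm2 k) (j := j + 2) (by omega) (by simp [hUl]; omega) b
        rw [weight_cons, weight_replicate Γ k y, hx2, hy2] at this
        refine this.trans (le_of_eq ?_)
        ring) hν hνn)
    have hleft := hasSum_sum_range_fst (hasSum_prod_apply
      (fun q : ℕ × ℕ => S.coefHom (U j) x (w q.1 q.2) (j + 2) (hadm3 q)
        (by omega) (by simp [hUl, hwl]; omega))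
      (C := fun q => weight Γ (U j) * (Γ * (K * ‖X‖)) * (Γ * ‖(S.insAfter x c).2‖)
        * ((Γ * ‖X‖) ^ q.1 * (Γ * ‖Y‖) ^ q.2))
      (summable_geometric_bound_prod _ hΓX0 hΓX hΓY0 hΓY)
      (fun q b => by
        have := hb.norm_coefHom_le (hadm3 q) (j := j + 2) (by omega) (by simp [hUl, hwl]; omega) b
        rw [hww, hx2] at this
        refine this.trans (le_of_eq ?_)
        ring) hμ hμn)
    have hsum := (hright.add hlast).add hleft
    have heq : ∀ q : ℕ × ℕ, T j q =
        (∑ s ∈ Finset.range q.2, S.coefHom (U j) x (y :: List.replicate (q.2 - 1 - s) y) (j + 2)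
            (hadm2 (q.2 - 1 - s)) (by omega) (by simp [hUl]; omega)
            (S.E (X ^ q.1 * Y ^ s * S.R c))
          + S.coefHom (U j) x [] (j + 1) hadm1 (by omega) (by simp [hUl])
            (S.E (X ^ q.1 * Y ^ q.2 * S.R c)))
          + ∑ s ∈ Finset.range q.1, S.coefHom (U j) x (w (q.1 - 1 - s) q.2) (j + 2)
            (hadm3 (q.1 - 1 - s, q.2)) (by omega) (by simp [hUl, hwl]; omega) (S.E (X ^ s)) := by
      rintro ⟨n, m⟩
      have hA := hadmw (U j) n m (hUmem j)
      have hrep : ∀ s < m, m - s = m - 1 - s + 1 := fun s hs => by omega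
      simp only [coefHom, AddMonoidHom.mk'_apply, T]
      cases n with
      | zero =>
        -- The current letter is the one that carries `c`, so no left letter can follow. The gap
        -- gives `c E(y^s)`, the zero slice of the mixed moments.
        have e : w 0 m = S.insAfter x c :: List.replicate m y := by
          simp [hw]
        rw [e] at hA ⊢
        have h := hA.partialCumulant_eq
        rw [hUl, List.length_replicate] at h
        rw [h, Finset.range_zero, Finset.sum_empty, add_zero]
        congr 1
        · refine Finset.sum_congr rfl fun s hs => ?_
          have hs := Finset.mem_range.1 hs
          rw [contract, List.take_replicate, List.drop_replicate, Nat.min_eq_left hs.le,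
            hrep s hs, List.replicate_succ, insAfter_insAfter, wordMoment_replicate_right,
            mul_E_pow (X := X) hY]
        · rw [insAfter_insAfter, wordMoment_replicate_right, mul_E_pow (X := X) hY]
      | succ n =>
        have e : w (n + 1) m = x :: w n m := by
          simp [hw, List.replicate_succ]
        rw [e] at hA ⊢
        have h := hA.partialCumulant_eq
        rw [hUl, hwl, Finset.sum_range_add] at h
        rw [h, wordMoment_mixedWord X hY]
        -- Gaps of at most `n` letters stop before or at the letter with `c`, which survives; longer
        -- gaps swallow it together with some right letters.
        have e1 : ∀ s ∈ Finset.range (n + 1), S.partialCumulant (S.contract (U j) x (w n m) s) (j + 2)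
            = S.partialCumulant (U j ++ S.insAfter x (S.E (X ^ s)) :: w (n + 1 - 1 - s) m)
              (j + 2) := by
          intro s hs
          have hs : s ≤ n := by have := Finset.mem_range.1 hs; omega
          have hle : s ≤ (List.replicate n x).length := by simpa using hs
          simp only [contract, hw]
          rw [List.take_append_of_le_length hle, List.drop_append_of_le_length hle,
            List.take_replicate, List.drop_replicate, Nat.min_eq_left hs,
            wordMoment_replicate_left, Nat.add_sub_cancel]
        have e2 : ∀ s ∈ Finset.range m,
            S.partialCumulant (S.contract (U j) x (w n m) (n + 1 + s)) (j + 2)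
            = S.partialCumulant (U j ++ S.insAfter x (S.E (X ^ (n + 1) * Y ^ s * S.R c)) ::
              y :: List.replicate (m - 1 - s) y) (j + 2) := by
          intro s hs
          have hs := Finset.mem_range.1 hs
          have e3 : n + 1 + s = (List.replicate n x).length + (s + 1) := by simp; omega
          have e4 : (w n m).take (n + 1 + s) = S.mixedWord X Y c n s := by
            rw [hw, e3, List.take_length_add_append, List.take_succ_cons, List.take_replicate,
              Nat.min_eq_left hs.le]
            rfl
          have e5 : (w n m).drop (n + 1 + s) = y :: List.replicate (m - 1 - s) y := by
            rw [hw, e3, List.drop_length_add_append, List.drop_succ_cons, List.drop_replicate,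
              hrep s hs, List.replicate_succ]
          rw [contract, e4, e5, wordMoment_mixedWord X hY]
        rw [Finset.sum_congr rfl e1, Finset.sum_congr rfl e2]
        abel
    have hU1 : U (j + 1) = U j ++ [x'] := by
      simp [U, List.replicate_succ']
    have hfun : T j = _ := funext heq
    simp only [Θ]
    rw [hfun, hsum.tsum_eq]
    congr 1
    refine tsum_congr fun q => ?_
    simp only [coefHom, AddMonoidHom.mk'_apply, T, ← hx']
    rw [hU1, List.append_assoc (U j) [x']]
    rfl
  have hΘ0 : Θ 0 = ∑' q : ℕ × ℕ, S.E (X ^ (q.1 + 1) * Y ^ q.2 * S.R c) := by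
    refine tsum_congr fun q => ?_
    simp only [T]
    have e : U 0 ++ w q.1 q.2 = w q.1 q.2 := by simp [U]
    have hA := hadmw [] q.1 q.2 (by simp)
    rw [List.nil_append] at hA
    rw [e, partialCumulant_one hA.leftFirst, wordMoment_mixedWord X hY]
    intro h0
    have := hwl q.1 q.2
    rw [h0, List.length_nil] at this
    omega
  rw [← hΘ0]
  exact hasSum_of_telescoping hstep hΘ

end Mixed

end BBSpace

end BiFree

/-! ### The terms of the cumulant series in terms of words -/

namespace BiFree

namespace BBSpace

section Terms

variable {B A : Type*} [Ring B] [Algebra ℂ B] [Ring A] [Algebra ℂ A] {S : BBSpace B A}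

theorem kappa_congr {N N' : ℕ} (h : N = N') {χ : Fin N → Side} {χ' : Fin N' → Side}
    {Z : Fin N → A} {Z' : Fin N' → A} (hχ : ∀ k, χ k = χ' (Fin.cast h k))
    (hZ : ∀ k, Z k = Z' (Fin.cast h k)) : S.kappa χ Z = S.kappa χ' Z' := by
  subst h
  obtain rfl : χ = χ' := funext hχ
  obtain rfl : Z = Z' := funext hZ
  rfl

/-- The cumulants for `χ_{n,m}` in terms of words. -/
theorem kappa_chi {n m : ℕ} {Z : Fin (n + m) → A} {w : Word A} (hw : LeftFirst w)
    (hlen : w.length = n + m) (hcount : leftCount w = n)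
    (hZ : ∀ k : Fin w.length, (w[position n k]).2 = Z (Fin.cast hlen k)) :
    S.kappa (chi n m) Z = S.partialCumulant w w.length := by
  rw [partialCumulant_length]
  symm
  refine kappa_congr hlen (fun k => ?_) fun k => ?_
  · have h := hw.wordSide_eq_left_iff k
    rw [hcount] at h
    by_cases hk : (k : ℕ) < n
    · simp [chi, hk, h.2 hk]
    · simp only [chi, Fin.val_cast, hk, if_false]
      exact Side.ne_left_iff.1 fun e => hk (h.1 e)
  · rw [← hZ]
    subst hcount
    rfl

theorem leftTerm_eq {X : A} (hX : X ∈ S.leftAlgebra) (b c : B) (n : ℕ) :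
    S.leftTerm X b c (n + 1) = S.partialCumulant
      (List.replicate n (Side.left, S.L b * X) ++ [(Side.left, S.L b * X * S.L c)]) (n + 1) := by
  have hbX : S.L b * X ∈ S.leftAlgebra := mul_mem (S.L_mem b) hX
  have hadm := admissible_append (S := S)
    (l := List.replicate n (Side.left, S.L b * X) ++ [(Side.left, S.L b * X * S.L c)]) (l' := [])
    (by
      intro z hz
      rcases List.mem_append.1 hz with hz | hz
      · rw [List.eq_of_mem_replicate hz]; exact ⟨rfl, hbX⟩
      · rw [List.mem_singleton.1 hz]; exact ⟨rfl, mul_mem hbX (S.L_mem c)⟩) (by simp)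
  rw [List.append_nil] at hadm
  rw [leftTerm, kappa_chi hadm.leftFirst]
  · simp
  · simp
  · simp [leftCount, List.countP_replicate, Side.isLeft]
  · intro k
    have hk := k.2
    simp only [List.length_append, List.length_replicate, List.length_singleton] at hk
    have hp : (position (n + 1) k : ℕ) = k := by rw [position_val, if_pos hk]
    simp only [Fin.getElem_fin, hp, Fin.val_cast]
    by_cases h : (k : ℕ) < n
    · rw [List.getElem_append_left (by simpa using h), if_neg (by omega)]
      simp
    · have e : (k : ℕ) + 1 = n + 1 := by omega
      rw [if_pos e, List.getElem_append_right (by simpa using h)]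
      simp

/-- Right indices are listed backwards, so the last index, which carries `R_c`, comes directly after
the left letters. -/
theorem mixedTerm_eq {X Y : A} (hX : X ∈ S.leftAlgebra) (hY : Y ∈ S.rightAlgebra) (b c d : B)
    (n m : ℕ) :
    S.mixedTerm X Y b c d n (m + 1) = S.partialCumulant
      (List.replicate n (Side.left, S.L b * X) ++
        (Side.right, S.R d * Y * S.R c) :: List.replicate m (Side.right, S.R d * Y))
      (n + (m + 1)) := by
  have hbX : S.L b * X ∈ S.leftAlgebra := mul_mem (S.L_mem b) hX
  have hdY : S.R d * Y ∈ S.rightAlgebra := mul_mem (S.R_mem d) hY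
  have hadm := admissible_append (S := S)
    (l := List.replicate n (Side.left, S.L b * X))
    (l' := (Side.right, S.R d * Y * S.R c) :: List.replicate m (Side.right, S.R d * Y))
    (by
      intro z hz
      rw [List.eq_of_mem_replicate hz]; exact ⟨rfl, hbX⟩)
    (by
      intro z hz
      rcases List.mem_cons.1 hz with rfl | hz
      · exact ⟨rfl, mul_mem hdY (S.R_mem c)⟩
      · rw [List.eq_of_mem_replicate hz]; exact ⟨rfl, hdY⟩)
  rw [mixedTerm, kappa_chi hadm.leftFirst]
  · simp
  · simp
  · simp [leftCount, List.countP_replicate, Side.isLeft]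
  · intro k
    have hk := k.2
    simp only [List.length_append, List.length_replicate, List.length_cons] at hk
    have hp := position_val n k
    simp only [List.length_append, List.length_replicate, List.length_cons] at hp
    simp only [Fin.getElem_fin, Fin.val_cast]
    by_cases h : (k : ℕ) < n
    · rw [if_pos h] at hp ⊢
      simp only [hp]
      rw [List.getElem_append_left (by simpa using h)]
      simp
    · rw [if_neg h] at hp ⊢
      rw [List.getElem_append_right (by simp only [List.length_replicate]; omega)]
      by_cases h' : (k : ℕ) + 1 = n + (m + 1)
      · have e : (position n k : ℕ) - (List.replicate n (Side.left, S.L b * X)).length = 0 := by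
          simp only [List.length_replicate]; omega
        simp only [e, if_pos h', List.getElem_cons_zero]
      · obtain ⟨i, e⟩ : ∃ i, (position n k : ℕ)
            - (List.replicate n (Side.left, S.L b * X)).length = i + 1 :=
          ⟨(position n k : ℕ) - n - 1, by simp only [List.length_replicate]; omega⟩
        simp only [e, if_neg h', List.getElem_cons_succ, List.getElem_replicate]

theorem coefBefore_replicate (n : ℕ) (z : Side × A) (b : B) :
    S.coefBefore (List.replicate n (z, b)) = List.replicate n (S.insBefore z b) := by
  simp [coefBefore]

theorem coefBefore_append (T T' : CoefWord B A) :
    S.coefBefore (T ++ T') = S.coefBefore T ++ S.coefBefore T' := by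
  simp [coefBefore]

theorem coefAfter_replicate (n : ℕ) (z : Side × A) (b : B) :
    S.coefAfter (List.replicate n (z, b)) b = List.replicate n (S.insAfter z b) := by
  induction n with
  | zero => rfl
  | succ n ih =>
    have : headCoef (List.replicate n (z, b)) b = b := by cases n <;> rfl
    rw [List.replicate_succ, coefAfter, ih, this, List.replicate_succ]

theorem insBefore_one (z : Side × A) : S.insBefore z 1 = z := by
  obtain ⟨s, Z⟩ := z
  cases s <;> simp [insBefore, L_one, R_one]

/-- `L_{ab} = L_a L_b` puts a coefficient `a` before every letter. Shifting moves each `a` behind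
the preceding letter, and the first one leaves in front. -/
theorem leftTerm_mul_left {X : A} (hX : X ∈ S.leftAlgebra) (a b c : B) (n : ℕ) :
    S.leftTerm X (a * b) c (n + 1) = a * S.partialCumulant
      (List.replicate n (S.insAfter (Side.left, S.L b * X) a)
        ++ [S.insAfter (Side.left, S.L b * X) c]) (n + 1) := by
  have hbX : S.L b * X ∈ S.leftAlgebra := mul_mem (S.L_mem b) hX
  let T : CoefWord B A := List.replicate n ((Side.left, S.L b * X), a)
    ++ [(S.insAfter (Side.left, S.L b * X) c, a)]
  have hT : S.CoefAdmissible T := by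
    have := admissible_append (S := S) (l := T.map Prod.fst) (l' := []) ?_ (by simp)
    · rwa [List.append_nil] at this
    · intro z hz
      simp only [T, List.map_append, List.map_replicate, List.mem_append, List.map_cons,
        List.map_nil, List.mem_singleton] at hz
      rcases hz with hz | rfl
      · rw [List.eq_of_mem_replicate hz]; exact ⟨rfl, hbX⟩
      · exact ⟨rfl, mul_mem hbX (S.L_mem c)⟩
  have key := headCoef_mul_partialCumulant hT 1 (j := n + 1) (by omega) (by simp [T])
  have h1 : headCoef T 1 = a := by
    simp only [T, headCoef_append]
    cases n <;> rfl
  have h2 : S.coefBefore T = List.replicate n (Side.left, S.L (a * b) * X)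
      ++ [(Side.left, S.L (a * b) * X * S.L c)] := by
    rw [coefBefore_append, coefBefore_replicate]
    simp [coefBefore, insBefore, insAfter, insertAfter, L_mul, mul_assoc]
  have h3 : S.coefAfter T 1 = List.replicate n (S.insAfter (Side.left, S.L b * X) a)
        ++ [S.insAfter (Side.left, S.L b * X) c] := by
    simp only [T]
    rw [coefAfter_append, headCoef_cons, coefAfter_replicate]
    simp [coefAfter, headCoef, insAfter_one]
  rw [leftTerm_eq hX, ← h2, ← h3, ← h1, key, mul_one]

section Mixed

variable {X Y : A} (a b c d e : B) (n m : ℕ)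

/-- The word with coefficients that describes the mixed terms. -/
def mixedCoefWord (S : BBSpace B A) (X Y : A) (a b c d e : B) (n m : ℕ) : CoefWord B A :=
  List.replicate n ((Side.left, S.L b * X), a) ++
    (S.insAfter (Side.right, S.R d * Y) e, c) ::
      List.replicate m (S.insAfter (Side.right, S.R d * Y) e, 1)

/-- `R_{de} = R_e R_d` already places `e` after its right letter. Only the `a` on the left letters
and the single `c` need shifting, so all other coefficients are `1`. -/
theorem mixedTerm_mul (hX : X ∈ S.leftAlgebra) (hY : Y ∈ S.rightAlgebra) :
    S.mixedTerm X Y (a * b) c (d * e) n (m + 1) =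
      headCoef (S.mixedCoefWord X Y a b c d e n m) 1 * S.partialCumulant
        (S.coefAfter (S.mixedCoefWord X Y a b c d e n m) 1) (n + (m + 1)) := by
  have hbX : S.L b * X ∈ S.leftAlgebra := mul_mem (S.L_mem b) hX
  have hdY : S.R d * Y ∈ S.rightAlgebra := mul_mem (S.R_mem d) hY
  have hdY' : (S.insAfter (Side.right, S.R d * Y) e).2 ∈ S.rightAlgebra := mul_mem (S.R_mem e) hdY
  have hT : S.CoefAdmissible (S.mixedCoefWord X Y a b c d e n m) := by
    have := admissible_append (S := S) (l := List.replicate n (Side.left, S.L b * X))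
      (l' := List.replicate (m + 1) (S.insAfter (Side.right, S.R d * Y) e)) ?_ ?_
    · simpa [CoefAdmissible, mixedCoefWord, List.replicate_succ] using this
    · intro z hz
      rw [List.eq_of_mem_replicate hz]; exact ⟨rfl, hbX⟩
    · intro z hz
      rw [List.eq_of_mem_replicate hz]; exact ⟨rfl, hdY'⟩
  have key := headCoef_mul_partialCumulant hT 1 (j := n + (m + 1)) (by omega)
    (by simp [mixedCoefWord])
  have h2 : S.coefBefore (S.mixedCoefWord X Y a b c d e n m)
      = List.replicate n (Side.left, S.L (a * b) * X) ++
        (Side.right, S.R (d * e) * Y * S.R c) :: List.replicate m (Side.right, S.R (d * e) * Y) := by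
    rw [mixedCoefWord, coefBefore_append, coefBefore_replicate]
    have : ∀ T : CoefWord B A, ∀ y, S.coefBefore (y :: T) = S.insBefore y.1 y.2 :: S.coefBefore T :=
      fun _ _ => rfl
    rw [this, coefBefore_replicate, insBefore_one]
    simp [insBefore, insAfter, insertAfter, L_mul, R_mul, mul_assoc]
  rw [key, mul_one, h2, mixedTerm_eq hX hY]

theorem coefAfter_mixedCoefWord_tail :
    S.coefAfter ((S.insAfter (Side.right, S.R d * Y) e, c) ::
      List.replicate m (S.insAfter (Side.right, S.R d * Y) e, (1 : B))) 1
      = List.replicate (m + 1) (S.insAfter (Side.right, S.R d * Y) e) := by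
  have : headCoef (List.replicate m (S.insAfter (Side.right, S.R d * Y) e, (1 : B))) 1 = 1 := by
    cases m <;> rfl
  rw [coefAfter, coefAfter_replicate, this, insAfter_one, List.replicate_succ]

theorem mixedTerm_zero_mul (hX : X ∈ S.leftAlgebra) (hY : Y ∈ S.rightAlgebra) :
    S.mixedTerm X Y (a * b) c (d * e) 0 (m + 1) =
      c * S.partialCumulant
        (List.replicate (m + 1) (S.insAfter (Side.right, S.R d * Y) e)) (m + 1) := by
  rw [mixedTerm_mul a b c d e 0 m hX hY, ← coefAfter_mixedCoefWord_tail c d e m, zero_add]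
  rfl

/-- With a left letter present, `a` leaves in front and `c` lands behind the last left letter.
Without one, `c` itself is the leading coefficient (`mixedTerm_zero_mul`); this is how the two kinds
of product in the functional equation arise. -/
theorem mixedTerm_succ_mul (hX : X ∈ S.leftAlgebra) (hY : Y ∈ S.rightAlgebra) :
    S.mixedTerm X Y (a * b) c (d * e) (n + 1) (m + 1) =
      a * S.partialCumulant
        (List.replicate n (S.insAfter (Side.left, S.L b * X) a)
          ++ S.insAfter (Side.left, S.L b * X) c ::
            List.replicate (m + 1) (S.insAfter (Side.right, S.R d * Y) e)) (n + 1 + (m + 1)) := by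
  rw [mixedTerm_mul a b c d e (n + 1) m hX hY]
  have h1 : headCoef (S.mixedCoefWord X Y a b c d e (n + 1) m) 1 = a := rfl
  have h2 : S.coefAfter (S.mixedCoefWord X Y a b c d e (n + 1) m) 1 =
      List.replicate n (S.insAfter (Side.left, S.L b * X) a)
          ++ S.insAfter (Side.left, S.L b * X) c ::
            List.replicate (m + 1) (S.insAfter (Side.right, S.R d * Y) e) := by
    rw [mixedCoefWord, coefAfter_append, coefAfter_mixedCoefWord_tail, List.replicate_succ',
      coefAfter_append, headCoef_cons, headCoef_cons, coefAfter_replicate, List.append_assoc]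
    rfl
  rw [h1, h2]

end Mixed

end Terms

end BBSpace

end BiFree

/-! ### Convergence and the functional equation -/

namespace BiFree

namespace BBSpace

section Main

variable {B A : Type*} [NormedRing B] [NormedAlgebra ℂ B] [NormedRing A] [NormedAlgebra ℂ A]
  {S : BBSpace B A}

theorem tsum_prod_eq_zero_add {E : Type*} [NormedAddCommGroup E] [CompleteSpace E]
    {f : ℕ × ℕ → E} (hf : Summable f) :
    ∑' p, f p = ∑' m, f (0, m) + ∑' p : ℕ × ℕ, f (p.1 + 1, p.2) := by
  have hinj : Function.Injective fun q : ℕ × ℕ => (q.1 + 1, q.2) := by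
    rintro ⟨i, j⟩ ⟨i', j'⟩ h
    simpa using h
  have hs : Summable fun p : ℕ × ℕ => f (p.1 + 1, p.2) := hf.comp_injective hinj
  have h1 := hf.hasSum.prod_fiberwise fun n => (hf.prod_factor n).hasSum
  rw [hs.tsum_prod, ← h1.tsum_eq, h1.summable.tsum_eq_zero_add]

theorem norm_pow_le_mul_pow {A : Type*} [NormedRing A] (X : A) (n : ℕ) : ‖X ^ n‖ ≤ (1 + ‖(1 : A)‖) * ‖X‖ ^ n := by
  rcases Nat.eq_zero_or_pos n with rfl | hn
  · simp
  · refine (norm_pow_le' X hn).trans (le_mul_of_one_le_left (by positivity) ?_)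
    linarith [norm_nonneg (1 : A)]

theorem norm_E_pow_le {K : ℝ} (hK : 0 ≤ K) (hE : ∀ Z, ‖S.E Z‖ ≤ K * ‖Z‖) (X : A) (n : ℕ) :
    ‖S.E (X ^ n)‖ ≤ K * (1 + ‖(1 : A)‖) * ‖X‖ ^ n := by
  rw [mul_assoc]
  exact (hE _).trans (mul_le_mul_of_nonneg_left (norm_pow_le_mul_pow X n) hK)

theorem norm_one_add_tsum_E_le {K : ℝ} (hK : 0 ≤ K) (hE : ∀ Z, ‖S.E Z‖ ≤ K * ‖Z‖) {X : A}
    (hX : ‖X‖ ≤ 1 / 2) : ‖1 + ∑' n : ℕ, S.E (X ^ (n + 1))‖ ≤ ‖(1 : B)‖ + K * (1 + ‖(1 : A)‖) := by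
  refine (norm_add_le _ _).trans (add_le_add_right ?_ _)
  refine (tsum_of_norm_bounded ((hasSum_geometric_of_lt_one (r := (1 / 2 : ℝ)) (by norm_num)
    (by norm_num)).mul_left (K * (1 + ‖(1 : A)‖) * (1 / 2))) fun n => ?_).trans (le_of_eq ?_)
  · refine (norm_E_pow_le hK hE X (n + 1)).trans ?_
    rw [mul_assoc _ (1 / 2 : ℝ), ← pow_succ']
    gcongr
  · ring

theorem summable_norm_E_pow {K : ℝ} (hK : 0 ≤ K) (hE : ∀ Z, ‖S.E Z‖ ≤ K * ‖Z‖) {X : A}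
    (hX : ‖X‖ ≤ 1 / 2) : Summable fun n : ℕ => ‖S.E (X ^ n)‖ :=
  Summable.of_nonneg_of_le (fun _ => norm_nonneg _) (norm_E_pow_le hK hE X)
    (summable_geometric_bound _ (norm_nonneg X) hX)

theorem summable_norm_E_pow_mul_pow {K : ℝ} (hK : 0 ≤ K) (hE : ∀ Z, ‖S.E Z‖ ≤ K * ‖Z‖) {X Y : A}
    (hX : ‖X‖ ≤ 1 / 2) (hY : ‖Y‖ ≤ 1 / 2) (Z : A) :
    Summable fun p : ℕ × ℕ => ‖S.E (X ^ p.1 * Y ^ p.2 * Z)‖ := by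
  refine Summable.of_nonneg_of_le (fun _ => norm_nonneg _) (fun p => ?_)
    (summable_geometric_bound_prod (K * ((1 + ‖(1 : A)‖) * (1 + ‖(1 : A)‖) * ‖Z‖))
      (norm_nonneg X) hX (norm_nonneg Y) hY)
  rw [mul_assoc K]
  refine (hE _).trans (mul_le_mul_of_nonneg_left ?_ hK)
  calc ‖X ^ p.1 * Y ^ p.2 * Z‖ ≤ ‖X ^ p.1‖ * ‖Y ^ p.2‖ * ‖Z‖ :=
        (norm_mul_le _ _).trans (mul_le_mul_of_nonneg_right (norm_mul_le _ _) (norm_nonneg _))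
    _ ≤ ((1 + ‖(1 : A)‖) * ‖X‖ ^ p.1) * ((1 + ‖(1 : A)‖) * ‖Y‖ ^ p.2) * ‖Z‖ := by
        gcongr <;> exact norm_pow_le_mul_pow _ _
    _ = _ := by ring

theorem hasSum_E_pow [CompleteSpace B] {X : A} (h : Summable fun n : ℕ => ‖S.E (X ^ (n + 1))‖) :
    HasSum (fun n => S.E (X ^ n)) (1 + ∑' n : ℕ, S.E (X ^ (n + 1))) := by
  have h1 := (hasSum_nat_add_iff (f := fun n => S.E (X ^ n)) 1).1 h.of_norm.hasSum
  simpa [S.E_one, add_comm] using h1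

theorem IsBound.summable_norm_leftCumulant {Γ K : ℝ} (hb : S.IsBound Γ K) {X X' : A}
    (hX : X ∈ S.leftAlgebra) (hX' : X' ∈ S.leftAlgebra) (hΓX : Γ * ‖X‖ ≤ 1 / 2) :
    Summable fun n : ℕ => ‖S.partialCumulant
      (List.replicate n (Side.left, X) ++ [(Side.left, X')]) (n + 1)‖ := by
  have hΓ : 0 ≤ Γ := zero_le_one.trans hb.one_le
  refine Summable.of_nonneg_of_le (fun _ => norm_nonneg _) (fun n => ?_)
    (summable_geometric_bound (Γ * ‖X'‖) (mul_nonneg hΓ (norm_nonneg X)) hΓX)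
  have hadm := admissible_append (S := S)
    (l := List.replicate n (Side.left, X) ++ [(Side.left, X')]) (l' := [])
    (by
      intro z hz
      rcases List.mem_append.1 hz with hz | hz
      · rw [List.eq_of_mem_replicate hz]; exact ⟨rfl, hX⟩
      · rw [List.mem_singleton.1 hz]; exact ⟨rfl, hX'⟩) (by simp)
  rw [List.append_nil] at hadm
  refine (hb.partialCumulant_le _ hadm _ (by omega) (by simp)).trans (le_of_eq ?_)
  rw [weight_append, weight_replicate, weight_cons, weight_nil]
  ring

/-- `c` enters each term through one letter only, hence as a constant factor of a geometric bound;
it need not be small. -/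
theorem IsBound.cConverges {Γ K : ℝ} (hb : S.IsBound Γ K) {X Y : A} (hX : X ∈ S.leftAlgebra)
    (hY : Y ∈ S.rightAlgebra) (b c d : B) (hΓX : Γ * ‖S.L b * X‖ ≤ 1 / 2)
    (hΓY : Γ * ‖S.R d * Y‖ ≤ 1 / 2) : S.CConverges X Y b c d := by
  have hΓ : 0 ≤ Γ := zero_le_one.trans hb.one_le
  have hbX : S.L b * X ∈ S.leftAlgebra := mul_mem (S.L_mem b) hX
  have hdY : S.R d * Y ∈ S.rightAlgebra := mul_mem (S.R_mem d) hY
  constructor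
  · simp only [leftTerm_eq hX]
    exact hb.summable_norm_leftCumulant hbX (mul_mem hbX (S.L_mem c)) hΓX
  · refine Summable.of_nonneg_of_le (fun _ => norm_nonneg _) (fun p => ?_)
      (summable_geometric_bound_prod (Γ * ‖S.R d * Y * S.R c‖) (mul_nonneg hΓ (norm_nonneg _)) hΓX
        (mul_nonneg hΓ (norm_nonneg _)) hΓY)
    rw [mixedTerm_eq hX hY]
    have hadm := admissible_append (S := S)
      (l := List.replicate p.1 (Side.left, S.L b * X))
      (l' := (Side.right, S.R d * Y * S.R c) :: List.replicate p.2 (Side.right, S.R d * Y))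
      (by
        intro z hz
        rw [List.eq_of_mem_replicate hz]; exact ⟨rfl, hbX⟩)
      (by
        intro z hz
        rcases List.mem_cons.1 hz with rfl | hz
        · exact ⟨rfl, mul_mem hdY (S.R_mem c)⟩
        · rw [List.eq_of_mem_replicate hz]; exact ⟨rfl, hdY⟩)
    refine (hb.partialCumulant_le _ hadm _ (by omega) (by simp)).trans (le_of_eq ?_)
    rw [weight_append, weight_replicate, weight_cons, weight_replicate]
    ring

/-- The functional equation between the moment series and the cumulant series, for arguments for
which the series are dominated by geometric series. -/
theorem IsBound.functional_equation [CompleteSpace B] {Γ K : ℝ} (hb : S.IsBound Γ K) {X Y : A}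
    (hX : X ∈ S.leftAlgebra) (hY : Y ∈ S.rightAlgebra) (b c d : B)
    (hMl : S.MlConverges X b) (hMr : S.MrConverges Y d) (hM : S.MConverges X Y b c d)
    (hΓX : Γ * ‖S.L b * X‖ ≤ 1 / 2) (hΓY : Γ * ‖S.R d * Y‖ ≤ 1 / 2)
    (hΓl : Γ * ‖(S.insAfter (Side.left, S.L b * X) (S.Ml X b)).2‖ ≤ 1 / 2)
    (hΓr : Γ * ‖(S.insAfter (Side.right, S.R d * Y) (S.Mr Y d)).2‖ ≤ 1 / 2)
    (hC : S.CConverges X Y (S.Ml X b * b) (S.M X Y b c d) (d * S.Mr Y d)) :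
    S.Ml X b * S.M X Y b c d + S.M X Y b c d * S.Mr Y d =
      S.Ml X b * c * S.Mr Y d
        + S.C X Y (S.Ml X b * b) (S.M X Y b c d) (d * S.Mr Y d) := by
  have hbX : S.L b * X ∈ S.leftAlgebra := mul_mem (S.L_mem b) hX
  have hdY : S.R d * Y ∈ S.rightAlgebra := mul_mem (S.R_mem d) hY
  set x : Side × A := (Side.left, S.L b * X) with hx
  set y : Side × A := (Side.right, S.R d * Y) with hy
  have hμ : HasSum (fun n => S.E ((S.L b * X) ^ n)) (S.Ml X b) := hasSum_E_pow hMl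
  have hμn : Summable fun n => ‖S.E ((S.L b * X) ^ n)‖ :=
    (summable_nat_add_iff (f := fun n => ‖S.E ((S.L b * X) ^ n)‖) 1).1 hMl
  have hρ : HasSum (fun n => S.E ((S.R d * Y) ^ n)) (S.Mr Y d) := hasSum_E_pow hMr
  have hρn : Summable fun n => ‖S.E ((S.R d * Y) ^ n)‖ :=
    (summable_nat_add_iff (f := fun n => ‖S.E ((S.R d * Y) ^ n)‖) 1).1 hMr
  have hν : HasSum (fun q : ℕ × ℕ => S.E ((S.L b * X) ^ q.1 * (S.R d * Y) ^ q.2 * S.R c))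
      (S.M X Y b c d) := hM.of_norm.hasSum
  have hρ' : HasSum (fun n => S.wordMoment (List.replicate n y)) (S.Mr Y d) := by
    simpa only [hy, wordMoment_replicate_right] using hρ
  have hρn' : Summable fun n => ‖S.wordMoment (List.replicate n y)‖ := by
    simpa only [hy, wordMoment_replicate_right] using hρn
  have hmix := hb.hasSum_mixed hbX hdY c hμ hμn hν hM hΓX hΓY hΓl
  rw [← hx, ← hy] at hmix
  set μ := S.Ml X b with hμdef
  set ρ := S.Mr Y d with hρdef
  set ν := S.M X Y b c d with hνdef
  let κ : ℕ → B := fun n =>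
    S.partialCumulant (List.replicate n (S.insAfter x μ) ++ [S.insAfter x ν]) (n + 1)
  let Ψ : ℕ → B := fun n => ∑' k, S.partialCumulant (List.replicate n (S.insAfter x μ)
    ++ S.insAfter x ν :: y :: List.replicate k y) (n + 2)
  have hκ : Summable κ := by
    have := hb.summable_norm_leftCumulant (S.insertAfter_mem (s := Side.left) hbX μ)
      (S.insertAfter_mem (s := Side.left) hbX ν) hΓl
    exact this.of_norm
  have hmix' : HasSum (fun n => Ψ n + κ n)
      (∑' q : ℕ × ℕ, S.E ((S.L b * X) ^ (q.1 + 1) * (S.R d * Y) ^ q.2 * S.R c)) := hmix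
  -- The words without left letters contribute `∑ E(y^m R_c) = cρ` to `ν`.
  have hsplit : ∑' q : ℕ × ℕ, S.E ((S.L b * X) ^ (q.1 + 1) * (S.R d * Y) ^ q.2 * S.R c)
      = ν - c * ρ := by
    have e2 := tsum_prod_eq_zero_add hM.of_norm
    have e3 : ∑' m, S.E ((S.L b * X) ^ 0 * (S.R d * Y) ^ m * S.R c) = c * ρ := by
      simp only [← mul_E_pow hdY]
      exact (hρ.mul_left c).tsum_eq
    have e4 := e2.symm.trans hν.tsum_eq
    simp only [e3] at e4
    rw [← e4, add_sub_cancel_left]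
  -- No separate estimate is needed: `Ψ + κ` and `κ` are summable.
  have hΨ : Summable Ψ := by
    have := hmix'.summable.sub hκ
    simpa using this
  have hΨsum : ∑' n, Ψ n + ∑' n, κ n = ν - c * ρ := by
    rw [← hΨ.tsum_add hκ, hmix'.tsum_eq, hsplit]
  have hright : HasSum (fun q => S.partialCumulant
      (List.replicate (q + 1) (S.insAfter y ρ)) (q + 1)) (ρ - 1) := by
    have h := hb.hasSum_cumulant_replicate (u := []) (z := y)
      (fun l hl => by simpa using admissible_append (l := []) (by simp) hl) hdY hρ' hρn' hΓY hΓr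
    have e : ∑' m, S.partialCumulant ([] ++ y :: List.replicate m y) (([] : Word A).length + 1)
        = ρ - 1 := by
      have e' : ∀ m, S.partialCumulant ([] ++ y :: List.replicate m y)
          (([] : Word A).length + 1) = S.E ((S.R d * Y) ^ (m + 1)) := by
        intro m
        have hadm : S.Admissible (List.replicate (m + 1) y) := by
          have := admissible_append (S := S) (l := []) (l' := List.replicate (m + 1) y) (by simp)
            (by
              intro z hz
              rw [List.eq_of_mem_replicate hz]; exact ⟨rfl, hdY⟩)
          simpa using this
        rw [List.nil_append, ← List.replicate_succ, List.length_nil, zero_add,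
          partialCumulant_one hadm.leftFirst (by simp), wordMoment_replicate_right]
      rw [tsum_congr e', hρdef, Mr, add_sub_cancel_left]
    rw [e] at h
    simpa using h
  -- The left part is now fixed as a prefix inside the block; summing over the right letters puts
  -- `ρ` on each of them.
  have hmixed : ∀ n, HasSum (fun q => S.partialCumulant (List.replicate n (S.insAfter x μ)
      ++ S.insAfter x ν :: List.replicate (q + 1) (S.insAfter y ρ)) (n + 1 + (q + 1))) (Ψ n) := by
    intro n
    have h := hb.hasSum_cumulant_replicate (z := y)
      (u := List.replicate n (S.insAfter x μ) ++ [S.insAfter x ν])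
      (fun l hl => admissible_append (by
        intro z hz
        rcases List.mem_append.1 hz with hz | hz
        · rw [List.eq_of_mem_replicate hz]
          exact ⟨rfl, S.insertAfter_mem (s := Side.left) hbX μ⟩
        · rw [List.mem_singleton.1 hz]
          exact ⟨rfl, S.insertAfter_mem (s := Side.left) hbX ν⟩) hl) hdY hρ' hρn' hΓY hΓr
    simpa only [List.append_assoc, List.cons_append, List.nil_append, List.length_append,
      List.length_replicate, List.length_singleton, add_assoc, one_add_one_eq_two] using h
  have hCl : ∑' n, S.leftTerm X (μ * b) ν (n + 1) = μ * ∑' n, κ n := by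
    rw [← hκ.tsum_mul_left]
    exact tsum_congr fun n => leftTerm_mul_left hX μ b ν n
  -- The slice without left letters has leading coefficient `ν`, all others have `μ`.
  have hCm : ∑' p : ℕ × ℕ, S.mixedTerm X Y (μ * b) ν (d * ρ) p.1 (p.2 + 1)
      = ν * (ρ - 1) + μ * ∑' n, Ψ n := by
    have e1 := hC.2.of_norm.hasSum.prod_fiberwise fun n =>
      (hC.2.of_norm.prod_factor n).hasSum
    have e2 := e1.summable.tsum_eq_zero_add
    rw [e1.tsum_eq] at e2
    rw [e2]
    congr 1
    · simp only [mixedTerm_zero_mul μ b ν d ρ _ hX hY]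
      exact (hright.mul_left ν).tsum_eq
    · rw [← hΨ.tsum_mul_left]
      refine tsum_congr fun n => ?_
      simp only [mixedTerm_succ_mul μ b ν d ρ n _ hX hY]
      exact ((hmixed n).mul_left μ).tsum_eq
  rw [C, hCl, hCm]
  have hΨ' : ∑' n, Ψ n = ν - c * ρ - ∑' n, κ n := by rw [← hΨsum]; abel
  rw [hΨ']
  noncomm_ring

end Main

end BBSpace

end BiFree

theorem mainTheorem3 {B A : Type*}
    [NormedRing B] [NormedAlgebra ℂ B] [CompleteSpace B]
    [NormedRing A] [NormedAlgebra ℂ A] [CompleteSpace A]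
    (S : BiFree.BBSpace B A) (hS : S.IsBanach)
    (X Y : A) (hX : X ∈ S.leftAlgebra) (hY : Y ∈ S.rightAlgebra) :
    ∃ δ : ℝ, 0 < δ ∧ ∀ b c d : B, ‖b‖ < δ → ‖d‖ < δ →
      S.MlConverges X b ∧ S.MrConverges Y d ∧ S.MConverges X Y b c d ∧ S.CConverges X Y b c d ∧
      S.CConverges X Y (S.Ml X b * b) (S.M X Y b c d) (d * S.Mr Y d) ∧
      S.Ml X b * S.M X Y b c d + S.M X Y b c d * S.Mr Y d =
        S.Ml X b * c * S.Mr Y d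
          + S.C X Y (S.Ml X b * b) (S.M X Y b c d) (d * S.Mr Y d) := by
  obtain ⟨K, hK, hE, hL, hR⟩ := hS.exists_bound
  obtain ⟨Γ, hΓ, hQ⟩ := hS.exists_norm_partialCumulant_le
  have hb : S.IsBound Γ K := ⟨hΓ, hQ, fun z b => BiFree.BBSpace.norm_insertAfter_le hL hR _ _ _⟩
  have hK0 : 0 ≤ K := zero_le_one.trans hK
  have hΓ0 : 0 ≤ Γ := zero_le_one.trans hΓ
  -- Bounds both one-sided moment series on the final domain; the leading `1` ensures `1 ≤ D`.
  set D := 1 + (‖(1 : B)‖ + K * (1 + ‖(1 : A)‖)) with hD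
  have hD1 : 1 ≤ D := by
    have : 0 ≤ ‖(1 : B)‖ + K * (1 + ‖(1 : A)‖) := by positivity
    linarith
  have hG1 : 1 ≤ Γ * (K * D) :=
    one_le_mul_of_one_le_of_one_le hΓ (one_le_mul_of_one_le_of_one_le hK hD1)
  -- Letters of norm at most `r` keep `Γ` times their norm below `1/2` even after a coefficient of
  -- norm at most `D` is attached, which costs a factor `K * D`.
  set r := 1 / (2 * (Γ * (K * D))) with hr
  have hr0 : 0 < r := by positivity
  have hGr : Γ * (K * D) * r = 1 / 2 := by
    rw [hr]; field_simp
  have hKD : 1 ≤ K * D := one_le_mul_of_one_le_of_one_le hK hD1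
  have hΓr : Γ * r ≤ 1 / 2 := by
    rw [← hGr]
    exact mul_le_mul_of_nonneg_right (le_mul_of_one_le_right hΓ0 hKD) hr0.le
  have hr2 : r ≤ 1 / 2 := (le_mul_of_one_le_left hr0.le hΓ).trans hΓr
  have hden : 0 < K * (‖X‖ + ‖Y‖ + 1) := by positivity
  -- This makes `‖L_b X‖` and `‖R_d Y‖` at most `r`; the `+ 1` keeps the denominator positive when
  -- `X = Y = 0`.
  refine ⟨r / (K * (‖X‖ + ‖Y‖ + 1)), by positivity, fun b c d hbδ hdδ => ?_⟩
  have hsmall : ∀ t : ℝ, t < r / (K * (‖X‖ + ‖Y‖ + 1)) → K * t * (‖X‖ + ‖Y‖ + 1) ≤ r := by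
    intro t ht
    rw [lt_div_iff₀ hden] at ht
    linarith
  have hXr : ‖S.L b * X‖ ≤ r := by
    refine le_trans ?_ (hsmall _ hbδ)
    refine (norm_mul_le _ _).trans (mul_le_mul (hL b) ?_ (norm_nonneg _) (by positivity))
    linarith [norm_nonneg Y]
  have hYr : ‖S.R d * Y‖ ≤ r := by
    refine le_trans ?_ (hsmall _ hdδ)
    refine (norm_mul_le _ _).trans (mul_le_mul (hR d) ?_ (norm_nonneg _) (by positivity))
    linarith [norm_nonneg X]
  have hX2 := hXr.trans hr2
  have hY2 := hYr.trans hr2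
  have hΓX : Γ * ‖S.L b * X‖ ≤ 1 / 2 := (mul_le_mul_of_nonneg_left hXr hΓ0).trans hΓr
  have hΓY : Γ * ‖S.R d * Y‖ ≤ 1 / 2 := (mul_le_mul_of_nonneg_left hYr hΓ0).trans hΓr
  have hMl : S.MlConverges X b :=
    (summable_nat_add_iff (f := fun n => ‖S.E ((S.L b * X) ^ n)‖) 1).2
      (BiFree.BBSpace.summable_norm_E_pow hK0 hE hX2)
  have hMr : S.MrConverges Y d :=
    (summable_nat_add_iff (f := fun n => ‖S.E ((S.R d * Y) ^ n)‖) 1).2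
      (BiFree.BBSpace.summable_norm_E_pow hK0 hE hY2)
  have hM : S.MConverges X Y b c d :=
    BiFree.BBSpace.summable_norm_E_pow_mul_pow hK0 hE hX2 hY2 (S.R c)
  have hMlD : ‖S.Ml X b‖ ≤ D :=
    (BiFree.BBSpace.norm_one_add_tsum_E_le hK0 hE hX2).trans (by linarith)
  have hMrD : ‖S.Mr Y d‖ ≤ D :=
    (BiFree.BBSpace.norm_one_add_tsum_E_le hK0 hE hY2).trans (by linarith)
  have hins : ∀ u v W : ℝ, 0 ≤ W → u ≤ K * v * W → v ≤ D → W ≤ r → Γ * u ≤ 1 / 2 := by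
    intro u v W hW hu hv hWr
    rw [← hGr, mul_assoc]
    refine mul_le_mul_of_nonneg_left (hu.trans ?_) hΓ0
    gcongr
  have hC : S.CConverges X Y (S.Ml X b * b) (S.M X Y b c d) (d * S.Mr Y d) := by
    refine hb.cConverges hX hY _ _ _ (hins _ ‖S.Ml X b‖ _ (norm_nonneg _) ?_ hMlD hXr)
      (hins _ ‖S.Mr Y d‖ _ (norm_nonneg _) ?_ hMrD hYr)
    · rw [BiFree.BBSpace.L_mul, mul_assoc]
      exact (norm_mul_le _ _).trans (mul_le_mul_of_nonneg_right (hL _) (norm_nonneg _))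
    · rw [BiFree.BBSpace.R_mul, mul_assoc]
      exact (norm_mul_le _ _).trans (mul_le_mul_of_nonneg_right (hR _) (norm_nonneg _))
  refine ⟨hMl, hMr, hM, hb.cConverges hX hY b c d hΓX hΓY, hC,
    hb.functional_equation hX hY b c d hMl hMr hM hΓX hΓY ?_ ?_ hC⟩
  · exact hins _ _ _ (norm_nonneg _) (hb.insAfter_le _ _) hMlD hXr
  · exact hins _ _ _ (norm_nonneg _) (hb.insAfter_le _ _) hMrD hYr
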